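/- **Setting.** Let $(M,g)$ be a quaternion–Kähler manifold of quaternionic dimension $n\ge 2$: a smooth Riemannian manifold of real dimension $4n$ with a smooth subbundle $Q\subseteq\operatorname{End}TM$, parallel for the Levi-Civita connection $\nabla$ of $g$, whose fibres $Q_p$ are unital subalgebras of $\operatorname{End}T_pM$ isomorphic to the quaternions $\mathbb H$ and satisfy $g(FX,Y)=g(X,\overline F Y)$ for all $F\in Q_p$, $X,Y\in T_pM$. Let $\gamma(F_1,F_2)=\operatorname{Re}(\overline{F_1}F_2)$ be the standard scalar product on $Q_p$, and suppose that the scalar curvature $\kappa$ of $M$ is positive. For a Riemannian metric $h$ with curvature tensor $R_{X,Y}=\nabla_X\nabla_Y-\nabla_Y\nabla_X-\nabla_{[X,Y]}$ write $R(X,Y,U,V)=h(R_{X,Y}U,V)$. The twistor space of $M$ is the manifold $$ZM=\{(p,I)\mid p\in M,\ I\in Q_p,\ I^2=-\mathrm{id}_{T_pM}\},$$ the unit sphere bundle of $\operatorname{Im}Q$. For $(p,I)\in ZM$ let $Q^-_p\subseteq Q_p$ be the plane of all elements that anticommute with $I$. The tangent space of $ZM$ is identified with a direct sum by the isomorphism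 $$T_{(p,I)}ZM\to T_pM\oplus Q^-_p,\qquad \tfrac{d}{dt}\Big|_0(p_t,I_t)\mapsto \tfrac{d}{dt}\Big|_0p_t\ \oplus\ \tfrac12\,I\Big(\tfrac{\nabla}{dt}\Big|_0I_t\Big),$$ and carries the complex structure and the metric $$I^Z(X\oplus x)=IX\oplus Ix,\qquad g^Z(X\oplus x,Y\oplus y)=g(X,Y)+\frac{16n(n+2)}{\kappa}\,\gamma(x,y).$$ Let $R^Z$ and $\kappa^Z$ be the Riemann curvature tensor and the scalar curvature of $(ZM,g^Z)$. The holomorphic bisectional curvature of $ZM$ is $$K^Z(a,b)=g^Z\big(R^Z_{a,I^Za}I^Zb,\,b\big)\qquad(a,b\in T_{(p,I)}ZM).$$ Let $m=2n+1=\dim_{\mathbb C}ZM$. The curvature tensor of the complex projective space of the same dimension and the same scalar curvature as $ZM$ is, on $(T_{(p,I)}ZM,g^Z,I^Z)$, $$R^{\mathbb{CP}}_{a,b}=-\frac{\kappa^Z}{4m(m+1)}\Big(a\wedge b+I^Za\wedge I^Zb+2\,g^Z(I^Za,b)\,I^Z\Big),\qquad (a\wedge b)c=g^Z(a,c)\,b-g^Z(b,c)\,a,$$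 and its holomorphic bisectional curvature is $K^{\mathbb{CP}}(a,b)=g^Z(R^{\mathbb{CP}}_{a,I^Za}I^Zb,b)$. Finally, the quaternionic bisectional curvature of $M$ at $(p,I)$ is, for $X,Y\in T_pM$, $$K_{\mathbb H,I}(X,Y)=R(X,IX,IY,Y)+\frac{\kappa}{8n(n+2)}\Big(g(JX,Y)^2+g(KX,Y)^2\Big),$$ where $J,K$ is any orthonormal basis of $Q^-_p$ with respect to $\gamma$. **Proposition.** For every $(p,I)\in ZM$, every $\gamma$-orthonormal basis $J,K$ of $Q^-_p$, all $X,Y\in T_pM$ and all $x,y\in Q^-_p$, $$K^Z(X\oplus x,\,Y\oplus y)=K_{\mathbb H,I}(X,Y)+K^{\mathbb{CP}}(X\oplus x,\,Y\oplus y)-K^{\mathbb{CP}}(X\oplus 0,\,Y\oplus 0).$$ -/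

import Mathlib

set_option linter.unusedSectionVars false

open scoped Manifold ContDiff Quaternion Bundle

noncomputable section

namespace TwistorCurvature

section Local

variable {V : Type*} [NormedAddCommGroup V] [NormedSpace ℝ V]

/-- For a metric `G` on a vector space, varying with the point, the Christoffel symbols of the first
kind at `u`: `Γ(v, w, z) = (D_v G(w, z) + D_w G(v, z) - D_z G(v, w)) / 2`. -/
def christoffelLower (G : V → V →L[ℝ] V →L[ℝ] ℝ) (u v : V) : V →L[ℝ] V →L[ℝ] ℝ :=
  (1 / 2 : ℝ) • (fderiv ℝ G u v + (fderiv ℝ G u).flip v - ((fderiv ℝ G u).flip v).flip)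

set_option synthInstance.maxHeartbeats 200000 in
theorem christoffelLower_apply (G : V → V →L[ℝ] V →L[ℝ] ℝ) (u v w z : V) :
    christoffelLower G u v w z =
      (1 / 2 : ℝ) * (fderiv ℝ G u v w z + fderiv ℝ G u w v z - fderiv ℝ G u z v w) := by
  simp [christoffelLower]

/-- The Christoffel symbols (of the second kind) at `u`: `christoffel G u v w = Γ_u(v, w)`, so that the
Levi-Civita connection of `G` is `∇_v W = D_v W + Γ(v, W)`. -/
def christoffel (G : V → V →L[ℝ] V →L[ℝ] ℝ) (u v : V) : V →L[ℝ] V :=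
  (G u).inverse.comp (christoffelLower G u v)

set_option synthInstance.maxHeartbeats 200000 in
theorem christoffelLower_add (G : V → V →L[ℝ] V →L[ℝ] ℝ) (u v v' : V) :
    christoffelLower G u (v + v') = christoffelLower G u v + christoffelLower G u v' := by
  ext w z; simp only [christoffelLower_apply, map_add, add_apply]; ring

set_option synthInstance.maxHeartbeats 200000 in
theorem christoffelLower_smul (G : V → V →L[ℝ] V →L[ℝ] ℝ) (u v : V) (c : ℝ) :
    christoffelLower G u (c • v) = c • christoffelLower G u v := by
  ext w z
  simp only [christoffelLower_apply, map_smul, smul_apply, smul_eq_mul]; ring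

theorem christoffel_add (G : V → V →L[ℝ] V →L[ℝ] ℝ) (u v v' : V) :
    christoffel G u (v + v') = christoffel G u v + christoffel G u v' := by
  ext w; simp [christoffel, christoffelLower_add]

theorem christoffel_smul (G : V → V →L[ℝ] V →L[ℝ] ℝ) (u v : V) (c : ℝ) :
    christoffel G u (c • v) = c • christoffel G u v := by
  ext w; simp [christoffel, christoffelLower_smul]

/-- The expression `a ↦ D a + Γ(L a) ∘ A - A ∘ Γ(L a)`, as a linear map. -/
def covDerivCoord {V' : Type*} [NormedAddCommGroup V'] [NormedSpace ℝ V']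
    (G : V → V →L[ℝ] V →L[ℝ] ℝ) (u : V) (L : V' →L[ℝ] V) (D : V' →L[ℝ] (V →L[ℝ] V)) (A : V →L[ℝ] V) :
    V' →ₗ[ℝ] (V →L[ℝ] V) where
  toFun a := D a + (christoffel G u (L a)).comp A - A.comp (christoffel G u (L a))
  map_add' a b := by
    simp only [map_add, christoffel_add, ContinuousLinearMap.add_comp, ContinuousLinearMap.comp_add]
    abel
  map_smul' c a := by
    simp only [map_smul, christoffel_smul, ContinuousLinearMap.smul_comp, ContinuousLinearMap.comp_smul,
      RingHom.id_apply, smul_sub, smul_add]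

/-- The Riemann curvature tensor of `G` at `u`,
`R_{v, w} z = D_v Γ(w, z) - D_w Γ(v, z) + Γ(v, Γ(w, z)) - Γ(w, Γ(v, z))`, that is
`R_{v, w} = ∇_v ∇_w - ∇_w ∇_v - ∇_[v, w]`. -/
def localCurvature (G : V → V →L[ℝ] V →L[ℝ] ℝ) (u v w : V) : V →L[ℝ] V :=
  fderiv ℝ (fun x ↦ christoffel G x w) u v - fderiv ℝ (fun x ↦ christoffel G x v) u w
    + (christoffel G u v).comp (christoffel G u w)
    - (christoffel G u w).comp (christoffel G u v)

/-- The Ricci tensor `Ric(w, z) = trace (v ↦ R_{v, w} z)` of `G` at `u`. -/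
def localRicci [FiniteDimensional ℝ V] (G : V → V →L[ℝ] V →L[ℝ] ℝ) (u w z : V) : ℝ :=
  ∑ i, (Module.finBasis ℝ V).coord i (localCurvature G u (Module.finBasis ℝ V i) w z)

/-- The scalar curvature `∑ g^{jk} Ric_{jk}` of `G` at `u`. -/
def localScalarCurvature [FiniteDimensional ℝ V] (G : V → V →L[ℝ] V →L[ℝ] ℝ) (u : V) : ℝ :=
  ∑ j, ∑ k, (Module.finBasis ℝ V).coord j
      ((G u).inverse (LinearMap.toContinuousLinearMap ((Module.finBasis ℝ V).coord k))) *
    localRicci G u (Module.finBasis ℝ V j) (Module.finBasis ℝ V k)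

end Local

section Manifold

variable {V : Type*} [NormedAddCommGroup V] [NormedSpace ℝ V]
  {N : Type*} [TopologicalSpace N] [ChartedSpace V N]

/-- A field `g` of bilinear forms on the tangent spaces of a manifold, written in the preferred chart at
`p`: its pull-back to the model space by the inverse of that chart. In Mathlib the tangent space at `p`
is the model space, identified through the preferred chart at `p`, so no identification is needed at
`p` itself. -/
def coordMetric
    (g : ∀ p : N, TangentSpace 𝓘(ℝ, V) p →L[ℝ] TangentSpace 𝓘(ℝ, V) p →L[ℝ] ℝ) (p : N) (u : V) :
    V →L[ℝ] V →L[ℝ] ℝ :=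
  let q : N := (extChartAt 𝓘(ℝ, V) p).symm u
  let d : V →L[ℝ] V := mfderiv 𝓘(ℝ, V) 𝓘(ℝ, V) (extChartAt 𝓘(ℝ, V) p).symm u
  let b : V →L[ℝ] V →L[ℝ] ℝ := g q
  b.bilinearComp d d

/-- The Riemann curvature tensor `R_{a, b} : T_p N → T_p N` of a metric `g` on a manifold, computed in the
preferred chart at `p`. -/
def riemannCurvature
    (g : ∀ p : N, TangentSpace 𝓘(ℝ, V) p →L[ℝ] TangentSpace 𝓘(ℝ, V) p →L[ℝ] ℝ) (p : N)
    (a b : TangentSpace 𝓘(ℝ, V) p) : TangentSpace 𝓘(ℝ, V) p →L[ℝ] TangentSpace 𝓘(ℝ, V) p :=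
  let R : V →L[ℝ] V := localCurvature (V := V) (coordMetric g p) (extChartAt 𝓘(ℝ, V) p p) a b
  R

/-- The scalar curvature of a metric `g` on a manifold at `p`. -/
def scalarCurvature [FiniteDimensional ℝ V]
    (g : ∀ p : N, TangentSpace 𝓘(ℝ, V) p →L[ℝ] TangentSpace 𝓘(ℝ, V) p →L[ℝ] ℝ) (p : N) : ℝ :=
  localScalarCurvature (coordMetric g p) (extChartAt 𝓘(ℝ, V) p p)

/-- An endomorphism of `T_q N`, written in the coordinates of the preferred chart at `p`. -/
def endCoord [IsManifold 𝓘(ℝ, V) 1 N] (p q : N)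
    (A : TangentSpace 𝓘(ℝ, V) q →L[ℝ] TangentSpace 𝓘(ℝ, V) q) : V →L[ℝ] V :=
  ContinuousLinearMap.inCoordinates V (TangentSpace 𝓘(ℝ, V)) V (TangentSpace 𝓘(ℝ, V)) p q p q A

variable {N' V' : Type*} [NormedAddCommGroup V'] [NormedSpace ℝ V'] [TopologicalSpace N']
    [ChartedSpace V' N'] [IsManifold 𝓘(ℝ, V) 1 N]

/-- The covariant derivative, for the Levi-Civita connection of `g`, of a field `σ w` of endomorphisms of
`T_{f w} N` along a map `f : N' → N`; in the chart at `f w` it is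
`D_a σ + Γ(df a) ∘ σ - σ ∘ Γ(df a)`. -/
def covDerivEnd
    (g : ∀ p : N, TangentSpace 𝓘(ℝ, V) p →L[ℝ] TangentSpace 𝓘(ℝ, V) p →L[ℝ] ℝ)
    (f : N' → N) (σ : ∀ w : N', TangentSpace 𝓘(ℝ, V) (f w) →L[ℝ] TangentSpace 𝓘(ℝ, V) (f w))
    (w : N') : TangentSpace 𝓘(ℝ, V') w →ₗ[ℝ]
      (TangentSpace 𝓘(ℝ, V) (f w) →L[ℝ] TangentSpace 𝓘(ℝ, V) (f w)) :=
  covDerivCoord (V := V) (V' := V') (coordMetric g (f w)) (extChartAt 𝓘(ℝ, V) (f w) (f w))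
    (mfderiv 𝓘(ℝ, V') 𝓘(ℝ, V) f w)
    (mfderiv 𝓘(ℝ, V') 𝓘(ℝ, V →L[ℝ] V) (fun x ↦ endCoord (f w) (f x) (σ x)) w)
    (σ w)

/-- The covariant derivative `∇_v σ` of a field `σ` of endomorphisms of `TN`. -/
def covDerivSection
    (g : ∀ p : N, TangentSpace 𝓘(ℝ, V) p →L[ℝ] TangentSpace 𝓘(ℝ, V) p →L[ℝ] ℝ)
    (σ : ∀ q : N, TangentSpace 𝓘(ℝ, V) q →L[ℝ] TangentSpace 𝓘(ℝ, V) q) (p : N) :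
    TangentSpace 𝓘(ℝ, V) p →ₗ[ℝ] (TangentSpace 𝓘(ℝ, V) p →L[ℝ] TangentSpace 𝓘(ℝ, V) p) :=
  covDerivEnd (V := V) (V' := V) g id σ p

end Manifold

section Pointwise

variable {T : Type*} [TopologicalSpace T] [AddCommGroup T] [Module ℝ T]

/-- The endomorphism `a ∧ b` of a vector space with inner product `h`:
`(a ∧ b) c = h(a, c) b - h(b, c) a`. -/
def wedgeEnd (h : T →L[ℝ] T →L[ℝ] ℝ) (a b c : T) : T := h a c • b - h b c • a

/-- The curvature tensor of the complex projective space of complex dimension `m` and scalar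
curvature `s` with its Fubini-Study metric, on a tangent space with metric `h` and complex
structure `J`:
`R_{a, b} = - s / (4 m (m + 1)) (a ∧ b + J a ∧ J b + 2 h(J a, b) J)`. -/
def complexProjectiveCurvature (m : ℕ) (s : ℝ) (h : T →L[ℝ] T →L[ℝ] ℝ) (J : T → T) (a b c : T) :
    T :=
  -(s / (4 * m * (m + 1))) •
    (wedgeEnd h a b c + wedgeEnd h (J a) (J b) c + (2 * h (J a) b) • J c)

/-- The holomorphic bisectional curvature `K(a, b) = R(a, J a, J b, b)` of a curvature tensor `R`
with respect to a metric `h` and a complex structure `J`, where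
`R(a, b, c, d) = h(R_{a, b} c, d)`. -/
def holomorphicBisectional (h : T →L[ℝ] T →L[ℝ] ℝ) (R : T → T → T → T) (J : T → T) (a b : T) : ℝ :=
  h (R a (J a) (J b)) b

end Pointwise

section Twistor
variable {E : Type*} [NormedAddCommGroup E] [NormedSpace ℝ E]
  {M : Type*} [TopologicalSpace M] [ChartedSpace E M]

variable (E) in
/-- The endomorphisms of the tangent space at `p`. -/
abbrev EndT (p : M) : Type _ := TangentSpace 𝓘(ℝ, E) p →L[ℝ] TangentSpace 𝓘(ℝ, E) p

/-- The trace of an endomorphism of `T_p M`. -/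
def trEnd {p : M} : EndT E p →ₗ[ℝ] ℝ :=
  (LinearMap.trace ℝ (TangentSpace 𝓘(ℝ, E) p)).comp (ContinuousLinearMap.coeLM ℝ)

/-- A smooth frame of the imaginary part of `Q` on the open set `U`: three smooth anticommuting almost
complex structures on `U` with values in `Q`, which together with the identity span `Q`. -/
structure IsLocalFrame [IsManifold 𝓘(ℝ, E) ∞ M] (Q : ∀ p : M, Subalgebra ℝ (EndT E p)) (U : Set M)
    (e : Fin 3 → ∀ q : M, EndT E q) : Prop where
  isOpen : IsOpen U
  smooth : ∀ i, ContMDiffOn 𝓘(ℝ, E) (𝓘(ℝ, E).prod 𝓘(ℝ, E →L[ℝ] E)) ∞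
    (fun q ↦ Bundle.TotalSpace.mk' (E →L[ℝ] E) (E := fun q : M ↦ EndT E q) q (e i q)) U
  mem : ∀ q ∈ U, ∀ i, e i q ∈ Q q
  sq : ∀ q ∈ U, ∀ i, e i q * e i q = -1
  anticomm : ∀ q ∈ U, ∀ i j, i ≠ j → e i q * e j q = -(e j q * e i q)
  span : ∀ q ∈ U, ∀ F ∈ Q q, ∃ (a : ℝ) (s : Fin 3 → ℝ), F = a • (1 : EndT E q) + ∑ i, s i • e i q

/-- A quaternion-Kähler structure of quaternionic dimension `n ≥ 2` on a Riemannian manifold `(M, g)` of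
dimension `4 n`: a smooth subbundle `Q` of unital subalgebras of `End TM` which is parallel for the
Levi-Civita connection, whose fibres are isomorphic to the quaternions and satisfy
`g(F X, Y) = g(X, conj F Y)`. -/
structure QuaternionKahlerStructure [IsManifold 𝓘(ℝ, E) ∞ M] (n : ℕ)
    (g : Bundle.ContMDiffRiemannianMetric 𝓘(ℝ, E) ∞ E (fun p : M ↦ TangentSpace 𝓘(ℝ, E) p)) where
  Q : ∀ p : M, Subalgebra ℝ (EndT E p)
  finrank_eq : Module.finrank ℝ E = 4 * n
  two_le : 2 ≤ n
  quaternionic : ∀ p, ∃ φ : Q p ≃ₐ[ℝ] ℍ[ℝ], ∀ (F : Q p) (X Y : TangentSpace 𝓘(ℝ, E) p),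
    g.inner p (F.1 X) Y = g.inner p X ((φ.symm (star (φ F))).1 Y)
  smooth : ∀ p, ∃ U, p ∈ U ∧ ∃ e, IsLocalFrame Q U e
  parallel : ∀ (p : M) (σ : ∀ q : M, EndT E q),
    ContMDiffAt 𝓘(ℝ, E) (𝓘(ℝ, E).prod 𝓘(ℝ, E →L[ℝ] E)) ∞
      (fun q ↦ Bundle.TotalSpace.mk' (E →L[ℝ] E) (E := fun q : M ↦ EndT E q) q (σ q)) p →
    (∀ᶠ q in nhds p, σ q ∈ Q q) →
    ∀ v : TangentSpace 𝓘(ℝ, E) p, covDerivSection g.inner σ p v ∈ Q p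

variable [IsManifold 𝓘(ℝ, E) ∞ M]

theorem endCoord_mul {p q : M} (hq : q ∈ (chartAt E p).source) (A B : EndT E q) :
    endCoord p q (A * B) = endCoord p q A * endCoord p q B := by
  have hb : q ∈ (trivializationAt E (TangentSpace 𝓘(ℝ, E)) p).baseSet := by simpa using hq
  simp only [endCoord]
  rw [ContinuousLinearMap.inCoordinates_eq hb hb, ContinuousLinearMap.inCoordinates_eq hb hb,
    ContinuousLinearMap.inCoordinates_eq hb hb]
  set c := (trivializationAt E (TangentSpace 𝓘(ℝ, E)) p).continuousLinearEquivAt ℝ q hb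
  ext v
  change c (A (B (c.symm v))) = c (A (c.symm (c (B (c.symm v)))))
  rw [c.symm_apply_apply]

theorem trEnd_eq_endCoord {p q : M} (hq : q ∈ (chartAt E p).source) (A : EndT E q) :
    trEnd A = LinearMap.trace ℝ E (endCoord p q A) := by
  have hb : q ∈ (trivializationAt E (TangentSpace 𝓘(ℝ, E)) p).baseSet := by simpa using hq
  simp only [endCoord]
  rw [ContinuousLinearMap.inCoordinates_eq hb hb]
  set c := (trivializationAt E (TangentSpace 𝓘(ℝ, E)) p).continuousLinearEquivAt ℝ q hb
  change LinearMap.trace ℝ (TangentSpace 𝓘(ℝ, E) q) A = _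
  rw [← LinearMap.trace_conj' _ c.toLinearEquiv]
  congr 1

theorem endCoord_self {p : M} (A : EndT E p) : endCoord p p A = A := by
  have h1 := TangentBundle.continuousLinearMapAt_trivializationAt_eq_core (I := 𝓘(ℝ, E))
    (mem_chart_source E p)
  have h2 := TangentBundle.symmL_trivializationAt_eq_core (I := 𝓘(ℝ, E))
    (mem_chart_source E p)
  simp only [endCoord, ContinuousLinearMap.inCoordinates]
  rw [h1, h2]
  ext v
  have h := (tangentBundleCore 𝓘(ℝ, E) M).coordChange_self (achart E p) p (mem_achart_source E p)
  exact (h _).trans (congrArg A (h v))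

theorem endCoord_neg_one {p q : M} (hq : q ∈ (chartAt E p).source) :
    endCoord p q (-1 : EndT E q) = -1 := by
  have hb : q ∈ (trivializationAt E (TangentSpace 𝓘(ℝ, E)) p).baseSet := by simpa using hq
  simp only [endCoord]
  rw [ContinuousLinearMap.inCoordinates_eq hb hb]
  set c := (trivializationAt E (TangentSpace 𝓘(ℝ, E)) p).continuousLinearEquivAt ℝ _ hb
  ext v
  change c (-(c.symm v)) = -v
  rw [map_neg, c.apply_symm_apply]

theorem endCoord_of_eq {p q : M} (h : q = p) (e : ∀ q : M, EndT E q) :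
    endCoord p q (e q) = e p := by
  subst h; exact endCoord_self _

theorem contMDiffOn_trEnd [FiniteDimensional ℝ E] {U : Set M} {σ τ : ∀ q : M, EndT E q}
    (hσ : ContMDiffOn 𝓘(ℝ, E) (𝓘(ℝ, E).prod 𝓘(ℝ, E →L[ℝ] E)) ∞
      (fun q ↦ Bundle.TotalSpace.mk' (E →L[ℝ] E) (E := fun q : M ↦ EndT E q) q (σ q)) U)
    (hτ : ContMDiffOn 𝓘(ℝ, E) (𝓘(ℝ, E).prod 𝓘(ℝ, E →L[ℝ] E)) ∞
      (fun q ↦ Bundle.TotalSpace.mk' (E →L[ℝ] E) (E := fun q : M ↦ EndT E q) q (τ q)) U) :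
    ContMDiffOn 𝓘(ℝ, E) 𝓘(ℝ, ℝ) ∞ (fun q ↦ trEnd (σ q * τ q)) U := by
  intro p hp
  have h1 := ((contMDiffWithinAt_hom_bundle _).1 (hσ p hp)).2
  have h2 := ((contMDiffWithinAt_hom_bundle _).1 (hτ p hp)).2
  let T : (E →L[ℝ] E) →L[ℝ] ℝ := LinearMap.toContinuousLinearMap
    ((LinearMap.trace ℝ E).comp (ContinuousLinearMap.coeLM ℝ))
  have h3 := (T.contMDiff (n := ∞)).contMDiffAt.comp_contMDiffWithinAt p (h1.clm_comp h2)
  refine h3.congr_of_eventuallyEq ?_ ?_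
  · filter_upwards [mem_nhdsWithin_of_mem_nhds (chart_source_mem_nhds E p)] with q hq
    rw [trEnd_eq_endCoord hq, endCoord_mul hq]
    rfl
  · rw [trEnd_eq_endCoord (mem_chart_source E p), endCoord_mul (mem_chart_source E p)]
    rfl

/-! ### Algebra of local frames -/
theorem trEnd_mul_comm {p : M} (A B : EndT E p) : trEnd (A * B) = trEnd (B * A) :=
  LinearMap.trace_mul_comm ℝ (A : TangentSpace 𝓘(ℝ, E) p →ₗ[ℝ] _) (B : TangentSpace 𝓘(ℝ, E) p →ₗ[ℝ] _)

theorem trEnd_one [FiniteDimensional ℝ E] {p : M} : trEnd (1 : EndT E p) = Module.finrank ℝ E := by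
  exact LinearMap.trace_one ℝ E

/-- The number `- trace (A B) / dim M`, the coordinate of `B` with respect to a member `A` of an
orthonormal frame of the imaginary part of `Q`. -/
def coordEnd {p : M} (A B : EndT E p) : ℝ := -trEnd (A * B) / Module.finrank ℝ E

namespace IsLocalFrame
variable {Q : ∀ p : M, Subalgebra ℝ (EndT E p)} {U : Set M} {e : Fin 3 → ∀ q : M, EndT E q}

section

theorem tr_mul (he : IsLocalFrame Q U e) {q : M} (hq : q ∈ U)
    {i j : Fin 3} (hij : i ≠ j) : trEnd (e i q * e j q) = 0 := by
  have h := congrArg trEnd (he.anticomm q hq i j hij)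
  rw [map_neg, trEnd_mul_comm] at h
  rw [trEnd_mul_comm]; linarith

theorem tr_eq_zero (he : IsLocalFrame Q U e) {q : M} (hq : q ∈ U)
    (i : Fin 3) : trEnd (e i q) = 0 := by
  obtain ⟨j, hij⟩ : ∃ j : Fin 3, i ≠ j := by
    fin_cases i
    · exact ⟨1, by decide⟩
    · exact ⟨0, by decide⟩
    · exact ⟨0, by decide⟩
  have h1 : e j q * (e i q * e j q) = e i q := by
    rw [he.anticomm q hq i j hij, mul_neg, ← mul_assoc, he.sq q hq]; simp
  have h2 := congrArg trEnd h1
  rw [trEnd_mul_comm, mul_assoc, he.sq q hq] at h2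
  simp at h2; linarith

theorem tr_comb [FiniteDimensional ℝ E] (he : IsLocalFrame Q U e) {q : M} (hq : q ∈ U)
    (i : Fin 3) (s : Fin 3 → ℝ) :
    trEnd (e i q * ∑ j, s j • e j q) = - s i * Module.finrank ℝ E := by
  rw [Finset.mul_sum, map_sum, Finset.sum_eq_single i]
  · rw [mul_smul_comm, he.sq q hq, map_smul, map_neg, trEnd_one]; simp
  · intro j _ hj
    rw [mul_smul_comm, map_smul, he.tr_mul hq hj.symm, smul_zero]
  · simp

theorem coord_comb [FiniteDimensional ℝ E] (he : IsLocalFrame Q U e)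
    (hE : 0 < Module.finrank ℝ E) {q : M} (hq : q ∈ U)
    (i : Fin 3) (s : Fin 3 → ℝ) :
    coordEnd (e i q) (∑ j, s j • e j q) = s i := by
  rw [coordEnd, he.tr_comb hq]; field_simp

theorem comb_sq (he : IsLocalFrame Q U e) {q : M} (hq : q ∈ U)
    (s : Fin 3 → ℝ) :
    (∑ j, s j • e j q) * (∑ j, s j • e j q) = -(∑ j, s j ^ 2) • (1 : EndT E q) := by
  have h10 := he.anticomm q hq 1 0 (by decide)
  have h20 := he.anticomm q hq 2 0 (by decide)
  have h21 := he.anticomm q hq 2 1 (by decide)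
  have h0 := he.sq q hq 0
  have h1 := he.sq q hq 1
  have h2 := he.sq q hq 2
  simp only [Fin.sum_univ_three, mul_add, add_mul, smul_mul_smul_comm, h10, h20, h21, h0, h1, h2]
  module

theorem eq_comb [FiniteDimensional ℝ E] (he : IsLocalFrame Q U e)
    (hE : 0 < Module.finrank ℝ E) {q : M} (hq : q ∈ U)
    {F : EndT E q} (hF : F ∈ Q q) (hsq : F * F = -1) :
    F = ∑ j, coordEnd (e j q) F • e j q ∧ ∑ j, coordEnd (e j q) F ^ 2 = 1 := by
  obtain ⟨a, s, h⟩ := he.span q hq F hF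
  set W := ∑ i, s i • e i q with hW
  have hE' : (Module.finrank ℝ E : ℝ) ≠ 0 := by positivity
  have hWW := he.comb_sq hq s
  rw [← hW] at hWW
  have hFF : F * F = (a ^ 2 - ∑ j, s j ^ 2) • (1 : EndT E q) + (2 * a) • W := by
    rw [h, mul_add, add_mul, add_mul, hWW]
    simp only [smul_mul_assoc, mul_smul_comm, one_mul, mul_one]
    module
  rw [hsq] at hFF
  have hWtr : trEnd W = 0 := by
    rw [hW, map_sum]; exact Finset.sum_eq_zero fun i _ ↦ by rw [map_smul, he.tr_eq_zero hq, smul_zero]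
  have e1 : a ^ 2 - ∑ j, s j ^ 2 = -1 := by
    have := congrArg trEnd hFF
    simp only [map_add, map_smul, map_neg, trEnd_one, hWtr, smul_eq_mul] at this
    have h3 : (a ^ 2 - ∑ j, s j ^ 2 + 1) * (Module.finrank ℝ E : ℝ) = 0 := by linarith
    rcases mul_eq_zero.1 h3 with h3 | h3
    · linarith
    · exact absurd h3 hE'
  have e2 : ∀ i, a * s i = 0 := by
    intro i
    have := congrArg (fun A ↦ trEnd (e i q * A)) hFF
    simp only [mul_add, mul_smul_comm, mul_one, mul_neg, map_add, map_smul, map_neg,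
      he.tr_eq_zero hq, smul_eq_mul, hW, he.tr_comb hq] at this
    have h3 : (a * s i) * (Module.finrank ℝ E : ℝ) = 0 := by linarith
    exact (mul_eq_zero.1 h3).resolve_right hE'
  have ha : a = 0 := by
    by_contra ha
    have : ∀ i, s i = 0 := fun i ↦ (mul_eq_zero.1 (e2 i)).resolve_left ha
    simp only [this] at e1
    norm_num at e1
    nlinarith [sq_nonneg a]
  have hFW : F = W := by rw [h, ha]; simp
  have hc : ∀ j, coordEnd (e j q) F = s j := fun j ↦ by rw [hFW, hW, he.coord_comb hE hq]
  simp only [hc]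
  refine ⟨hFW, ?_⟩
  rw [ha] at e1; linarith

end

theorem contMDiffOn_coord [FiniteDimensional ℝ E] {U' : Set M} {e' : Fin 3 → ∀ q : M, EndT E q}
    (he : IsLocalFrame Q U e) (he' : IsLocalFrame Q U' e') (i j : Fin 3) :
    ContMDiffOn 𝓘(ℝ, E) 𝓘(ℝ, ℝ) ∞ (fun q ↦ coordEnd (e' i q) (e j q)) (U ∩ U') := by
  have := contMDiffOn_trEnd ((he'.smooth i).mono (t := U ∩ U') Set.inter_subset_right)
    ((he.smooth j).mono (t := U ∩ U') Set.inter_subset_left)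
  simp only [coordEnd, div_eq_mul_inv]
  exact this.neg.mul contMDiffOn_const

end IsLocalFrame

theorem IsLocalFrame.exists_pos [FiniteDimensional ℝ E] {Q : ∀ p : M, Subalgebra ℝ (EndT E p)}
    {U : Set M} {e : Fin 3 → ∀ q : M, EndT E q} (he : IsLocalFrame Q U e)
    (hE : 0 < Module.finrank ℝ E) {q : M} (hq : q ∈ U)
    {F : EndT E q} (hF : F ∈ Q q) (hsq : F * F = -1) :
    ∃ e', IsLocalFrame Q U e' ∧ 0 < coordEnd (e' 0 q) F := by
  obtain ⟨h1, h2⟩ := he.eq_comb hE hq hF hsq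
  obtain ⟨j, hj⟩ : ∃ j, coordEnd (e j q) F ≠ 0 := by
    by_contra! h
    simp [h] at h2
  have key : ∀ ε : ℝ, ε * ε = 1 →
      IsLocalFrame Q U (fun i q ↦ ε • e (Equiv.swap 0 j i) q) := by
    intro ε hε
    refine ⟨he.isOpen, fun i ↦ ?_, fun q hq i ↦ ?_, fun q hq i ↦ ?_, fun q hq i k hik ↦ ?_,
      fun q hq A hA ↦ ?_⟩
    · exact ContMDiffOn.smul_section (f := fun _ : M ↦ ε) contMDiffOn_const
        (he.smooth (Equiv.swap 0 j i))
    · exact (Q q).smul_mem (he.mem q hq _) ε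
    · rw [smul_mul_smul_comm, hε, he.sq q hq, one_smul]
    · rw [smul_mul_smul_comm, smul_mul_smul_comm, he.anticomm q hq _ (Equiv.swap 0 j k)
        (fun h ↦ hik ((Equiv.swap 0 j).injective h)), smul_neg]
    · obtain ⟨a, s, h⟩ := he.span q hq A hA
      refine ⟨a, fun i ↦ ε * s (Equiv.swap 0 j i), ?_⟩
      rw [h]
      congr 1
      rw [← Equiv.sum_comp (Equiv.swap 0 j)]
      refine Finset.sum_congr rfl fun i _ ↦ ?_
      rw [smul_smul, mul_right_comm, hε, one_mul]
  rcases lt_or_gt_of_ne hj with hneg | hpos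
  · refine ⟨_, key (-1) (by norm_num), ?_⟩
    simp only [Equiv.swap_apply_left, coordEnd, smul_mul_assoc, map_smul] at hneg ⊢
    rw [smul_eq_mul, neg_one_mul]
    rw [neg_div] at hneg ⊢
    rw [neg_div]
    linarith
  · refine ⟨_, key 1 (by norm_num), ?_⟩
    simpa using hpos

variable {n : ℕ}
    {g : Bundle.ContMDiffRiemannianMetric 𝓘(ℝ, E) ∞ E (fun p : M ↦ TangentSpace 𝓘(ℝ, E) p)}

namespace QuaternionKahlerStructure
theorem finrank_pos (S : QuaternionKahlerStructure n g) : 0 < Module.finrank ℝ E := by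
  have := S.finrank_eq; have := S.two_le; omega

theorem finiteDimensional (S : QuaternionKahlerStructure n g) : FiniteDimensional ℝ E :=
  Module.finite_of_finrank_pos S.finrank_pos
end QuaternionKahlerStructure

/-- The twistor space `ZM = {(p, I) | I ∈ Q_p, I² = -1}`. -/

structure TwistorSpace (S : QuaternionKahlerStructure n g) where
  pt : M
  cx : EndT E pt
  mem : cx ∈ S.Q pt
  sq : cx * cx = -1

variable (E) in
/-- The model space of the twistor space. -/
abbrev TwistorModel : Type _ := E × EuclideanSpace ℝ (Fin 2)

namespace TwistorSpace

variable {S : QuaternionKahlerStructure n g}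

/-- Central projection of the unit sphere: `t ↦ (1, t₀, t₁) / √(1 + t₀² + t₁²)`. -/
def sphereCoeff (t : EuclideanSpace ℝ (Fin 2)) (i : Fin 3) : ℝ :=
  ![1, t 0, t 1] i / Real.sqrt (1 + t 0 ^ 2 + t 1 ^ 2)

theorem sphereCoeff_sq (t : EuclideanSpace ℝ (Fin 2)) : ∑ i, sphereCoeff t i ^ 2 = 1 := by
  have h : 0 < 1 + t 0 ^ 2 + t 1 ^ 2 := by positivity
  simp only [Fin.sum_univ_three, sphereCoeff, div_pow, Real.sq_sqrt h.le]
  simp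
  field_simp

theorem sphereCoeff_zero_pos (t : EuclideanSpace ℝ (Fin 2)) : 0 < sphereCoeff t 0 := by
  have h : 0 < 1 + t 0 ^ 2 + t 1 ^ 2 := by positivity
  simp [sphereCoeff]
  positivity

theorem contDiff_sphereCoeff (i : Fin 3) : ContDiff ℝ ∞ (fun t ↦ sphereCoeff t i) := by
  have h : ∀ t : EuclideanSpace ℝ (Fin 2), 1 + t 0 ^ 2 + t 1 ^ 2 ≠ 0 := fun t ↦ by positivity
  have h' : ∀ t : EuclideanSpace ℝ (Fin 2), Real.sqrt (1 + t 0 ^ 2 + t 1 ^ 2) ≠ 0 :=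
    fun t ↦ by positivity
  have c : ∀ j : Fin 2, ContDiff ℝ ∞ (fun t : EuclideanSpace ℝ (Fin 2) ↦ t j) := fun j ↦ by fun_prop
  have hs : ContDiff ℝ ∞ (fun t : EuclideanSpace ℝ (Fin 2) ↦ Real.sqrt (1 + t 0 ^ 2 + t 1 ^ 2)) :=
    ContDiff.sqrt (by fun_prop) h
  unfold sphereCoeff
  fin_cases i
  · exact ContDiff.div contDiff_const hs h'
  · exact ContDiff.div (c 0) hs h'
  · exact ContDiff.div (c 1) hs h'

/-- The point of the twistor space over `q` with fibre coordinate `t` in the frame `e`. -/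
def ofFrame {U : Set M} {e : Fin 3 → ∀ q : M, EndT E q} (he : IsLocalFrame S.Q U e) {q : M}
    (hq : q ∈ U) (t : EuclideanSpace ℝ (Fin 2)) : TwistorSpace S where
  pt := q
  cx := ∑ i, sphereCoeff t i • e i q
  mem := Subalgebra.sum_mem _ fun i _ ↦ Subalgebra.smul_mem _ (he.mem q hq i) _
  sq := by rw [he.comb_sq hq, sphereCoeff_sq, neg_smul, one_smul]

theorem ext_coord {U : Set M} {e : Fin 3 → ∀ q : M, EndT E q} (he : IsLocalFrame S.Q U e)
    {z w : TwistorSpace S} (hz : z.pt ∈ U) (h : z.pt = w.pt)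
    (hc : ∀ i, coordEnd (e i z.pt) z.cx = coordEnd (e i w.pt) w.cx) : z = w := by
  have := S.finiteDimensional
  obtain ⟨p, A, hA, hA'⟩ := z
  obtain ⟨q, B, hB, hB'⟩ := w
  obtain rfl : p = q := h
  have : A = B := by
    rw [(he.eq_comb S.finrank_pos hz hA hA').1, (he.eq_comb S.finrank_pos hz hB hB').1]
    simp only at hc
    simp only [hc]
  subst this
  rfl

open Classical in
/-- A chart of the twistor space, from a chart of `M` and a local frame `e`: the half sphere of those
`I = c₀ e₀ + c₁ e₁ + c₂ e₂` with `c₀ > 0` in each fibre has the coordinates `(c₁ / c₀, c₂ / c₀)`. -/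
def frameChart (x₀ : M) {U : Set M} {e : Fin 3 → ∀ q : M, EndT E q} (he : IsLocalFrame S.Q U e)
    (z₀ : TwistorSpace S) : PartialEquiv (TwistorSpace S) (TwistorModel E) where
  toFun z := (chartAt E x₀ z.pt,
    !₂[coordEnd (e 1 z.pt) z.cx / coordEnd (e 0 z.pt) z.cx,
       coordEnd (e 2 z.pt) z.cx / coordEnd (e 0 z.pt) z.cx])
  invFun x := if h : (chartAt E x₀).symm x.1 ∈ U then ofFrame he h x.2 else z₀
  source := {z | z.pt ∈ (chartAt E x₀).source ∧ z.pt ∈ U ∧ 0 < coordEnd (e 0 z.pt) z.cx}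
  target := {x | x.1 ∈ (chartAt E x₀).target ∧ (chartAt E x₀).symm x.1 ∈ U}
  map_source' := by
    rintro z ⟨h1, h2, h3⟩
    refine ⟨(chartAt E x₀).map_source h1, ?_⟩
    simpa only [(chartAt E x₀).left_inv h1] using h2
  map_target' := by
    have := S.finiteDimensional
    rintro x ⟨h1, h2⟩
    rw [dif_pos h2]
    refine ⟨(chartAt E x₀).map_target h1, h2, ?_⟩
    change 0 < coordEnd (e 0 ((chartAt E x₀).symm x.1)) (∑ i, sphereCoeff x.2 i • e i _)
    rw [he.coord_comb S.finrank_pos h2]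
    exact sphereCoeff_zero_pos _
  left_inv' := by
    have := S.finiteDimensional
    rintro z ⟨h1, h2, h3⟩
    have hl := (chartAt E x₀).left_inv h1
    have hU : (chartAt E x₀).symm (chartAt E x₀ z.pt) ∈ U := by rwa [hl]
    rw [dif_pos hU]
    refine ext_coord he hU hl fun i ↦ ?_
    refine (he.coord_comb S.finrank_pos hU i _).trans ?_
    have hs := (he.eq_comb S.finrank_pos h2 z.mem z.sq).2
    simp only [Fin.sum_univ_three] at hs
    set c := fun i ↦ coordEnd (e i z.pt) z.cx with hc
    have hsq : 1 + (c 1 / c 0) ^ 2 + (c 2 / c 0) ^ 2 = (1 / c 0) ^ 2 := by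
      have : c 0 ≠ 0 := ne_of_gt h3
      field_simp
      linarith [hs]
    have h0 : c 0 ≠ 0 := ne_of_gt h3
    have hpos : 0 < 1 / c 0 := one_div_pos.2 h3
    change ![1, c 1 / c 0, c 2 / c 0] i / Real.sqrt (1 + (c 1 / c 0) ^ 2 + (c 2 / c 0) ^ 2) = c i
    rw [hsq, Real.sqrt_sq hpos.le]
    fin_cases i
    · simp
    · simp; field_simp
    · simp; field_simp
  right_inv' := by
    have := S.finiteDimensional
    rintro ⟨u, t⟩ ⟨h1, h2⟩
    simp only
    rw [dif_pos h2]
    have hc : ∀ i, coordEnd (e i ((chartAt E x₀).symm u)) (∑ j, sphereCoeff t j • e j _) = sphereCoeff t i :=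
      fun i ↦ he.coord_comb S.finrank_pos h2 i _
    have h : Real.sqrt (1 + t 0 ^ 2 + t 1 ^ 2) ≠ 0 := by positivity
    refine Prod.ext ((chartAt E x₀).right_inv h1) ?_
    simp only [ofFrame, hc]
    ext i
    fin_cases i <;> simp [sphereCoeff] <;> field_simp

/-- The coordinates, in a second frame, of the point with given coordinates in a first frame. -/
def transCoeff (x₀ : M) (e e' : Fin 3 → ∀ q : M, EndT E q) (i : Fin 3) (x : TwistorModel E) : ℝ :=
  ∑ j, sphereCoeff x.2 j *
    coordEnd (e' i ((chartAt E x₀).symm x.1)) (e j ((chartAt E x₀).symm x.1))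

theorem coordEnd_ofFrame (x₀ : M) {U : Set M} {e e' : Fin 3 → ∀ q : M, EndT E q}
    (he : IsLocalFrame S.Q U e) (i : Fin 3) {x : TwistorModel E}
    (hx : (chartAt E x₀).symm x.1 ∈ U) :
    coordEnd (e' i (ofFrame he hx x.2).pt) (ofFrame he hx x.2).cx = transCoeff x₀ e e' i x := by
  change coordEnd (e' i ((chartAt E x₀).symm x.1)) (∑ j, sphereCoeff x.2 j • e j _) = _
  simp only [coordEnd, transCoeff, Finset.mul_sum, map_sum, mul_smul_comm, map_smul,
    smul_eq_mul, ← Finset.sum_neg_distrib, Finset.sum_div]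
  refine Finset.sum_congr rfl fun j _ ↦ ?_
  ring

section Transition
variable {x₀ x₁ : M} {U U' : Set M} {e e' : Fin 3 → ∀ q : M, EndT E q}
  {he : IsLocalFrame S.Q U e} {he' : IsLocalFrame S.Q U' e'} {z₀ z₁ : TwistorSpace S}

theorem contDiffOn_transCoeff (he : IsLocalFrame S.Q U e) (he' : IsLocalFrame S.Q U' e')
    (i : Fin 3) :
    ContDiffOn ℝ ∞ (transCoeff x₀ e e' i)
      {x : TwistorModel E | x.1 ∈ (chartAt E x₀).target ∧ (chartAt E x₀).symm x.1 ∈ U ∩ U'} := by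
  have := S.finiteDimensional
  refine ContDiffOn.sum fun j _ ↦ ?_
  refine ContDiffOn.mul ((contDiff_sphereCoeff j).comp contDiff_snd).contDiffOn ?_
  rw [← contMDiffOn_iff_contDiffOn]
  have h1 : ContMDiffOn 𝓘(ℝ, TwistorModel E) 𝓘(ℝ, E) ∞ (fun x : TwistorModel E ↦ (chartAt E x₀).symm x.1)
      {x | x.1 ∈ (chartAt E x₀).target ∧ (chartAt E x₀).symm x.1 ∈ U ∩ U'} :=
    (contMDiffOn_chart_symm (I := 𝓘(ℝ, E)) (n := ∞) (x := x₀)).comp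
      (contMDiff_iff_contDiff.2 contDiff_fst).contMDiffOn fun x hx ↦ hx.1
  exact (he.contMDiffOn_coord he' i j).comp h1 fun x hx ↦ hx.2

theorem trans_source (he : IsLocalFrame S.Q U e) (he' : IsLocalFrame S.Q U' e') :
    ((frameChart x₀ he z₀).symm.trans (frameChart x₁ he' z₁)).source =
      {x | (x.1 ∈ (chartAt E x₀).target ∧ (chartAt E x₀).symm x.1 ∈ U ∩ U') ∧
        (chartAt E x₀).symm x.1 ∈ (chartAt E x₁).source ∧ 0 < transCoeff x₀ e e' 0 x} := by
  ext x
  constructor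
  · rintro ⟨⟨h1, h2⟩, h3⟩
    change (frameChart x₀ he z₀).invFun x ∈ (frameChart x₁ he' z₁).source at h3
    simp only [frameChart, dif_pos h2] at h3
    obtain ⟨h3, h4, h5⟩ := h3
    rw [coordEnd_ofFrame] at h5
    exact ⟨⟨h1, h2, h4⟩, h3, h5⟩
  · rintro ⟨⟨h1, h2, h4⟩, h3, h5⟩
    refine ⟨⟨h1, h2⟩, ?_⟩
    change (frameChart x₀ he z₀).invFun x ∈ (frameChart x₁ he' z₁).source
    simp only [frameChart, dif_pos h2]
    refine ⟨h3, h4, ?_⟩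
    rwa [coordEnd_ofFrame]

theorem isOpen_trans_source (he : IsLocalFrame S.Q U e) (he' : IsLocalFrame S.Q U' e') :
    IsOpen ((frameChart x₀ he z₀).symm.trans (frameChart x₁ he' z₁)).source := by
  rw [trans_source]
  have hb : ∀ W : Set M, IsOpen W →
      IsOpen {x : TwistorModel E | x.1 ∈ (chartAt E x₀).target ∧ (chartAt E x₀).symm x.1 ∈ W} :=
    fun W hW ↦ ((chartAt E x₀).isOpen_inter_preimage_symm hW).preimage continuous_fst
  have h1 := hb _ (he.isOpen.inter he'.isOpen)
  have h2 := (contDiffOn_transCoeff (x₀ := x₀) he he' 0).continuousOn.isOpen_inter_preimage h1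
    isOpen_Ioi (t := Set.Ioi 0)
  have h3 := h2.inter (hb _ (chartAt E x₁).open_source)
  refine (congrArg IsOpen ?_).mpr h3
  refine Set.ext fun x ↦ Iff.intro ?_ ?_
  · rintro ⟨h1, h2, h3⟩
    exact ⟨⟨h1, h3⟩, h1.1, h2⟩
  · rintro ⟨⟨h1, h3⟩, h4⟩
    exact ⟨h1, h4.2, h3⟩

theorem contDiffOn_trans (he : IsLocalFrame S.Q U e) (he' : IsLocalFrame S.Q U' e') :
    ContDiffOn ℝ ∞ ((frameChart x₀ he z₀).symm.trans (frameChart x₁ he' z₁))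
      ((frameChart x₀ he z₀).symm.trans (frameChart x₁ he' z₁)).source := by
  rw [trans_source]
  set s := {x : TwistorModel E | (x.1 ∈ (chartAt E x₀).target ∧ (chartAt E x₀).symm x.1 ∈ U ∩ U') ∧
        (chartAt E x₀).symm x.1 ∈ (chartAt E x₁).source ∧ 0 < transCoeff x₀ e e' 0 x} with hs
  have hc : ∀ i, ContDiffOn ℝ ∞ (transCoeff x₀ e e' i) s := fun i ↦
    (contDiffOn_transCoeff he he' i).mono fun x hx ↦ hx.1
  have hbase : ContDiffOn ℝ ∞ (fun x : TwistorModel E ↦ chartAt E x₁ ((chartAt E x₀).symm x.1)) s := by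
    rw [← contMDiffOn_iff_contDiffOn]
    have h1 : ContMDiffOn 𝓘(ℝ, TwistorModel E) 𝓘(ℝ, E) ∞
        (fun x : TwistorModel E ↦ (chartAt E x₀).symm x.1) s :=
      (contMDiffOn_chart_symm (I := 𝓘(ℝ, E)) (n := ∞) (x := x₀)).comp
        (contMDiff_iff_contDiff.2 contDiff_fst).contMDiffOn fun x hx ↦ hx.1.1
    exact (contMDiffOn_chart (I := 𝓘(ℝ, E)) (n := ∞) (x := x₁)).comp h1 fun x hx ↦ hx.2.1
  have hF : ContDiffOn ℝ ∞ (fun x : TwistorModel E ↦ ((chartAt E x₁ ((chartAt E x₀).symm x.1),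
      !₂[transCoeff x₀ e e' 1 x / transCoeff x₀ e e' 0 x,
        transCoeff x₀ e e' 2 x / transCoeff x₀ e e' 0 x]) : TwistorModel E)) s := by
    refine hbase.prodMk ?_
    rw [contDiffOn_euclidean]
    intro i
    fin_cases i
    · exact (hc 1).div (hc 0) fun x hx ↦ hx.2.2.ne'
    · exact (hc 2).div (hc 0) fun x hx ↦ hx.2.2.ne'
  refine hF.congr fun x hx ↦ ?_
  change (frameChart x₁ he' z₁).toFun ((frameChart x₀ he z₀).invFun x) = _
  simp only [frameChart, dif_pos hx.1.2.1, coordEnd_ofFrame]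
  rfl

end Transition

theorem exists_chart (z : TwistorSpace S) : ∃ (U : Set M) (e : Fin 3 → ∀ q : M, EndT E q)
    (_ : IsLocalFrame S.Q U e), z.pt ∈ U ∧ 0 < coordEnd (e 0 z.pt) z.cx := by
  have := S.finiteDimensional
  obtain ⟨U, hU, e, he⟩ := S.smooth z.pt
  obtain ⟨e', he', hpos⟩ := he.exists_pos S.finrank_pos hU z.mem z.sq
  exact ⟨U, e', he', hU, hpos⟩

variable (S) in
/-- The smooth atlas of the twistor space: the charts `frameChart` for all charts of `M` and all local
frames. -/
def chartedSpaceCore : ChartedSpaceCore (TwistorModel E) (TwistorSpace S) where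
  atlas := {f | ∃ (x₀ : M) (U : Set M) (e : Fin 3 → ∀ q : M, EndT E q) (he : IsLocalFrame S.Q U e)
    (z₀ : TwistorSpace S), f = frameChart x₀ he z₀}
  chartAt z := frameChart z.pt (exists_chart z).choose_spec.choose_spec.choose z
  mem_chart_source z :=
    ⟨mem_chart_source E z.pt, (exists_chart z).choose_spec.choose_spec.choose_spec⟩
  chart_mem_atlas z := ⟨_, _, _, _, _, rfl⟩
  open_source := by
    rintro _ _ ⟨x₀, U, e, he, z₀, rfl⟩ ⟨x₁, U', e', he', z₁, rfl⟩
    exact isOpen_trans_source he he'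
  continuousOn_toFun := by
    rintro _ _ ⟨x₀, U, e, he, z₀, rfl⟩ ⟨x₁, U', e', he', z₁, rfl⟩
    exact (contDiffOn_trans he he').continuousOn

instance : TopologicalSpace (TwistorSpace S) := (chartedSpaceCore S).toTopologicalSpace

instance : ChartedSpace (TwistorModel E) (TwistorSpace S) := (chartedSpaceCore S).toChartedSpace

instance : IsManifold 𝓘(ℝ, TwistorModel E) ∞ (TwistorSpace S) := by
  refine isManifold_of_contDiffOn _ _ _ fun f f' hf hf' ↦ ?_
  obtain ⟨f₀, hf⟩ := Set.mem_iUnion.1 hf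
  obtain ⟨⟨x₀, U, e, he, z₀, rfl⟩, rfl⟩ := Set.mem_iUnion.1 hf
  obtain ⟨f₁, hf'⟩ := Set.mem_iUnion.1 hf'
  obtain ⟨⟨x₁, U', e', he', z₁, rfl⟩, rfl⟩ := Set.mem_iUnion.1 hf'
  have h := contDiffOn_trans (x₀ := x₀) (x₁ := x₁) (z₀ := z₀) (z₁ := z₁) he he'
  simpa using! h

variable [FiniteDimensional ℝ E]

/-- The domain of the frame that underlies the preferred chart at `z`. -/
def frameDomain (z : TwistorSpace S) : Set M := (exists_chart z).choose
/-- The frame that underlies the preferred chart at `z`. -/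
def frameAt (z : TwistorSpace S) : Fin 3 → ∀ q : M, EndT E q := (exists_chart z).choose_spec.choose
theorem isLocalFrame_frameAt (z : TwistorSpace S) : IsLocalFrame S.Q (frameDomain z) (frameAt z) :=
  (exists_chart z).choose_spec.choose_spec.choose
theorem mem_frameDomain (z : TwistorSpace S) : z.pt ∈ frameDomain z :=
  (exists_chart z).choose_spec.choose_spec.choose_spec.1

/-- The members of that frame, in coordinates. -/
def frameCoord (z : TwistorSpace S) (i : Fin 3) (u : E) : E →L[ℝ] E :=
  endCoord z.pt ((chartAt E z.pt).symm u) (frameAt z i ((chartAt E z.pt).symm u))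

theorem extChartAt_symm_eq (z : TwistorSpace S) {x : TwistorModel E}
    (hx : x ∈ (extChartAt 𝓘(ℝ, TwistorModel E) z).target) :
    ∃ h : (chartAt E z.pt).symm x.1 ∈ frameDomain z,
      (extChartAt 𝓘(ℝ, TwistorModel E) z).symm x = ofFrame (isLocalFrame_frameAt z) h x.2 := by
  have hx' : x ∈ (frameChart z.pt (isLocalFrame_frameAt z) z).target := by
    simpa using! hx
  refine ⟨hx'.2, ?_⟩
  change (frameChart z.pt (isLocalFrame_frameAt z) z).invFun x = _
  simp only [frameChart, dif_pos hx'.2]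

theorem extChartAt_target_mem (z : TwistorSpace S) {x : TwistorModel E}
    (hx : x ∈ (extChartAt 𝓘(ℝ, TwistorModel E) z).target) : x.1 ∈ (chartAt E z.pt).target := by
  have hx' : x ∈ (frameChart z.pt (isLocalFrame_frameAt z) z).target := by
    simpa using! hx
  exact hx'.1

theorem extChartAt_fst (z w : TwistorSpace S) :
    (extChartAt 𝓘(ℝ, TwistorModel E) z w).1 = chartAt E z.pt w.pt := rfl

theorem contMDiff_pt : ContMDiff 𝓘(ℝ, TwistorModel E) 𝓘(ℝ, E) ∞ (pt : TwistorSpace S → M) := by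
  intro z
  have h1 : ContMDiffAt 𝓘(ℝ, TwistorModel E) 𝓘(ℝ, E) ∞
      (fun w ↦ (extChartAt 𝓘(ℝ, TwistorModel E) z w).1) z :=
    (contDiff_fst.contMDiff (n := ∞)).contMDiffAt.comp z contMDiffAt_extChartAt
  have h2 : ContMDiffAt 𝓘(ℝ, E) 𝓘(ℝ, E) ∞ (chartAt E z.pt).symm
      ((extChartAt 𝓘(ℝ, TwistorModel E) z z).1) :=
    (contMDiffOn_chart_symm (I := 𝓘(ℝ, E)) (n := ∞) (x := z.pt)).contMDiffAt
      ((chartAt E z.pt).open_target.mem_nhds (mem_chart_target E z.pt))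
  refine (h2.comp z h1).congr_of_eventuallyEq ?_
  filter_upwards [extChartAt_source_mem_nhds (I := 𝓘(ℝ, TwistorModel E)) z] with w hw
  have hw' : w ∈ (frameChart z.pt (isLocalFrame_frameAt z) z).source := by
    simpa using! hw
  exact ((chartAt E z.pt).left_inv hw'.1).symm

theorem contDiffAt_frameCoord (z : TwistorSpace S) (i : Fin 3) :
    ContDiffAt ℝ ∞ (frameCoord z i) (chartAt E z.pt z.pt) := by
  have he := isLocalFrame_frameAt z
  have h1 := ((contMDiffAt_hom_bundle _).1 ((he.smooth i).contMDiffAt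
    (he.isOpen.mem_nhds (mem_frameDomain z)))).2
  have h2 : ContMDiffAt 𝓘(ℝ, E) 𝓘(ℝ, E) ∞ (chartAt E z.pt).symm (chartAt E z.pt z.pt) :=
    (contMDiffOn_chart_symm (I := 𝓘(ℝ, E)) (n := ∞) (x := z.pt)).contMDiffAt
      ((chartAt E z.pt).open_target.mem_nhds (mem_chart_target E z.pt))
  rw [← contMDiffAt_iff_contDiffAt]
  exact ContMDiffAt.comp_of_eq h1 h2 ((chartAt E z.pt).left_inv (mem_chart_source E z.pt))

theorem endCoord_sum {p q : M} {s : Fin 3 → ℝ} {A : Fin 3 → EndT E q} :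
    endCoord p q (∑ i, s i • A i) = ∑ i, s i • endCoord p q (A i) := by
  ext v
  simp [endCoord, ContinuousLinearMap.inCoordinates, Fin.sum_univ_three]

/-- The tautological endomorphism, in the coordinates of the preferred chart at `z`. -/
def cxCoord (z : TwistorSpace S) (x : TwistorModel E) : E →L[ℝ] E :=
  ∑ i, sphereCoeff x.2 i • frameCoord z i x.1

theorem endCoord_cx_symm (z : TwistorSpace S) {x : TwistorModel E}
    (hx : x ∈ (extChartAt 𝓘(ℝ, TwistorModel E) z).target) :
    endCoord z.pt ((extChartAt 𝓘(ℝ, TwistorModel E) z).symm x).pt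
      ((extChartAt 𝓘(ℝ, TwistorModel E) z).symm x).cx = cxCoord z x := by
  obtain ⟨h, h'⟩ := extChartAt_symm_eq z hx
  rw [h']
  exact endCoord_sum

theorem contDiffAt_cxCoord (z : TwistorSpace S) :
    ContDiffAt ℝ ∞ (cxCoord z) (extChartAt 𝓘(ℝ, TwistorModel E) z z) := by
  refine ContDiffAt.sum fun i _ ↦ ContDiffAt.fun_smul ?_ ?_
  · exact ((contDiff_sphereCoeff i).comp contDiff_snd).contDiffAt
  · exact (contDiffAt_frameCoord z i).comp (extChartAt 𝓘(ℝ, TwistorModel E) z z) contDiffAt_fst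

theorem contMDiffAt_endCoord_cx (z : TwistorSpace S) :
    ContMDiffAt 𝓘(ℝ, TwistorModel E) 𝓘(ℝ, E →L[ℝ] E) ∞
      (fun w : TwistorSpace S ↦ endCoord z.pt w.pt w.cx) z := by
  refine ((contDiffAt_cxCoord z).contMDiffAt.comp z
    (contMDiffAt_extChartAt (n := ∞))).congr_of_eventuallyEq ?_
  filter_upwards [extChartAt_source_mem_nhds (I := 𝓘(ℝ, TwistorModel E)) z] with w hw
  have h := endCoord_cx_symm z ((extChartAt 𝓘(ℝ, TwistorModel E) z).map_source hw)
  rw [(extChartAt 𝓘(ℝ, TwistorModel E) z).left_inv hw] at h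
  exact h

theorem mfderiv_pt (z : TwistorSpace S) :
    mfderiv 𝓘(ℝ, TwistorModel E) 𝓘(ℝ, E) (pt : TwistorSpace S → M) z =
      (ContinuousLinearMap.fst ℝ E (EuclideanSpace ℝ (Fin 2)) : TwistorModel E →L[ℝ] E) := by
  have hd : MDifferentiableAt 𝓘(ℝ, TwistorModel E) 𝓘(ℝ, E) (pt : TwistorSpace S → M) z :=
    (contMDiff_pt z).mdifferentiableAt (by simp)
  rw [hd.mfderiv]
  simp only [modelWithCornersSelf_coe, Set.range_id, fderivWithin_univ]
  have : writtenInExtChartAt 𝓘(ℝ, TwistorModel E) 𝓘(ℝ, E) z (pt : TwistorSpace S → M)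
      =ᶠ[nhds (extChartAt 𝓘(ℝ, TwistorModel E) z z)] Prod.fst := by
    filter_upwards [extChartAt_target_mem_nhds (I := 𝓘(ℝ, TwistorModel E)) z] with x hx
    obtain ⟨h, h'⟩ := extChartAt_symm_eq z hx
    have h2 := extChartAt_target_mem z hx
    simp only [writtenInExtChartAt, Function.comp_apply, h', ofFrame]
    exact (chartAt E z.pt).right_inv h2
  rw [this.fderiv_eq]
  exact fderiv_fst

theorem mfderiv_cx (z : TwistorSpace S) :
    mfderiv 𝓘(ℝ, TwistorModel E) 𝓘(ℝ, E →L[ℝ] E)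
      (fun w : TwistorSpace S ↦ endCoord z.pt w.pt w.cx) z =
      (fderiv ℝ (cxCoord z) (extChartAt 𝓘(ℝ, TwistorModel E) z z) :
        TwistorModel E →L[ℝ] (E →L[ℝ] E)) := by
  rw [((contMDiffAt_endCoord_cx z).mdifferentiableAt (by simp)).mfderiv]
  simp only [modelWithCornersSelf_coe, Set.range_id, fderivWithin_univ]
  have : writtenInExtChartAt 𝓘(ℝ, TwistorModel E) 𝓘(ℝ, E →L[ℝ] E) z
      (fun w : TwistorSpace S ↦ endCoord z.pt w.pt w.cx)
      =ᶠ[nhds (extChartAt 𝓘(ℝ, TwistorModel E) z z)] cxCoord z := by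
    filter_upwards [extChartAt_target_mem_nhds (I := 𝓘(ℝ, TwistorModel E)) z] with x hx
    exact endCoord_cx_symm z hx
  rw [this.fderiv_eq]

/-- The fibre coordinate of `z` in its preferred chart. -/
def fibreCoord (z : TwistorSpace S) : EuclideanSpace ℝ (Fin 2) :=
  (extChartAt 𝓘(ℝ, TwistorModel E) z z).2

theorem frameCoord_self (z : TwistorSpace S) (i : Fin 3) :
    frameCoord z i (chartAt E z.pt z.pt) = frameAt z i z.pt :=
  endCoord_of_eq ((chartAt E z.pt).left_inv (mem_chart_source E z.pt)) (frameAt z i)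

theorem cxCoord_self (z : TwistorSpace S) :
    cxCoord z (extChartAt 𝓘(ℝ, TwistorModel E) z z) = z.cx := by
  have h := endCoord_cx_symm z (mem_extChartAt_target (I := 𝓘(ℝ, TwistorModel E)) z)
  rw [extChartAt_to_inv] at h
  exact h.symm.trans (endCoord_self _)

theorem cx_eq (z : TwistorSpace S) :
    z.cx = ∑ i, sphereCoeff (fibreCoord z) i • frameAt z i z.pt := by
  refine (cxCoord_self z).symm.trans ?_
  exact Finset.sum_congr rfl fun i _ ↦ congrArg _ (frameCoord_self z i)

theorem fderiv_cxCoord (z : TwistorSpace S) (a : TwistorModel E) :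
    fderiv ℝ (cxCoord z) (extChartAt 𝓘(ℝ, TwistorModel E) z z) a =
      ∑ i, (sphereCoeff (fibreCoord z) i • fderiv ℝ (frameCoord z i) (chartAt E z.pt z.pt) a.1 +
        fderiv ℝ (fun t ↦ sphereCoeff t i) (fibreCoord z) a.2 •
          frameCoord z i (chartAt E z.pt z.pt)) := by
  have h : ∀ i : Fin 3, HasFDerivAt
      (fun x : TwistorModel E ↦ sphereCoeff x.2 i • frameCoord z i x.1) _
      (extChartAt 𝓘(ℝ, TwistorModel E) z z) := fun i ↦
    ((((contDiff_sphereCoeff i).differentiable (by simp)) (fibreCoord z)).hasFDerivAt.comp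
      (extChartAt 𝓘(ℝ, TwistorModel E) z z) hasFDerivAt_snd).smul
    ((((contDiffAt_frameCoord z i).differentiableAt (by simp)).hasFDerivAt).comp
      (extChartAt 𝓘(ℝ, TwistorModel E) z z) hasFDerivAt_fst)
  have hs := HasFDerivAt.fun_sum (u := Finset.univ) fun i _ ↦ h i
  have : fderiv ℝ (cxCoord z) (extChartAt 𝓘(ℝ, TwistorModel E) z z) = _ := hs.fderiv
  rw [this]
  simp only [FunLike.coe_sum, Finset.sum_apply]
  rfl

theorem covDerivSection_frameAt (z : TwistorSpace S) (i : Fin 3) (v : TangentSpace 𝓘(ℝ, E) z.pt) :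
    covDerivSection g.inner (frameAt z i) z.pt v =
      (let Γ : E →L[ℝ] E := christoffel (coordMetric g.inner z.pt) (extChartAt 𝓘(ℝ, E) z.pt z.pt) v
       let A : E →L[ℝ] E := frameAt z i z.pt
       (fderiv ℝ (frameCoord z i) (chartAt E z.pt z.pt) v + Γ.comp A - A.comp Γ : E →L[ℝ] E)) := by
  have he := isLocalFrame_frameAt z
  have h1 := ((contMDiffAt_hom_bundle _).1 ((he.smooth i).contMDiffAt
    (he.isOpen.mem_nhds (mem_frameDomain z)))).2
  have h2 : mfderiv 𝓘(ℝ, E) 𝓘(ℝ, E →L[ℝ] E) (fun q ↦ endCoord z.pt q (frameAt z i q)) z.pt =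
      (fderiv ℝ (frameCoord z i) (chartAt E z.pt z.pt) : E →L[ℝ] (E →L[ℝ] E)) := by
    have h3 : MDifferentiableAt 𝓘(ℝ, E) 𝓘(ℝ, E →L[ℝ] E)
      (fun q ↦ endCoord z.pt q (frameAt z i q)) z.pt := h1.mdifferentiableAt (by simp)
    rw [h3.mfderiv]
    simp only [modelWithCornersSelf_coe, Set.range_id, fderivWithin_univ]
    rfl
  have h4 : mfderiv 𝓘(ℝ, E) 𝓘(ℝ, E) (id : M → M) z.pt = ContinuousLinearMap.id ℝ E := mfderiv_id
  unfold covDerivSection covDerivEnd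
  change covDerivCoord (V := E) (V' := E) _ _ (mfderiv 𝓘(ℝ, E) 𝓘(ℝ, E) (id : M → M) z.pt)
    (mfderiv 𝓘(ℝ, E) 𝓘(ℝ, E →L[ℝ] E) (fun q ↦ endCoord z.pt q (frameAt z i q)) z.pt) _ _ = _
  rw [h2, h4]
  rfl

theorem covDerivEnd_cx (z : TwistorSpace S) (a : TangentSpace 𝓘(ℝ, TwistorModel E) z) :
    covDerivEnd (V := E) (V' := TwistorModel E) g.inner (pt : TwistorSpace S → M) (cx) z a =
      (let a' : TwistorModel E := a
       let Γ : E →L[ℝ] E := christoffel (coordMetric g.inner z.pt) (extChartAt 𝓘(ℝ, E) z.pt z.pt) a'.1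
       let A : E →L[ℝ] E := z.cx
       (fderiv ℝ (cxCoord z) (extChartAt 𝓘(ℝ, TwistorModel E) z z) a' + Γ.comp A - A.comp Γ : E →L[ℝ] E)) := by
  unfold covDerivEnd
  rw [mfderiv_cx, mfderiv_pt]
  rfl

theorem covDerivEnd_cx_eq (z : TwistorSpace S) (a : TangentSpace 𝓘(ℝ, TwistorModel E) z) :
    covDerivEnd (V := E) (V' := TwistorModel E) g.inner (pt : TwistorSpace S → M) (cx) z a =
      ∑ i, fderiv ℝ (fun t ↦ sphereCoeff t i) (fibreCoord z) (a : TwistorModel E).2 •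
          frameAt z i z.pt +
      ∑ i, sphereCoeff (fibreCoord z) i •
        covDerivSection g.inner (frameAt z i) z.pt (a : TwistorModel E).1 := by
  rw [covDerivEnd_cx]
  have key : ∀ (s d : Fin 3 → ℝ) (P e : Fin 3 → (E →L[ℝ] E)) (Γ : E →L[ℝ] E),
      (∑ i, (s i • P i + d i • e i)) + Γ.comp (∑ i, s i • e i) - (∑ i, s i • e i).comp Γ =
        ∑ i, d i • e i + ∑ i, s i • (P i + Γ.comp (e i) - (e i).comp Γ) := by
    intro s d P e Γ
    ext v
    simp [Fin.sum_univ_three]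
    module
  have hf := fderiv_cxCoord z (a : TwistorModel E)
  simp only [frameCoord_self] at hf
  let Γ : E →L[ℝ] E := christoffel (coordMetric g.inner z.pt) (extChartAt 𝓘(ℝ, E) z.pt z.pt)
    (a : TwistorModel E).1
  refine (congrArg₂ (fun D A : E →L[ℝ] E ↦ D + Γ.comp A - A.comp Γ) hf (cx_eq z)).trans
    ((key _ _ _ _ Γ).trans ?_)
  exact congrArg (HAdd.hAdd _) (Finset.sum_congr rfl fun i _ ↦
    congrArg (HSMul.hSMul (sphereCoeff (fibreCoord z) i)) (covDerivSection_frameAt z i _).symm)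

theorem covDerivEnd_cx_mem (z : TwistorSpace S) (a : TangentSpace 𝓘(ℝ, TwistorModel E) z) :
    covDerivEnd (V := E) (V' := TwistorModel E) g.inner (pt : TwistorSpace S → M) (cx) z a
      ∈ S.Q z.pt := by
  have he := isLocalFrame_frameAt z
  have hn := he.isOpen.mem_nhds (mem_frameDomain z)
  rw [covDerivEnd_cx_eq]
  refine Subalgebra.add_mem _ (Subalgebra.sum_mem _ fun i _ ↦ Subalgebra.smul_mem _
    (he.mem _ (mem_frameDomain z) i) _) (Subalgebra.sum_mem _ fun i _ ↦ Subalgebra.smul_mem _ ?_ _)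
  refine S.parallel _ _ ((he.smooth i).contMDiffAt hn) ?_ _
  filter_upwards [hn] with q hq using he.mem q hq i

theorem covDerivEnd_cx_anticomm (z : TwistorSpace S) (a : TangentSpace 𝓘(ℝ, TwistorModel E) z) :
    covDerivEnd (V := E) (V' := TwistorModel E) g.inner (pt : TwistorSpace S → M) (cx) z a * z.cx =
      -(z.cx * covDerivEnd (V := E) (V' := TwistorModel E) g.inner
        (pt : TwistorSpace S → M) (cx) z a) := by
  rw [covDerivEnd_cx]
  set x₀ := extChartAt 𝓘(ℝ, TwistorModel E) z z with hx₀
  have hC : cxCoord z x₀ = z.cx := cxCoord_self z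
  have hsq : (fun x ↦ cxCoord z x * cxCoord z x) =ᶠ[nhds x₀] fun _ ↦ -1 := by
    filter_upwards [extChartAt_target_mem_nhds (I := 𝓘(ℝ, TwistorModel E)) z] with x hx
    have hx1 := extChartAt_target_mem z hx
    rw [← endCoord_cx_symm z hx]
    obtain ⟨h, h'⟩ := extChartAt_symm_eq z hx
    rw [h']
    refine (endCoord_mul ((chartAt E z.pt).map_target hx1) (ofFrame _ h x.2).cx
      (ofFrame _ h x.2).cx).symm.trans ?_
    refine (congrArg (endCoord z.pt ((chartAt E z.pt).symm x.1)) (ofFrame _ h x.2).sq).trans ?_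
    exact endCoord_neg_one ((chartAt E z.pt).map_target hx1)
  have hd := ((contDiffAt_cxCoord z).differentiableAt (by simp)).hasFDerivAt
  have h1 := (hd.mul' hd).fderiv
  have h2 : fderiv ℝ (fun x ↦ cxCoord z x * cxCoord z x) x₀ = 0 := by
    rw [hsq.fderiv_eq]; simp
  have h3 : ∀ a : TwistorModel E, cxCoord z x₀ * fderiv ℝ (cxCoord z) x₀ a +
      fderiv ℝ (cxCoord z) x₀ a * cxCoord z x₀ = 0 := by
    intro a
    have h4 := congrArg (fun T : TwistorModel E →L[ℝ] (E →L[ℝ] E) ↦ T a) (h1.symm.trans h2)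
    simpa using! h4
  have hI : cxCoord z x₀ * cxCoord z x₀ = -1 := hsq.eq_of_nhds
  have key : ∀ (I D Γ : E →L[ℝ] E), I * I = -1 → I * D + D * I = 0 →
      (D + Γ * I - I * Γ) * I = -(I * (D + Γ * I - I * Γ)) := by
    intro I D Γ hI hD
    have e1 : D * I = - (I * D) := eq_neg_of_add_eq_zero_right hD
    simp only [add_mul, sub_mul, mul_add, mul_sub, mul_assoc, hI, e1]
    rw [← mul_assoc I I Γ, hI]
    simp
    abel
  have := key (cxCoord z x₀) _ (christoffel (coordMetric g.inner z.pt)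
    (extChartAt 𝓘(ℝ, E) z.pt z.pt) (a : TwistorModel E).1) hI (h3 a)
  rw [hC] at this
  exact this

/-- The space `Q⁻_p` of those elements of `Q_p` that anticommute with `I`. -/
def QMinus (z : TwistorSpace S) : Submodule ℝ (EndT E z.pt) where
  carrier := {A | A ∈ S.Q z.pt ∧ A * z.cx = -(z.cx * A)}
  add_mem' := by
    rintro A B ⟨hA, hA'⟩ ⟨hB, hB'⟩
    refine ⟨add_mem hA hB, ?_⟩
    rw [add_mul, mul_add, hA', hB', neg_add]
  zero_mem' := ⟨zero_mem _, by simp⟩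
  smul_mem' := by
    rintro c A ⟨hA, hA'⟩
    refine ⟨Subalgebra.smul_mem _ hA c, ?_⟩
    rw [smul_mul_assoc, mul_smul_comm, hA', smul_neg]

/-- The differential of the projection `ZM → M`. -/
def horizontal (z : TwistorSpace S) :
    TangentSpace 𝓘(ℝ, TwistorModel E) z →ₗ[ℝ] TangentSpace 𝓘(ℝ, E) z.pt :=
  mfderiv 𝓘(ℝ, TwistorModel E) 𝓘(ℝ, E) (pt : TwistorSpace S → M) z

/-- The covariant derivative `∇ I_t / dt` of the tautological endomorphism: a tangent vector
`d/dt (p_t, I_t)` of the twistor space is sent to the covariant derivative of `I_t` along `p_t`. -/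
def covDerivTaut (z : TwistorSpace S) :
    TangentSpace 𝓘(ℝ, TwistorModel E) z →ₗ[ℝ] EndT E z.pt :=
  covDerivEnd (V := E) (V' := TwistorModel E) g.inner (pt : TwistorSpace S → M) cx z

theorem cx_mul_mem_QMinus (z : TwistorSpace S) {A : EndT E z.pt} (hA : A ∈ QMinus z) :
    z.cx * A ∈ QMinus z := by
  refine ⟨mul_mem z.mem hA.1, ?_⟩
  rw [mul_assoc, hA.2, mul_neg]

/-- The vertical part `(1/2) I (∇ I_t / dt)` of a tangent vector of the twistor space. -/
def vertical (z : TwistorSpace S) : TangentSpace 𝓘(ℝ, TwistorModel E) z →ₗ[ℝ] QMinus z where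
  toFun a := ⟨(1 / 2 : ℝ) • (z.cx * covDerivTaut z a), Submodule.smul_mem _ _
    (cx_mul_mem_QMinus z ⟨covDerivEnd_cx_mem z a, covDerivEnd_cx_anticomm z a⟩)⟩
  map_add' a b := Subtype.ext (by simp [mul_add])
  map_smul' c a := Subtype.ext (by simp [smul_comm c])

theorem tr_cx (z : TwistorSpace S) : trEnd z.cx = 0 := by
  have he := isLocalFrame_frameAt z
  rw [cx_eq z, map_sum]
  exact Finset.sum_eq_zero fun i _ ↦ by
    rw [map_smul, he.tr_eq_zero (mem_frameDomain z), smul_zero]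

theorem tr_of_mem_QMinus (z : TwistorSpace S) {A : EndT E z.pt} (hA : A ∈ QMinus z) :
    trEnd A = 0 := by
  have h1 : z.cx * (A * z.cx) = A := by
    rw [hA.2, mul_neg, ← mul_assoc, z.sq]; simp
  have h2 := congrArg trEnd h1
  rw [trEnd_mul_comm, mul_assoc, z.sq] at h2
  simp at h2; linarith

theorem eq_comb_of_mem_QMinus (z : TwistorSpace S) {A : EndT E z.pt} (hA : A ∈ QMinus z) :
    A = ∑ i, coordEnd (frameAt z i z.pt) A • frameAt z i z.pt ∧
      ∑ i, coordEnd (frameAt z i z.pt) A * sphereCoeff (fibreCoord z) i = 0 := by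
  have he := isLocalFrame_frameAt z
  have hU := mem_frameDomain z
  have hE : (Module.finrank ℝ E : ℝ) ≠ 0 := by exact_mod_cast S.finrank_pos.ne'
  obtain ⟨a, b, h⟩ := he.span z.pt hU A hA.1
  have htr : trEnd (∑ i, b i • frameAt z i z.pt) = 0 := by
    rw [map_sum]
    exact Finset.sum_eq_zero fun i _ ↦ by rw [map_smul, he.tr_eq_zero hU, smul_zero]
  have ha : a = 0 := by
    have := tr_of_mem_QMinus z hA
    rw [h, map_add, htr, map_smul, trEnd_one, smul_eq_mul, add_zero] at this
    exact (mul_eq_zero.1 this).resolve_right hE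
  rw [ha, zero_smul, zero_add] at h
  have hb : ∀ i, coordEnd (frameAt z i z.pt) A = b i := fun i ↦ by
    rw [h, he.coord_comb S.finrank_pos hU]
  simp only [hb]
  refine ⟨h, ?_⟩
  have h1 := congrArg trEnd hA.2
  rw [map_neg, trEnd_mul_comm z.cx A] at h1
  have h2 : trEnd (A * z.cx) = 0 := by linarith
  rw [h, Finset.sum_mul, map_sum] at h2
  have h3 : ∀ i, trEnd (b i • frameAt z i z.pt * z.cx) =
      -(b i * sphereCoeff (fibreCoord z) i) * Module.finrank ℝ E := fun i ↦ by
    rw [smul_mul_assoc, map_smul, cx_eq z, he.tr_comb hU, smul_eq_mul]; ring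
  simp only [h3] at h2
  rw [← Finset.sum_mul, Finset.sum_neg_distrib] at h2
  exact neg_eq_zero.1 ((mul_eq_zero.1 h2).resolve_right hE)

theorem finrank_QMinus_le (z : TwistorSpace S) : Module.finrank ℝ (QMinus z) ≤ 2 := by
  let κ : QMinus z →ₗ[ℝ] (Fin 2 → ℝ) :=
    { toFun := fun A i ↦ coordEnd (frameAt z i.succ z.pt) A.1
      map_add' := fun A B ↦ by
        ext i; simp [coordEnd, mul_add, add_div]; ring
      map_smul' := fun c A ↦ by
        ext i; simp [coordEnd]; ring }
  have hκ : Function.Injective κ := by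
    rw [← LinearMap.ker_eq_bot, LinearMap.ker_eq_bot']
    intro A hA
    obtain ⟨h1, h2⟩ := eq_comb_of_mem_QMinus z A.2
    have h3 : coordEnd (frameAt z 1 z.pt) A.1 = 0 := congrFun hA 0
    have h4 : coordEnd (frameAt z 2 z.pt) A.1 = 0 := congrFun hA 1
    rw [Fin.sum_univ_three, h3, h4] at h2
    have h5 : coordEnd (frameAt z 0 z.pt) A.1 = 0 := by
      have := sphereCoeff_zero_pos (fibreCoord z)
      have h6 : coordEnd (frameAt z 0 z.pt) A.1 * sphereCoeff (fibreCoord z) 0 = 0 := by linarith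
      exact (mul_eq_zero.1 h6).resolve_right this.ne'
    refine Subtype.ext ?_
    rw [h1, Fin.sum_univ_three, h3, h4, h5]
    simp
  simpa using LinearMap.finrank_le_finrank_of_injective hκ

theorem eq_zero_of_fderiv_sphereCoeff {t τ : EuclideanSpace ℝ (Fin 2)}
    (h : ∀ i, fderiv ℝ (fun t ↦ sphereCoeff t i) t τ = 0) : τ = 0 := by
  have hd : ∀ i : Fin 3, HasFDerivAt (fun t ↦ sphereCoeff t i)
      (fderiv ℝ (fun t ↦ sphereCoeff t i) t) t := fun i ↦
    ((contDiff_sphereCoeff i).differentiable (by simp) t).hasFDerivAt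
  have key : ∀ j : Fin 2, τ j = 0 := by
    intro j
    have h1 : (fun t ↦ sphereCoeff t j.succ) = fun t ↦ t j * sphereCoeff t 0 := by
      funext t; fin_cases j <;> simp [sphereCoeff, div_eq_mul_inv]
    have h2 : HasFDerivAt (fun t : EuclideanSpace ℝ (Fin 2) ↦ t j)
      (EuclideanSpace.proj j : EuclideanSpace ℝ (Fin 2) →L[ℝ] ℝ) t :=
      (EuclideanSpace.proj j : EuclideanSpace ℝ (Fin 2) →L[ℝ] ℝ).hasFDerivAt
    have h3 := (h2.mul (hd 0)).fderiv
    have h4 := h j.succ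
    rw [h1] at h4
    have h5 := congrArg (fun T : EuclideanSpace ℝ (Fin 2) →L[ℝ] ℝ ↦ T τ) h3
    have h6 : fderiv ℝ (fun t : EuclideanSpace ℝ (Fin 2) ↦ t j * sphereCoeff t 0) t τ =
        t j * fderiv ℝ (fun t ↦ sphereCoeff t 0) t τ + sphereCoeff t 0 * τ j := h5
    rw [h4, h 0] at h6
    have h7 : sphereCoeff t 0 * τ j = 0 := by linarith
    exact (mul_eq_zero.1 h7).resolve_left (sphereCoeff_zero_pos t).ne'
  ext j; exact key j

theorem split_injective (z : TwistorSpace S) :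
    Function.Injective ((horizontal z).prod (vertical z)) := by
  rw [← LinearMap.ker_eq_bot, LinearMap.ker_eq_bot']
  intro a ha
  have h1 : horizontal z a = 0 := congrArg Prod.fst ha
  have h2 : vertical z a = 0 := congrArg Prod.snd ha
  have h3 : (a : TwistorModel E).1 = 0 := by
    have : horizontal z a = (a : TwistorModel E).1 := by
      change mfderiv 𝓘(ℝ, TwistorModel E) 𝓘(ℝ, E) (pt : TwistorSpace S → M) z a = _
      rw [mfderiv_pt]; rfl
    exact this.symm.trans h1
  have h4 : covDerivTaut z a = 0 := by
    have h5 : (1 / 2 : ℝ) • (z.cx * covDerivTaut z a) = 0 := congrArg Subtype.val h2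
    have h6 : z.cx * covDerivTaut z a = 0 := (smul_eq_zero.1 h5).resolve_left (by norm_num)
    have h7 := congrArg (fun A ↦ z.cx * A) h6
    simp only [← mul_assoc, z.sq] at h7
    simpa using h7
  have he := isLocalFrame_frameAt z
  have h5 : ∑ i, fderiv ℝ (fun t ↦ sphereCoeff t i) (fibreCoord z) (a : TwistorModel E).2 •
      frameAt z i z.pt = 0 := by
    have h6 := (covDerivEnd_cx_eq z a).symm.trans h4
    rw [h3] at h6
    have h7 : ∀ i, covDerivSection g.inner (frameAt z i) z.pt (0 : E) = 0 := fun i ↦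
      (covDerivSection g.inner (frameAt z i) z.pt).map_zero
    simp only [h7, smul_zero, Finset.sum_const_zero, add_zero] at h6
    exact h6
  have h6 : ∀ i, fderiv ℝ (fun t ↦ sphereCoeff t i) (fibreCoord z) (a : TwistorModel E).2 = 0 := by
    intro i
    have := he.coord_comb S.finrank_pos (mem_frameDomain z) i
      (fun i ↦ fderiv ℝ (fun t ↦ sphereCoeff t i) (fibreCoord z) (a : TwistorModel E).2)
    rw [h5] at this
    rw [← this]
    simp [coordEnd]
  exact Prod.ext h3 (eq_zero_of_fderiv_sphereCoeff h6)

theorem split_bijective (z : TwistorSpace S) :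
    Function.Bijective ((horizontal z).prod (vertical z)) := by
  have hinj := split_injective z
  have i1 : FiniteDimensional ℝ (TangentSpace 𝓘(ℝ, TwistorModel E) z) :=
    inferInstanceAs (FiniteDimensional ℝ (TwistorModel E))
  have i2 : FiniteDimensional ℝ (TangentSpace 𝓘(ℝ, E) z.pt) :=
    inferInstanceAs (FiniteDimensional ℝ E)
  have i4 : FiniteDimensional ℝ (EndT E z.pt) :=
    inferInstanceAs (FiniteDimensional ℝ (E →L[ℝ] E))
  have i3 : FiniteDimensional ℝ (QMinus z) := inferInstance
  have h1 : Module.finrank ℝ (TangentSpace 𝓘(ℝ, TwistorModel E) z) = Module.finrank ℝ E + 2 := by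
    change Module.finrank ℝ (E × EuclideanSpace ℝ (Fin 2)) = _
    simp
  have h2 : Module.finrank ℝ (TangentSpace 𝓘(ℝ, E) z.pt × QMinus z) =
      Module.finrank ℝ E + Module.finrank ℝ (QMinus z) := by
    rw [Module.finrank_prod]; rfl
  have h3 := LinearMap.finrank_le_finrank_of_injective hinj
  have h4 := finrank_QMinus_le z
  exact ⟨hinj, (LinearMap.injective_iff_surjective_of_finrank_eq_finrank (by omega)).1 hinj⟩

/-- The isomorphism `T_{(p, I)} ZM ≅ T_p M ⊕ Q⁻_p`,
`d/dt (p_t, I_t) ↦ dp_t/dt ⊕ (1/2) I (∇ I_t / dt)`. -/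
def split (z : TwistorSpace S) :
    TangentSpace 𝓘(ℝ, TwistorModel E) z ≃ₗ[ℝ] TangentSpace 𝓘(ℝ, E) z.pt × QMinus z :=
  LinearEquiv.ofBijective _ (split_bijective z)

end TwistorSpace

/-- The real part of an element of `Q_p`, i.e. `1 / dim M` times its trace; it is the real part of
a quaternion under every isomorphism of `Q_p` with the quaternions. -/
def reEnd {p : M} (A : EndT E p) : ℝ := trEnd A / Module.finrank ℝ E

/-- Quaternionic conjugation `A ↦ 2 Re A - A` on `Q_p`. -/
def conjEnd {p : M} (A : EndT E p) : EndT E p := (2 * reEnd A) • (1 : EndT E p) - A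

/-- The standard scalar product `γ(A, B) = Re (conj A * B)` on `Q_p`. -/
def gammaEnd {p : M} (A B : EndT E p) : ℝ := reEnd (conjEnd A * B)

theorem gammaEnd_eq {p : M} (A B : EndT E p) :
    gammaEnd A B = 2 * reEnd A * reEnd B - reEnd (A * B) := by
  simp only [gammaEnd, conjEnd, reEnd, sub_mul, smul_mul_assoc, one_mul, map_sub, map_smul,
    smul_eq_mul]
  ring

/-- `γ` as a bilinear form. -/
def gammaBilin (p : M) : EndT E p →ₗ[ℝ] EndT E p →ₗ[ℝ] ℝ :=
  LinearMap.mk₂ ℝ gammaEnd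
    (by intros; simp only [gammaEnd_eq, reEnd, add_mul, map_add]; ring)
    (by intros; simp only [gammaEnd_eq, reEnd, smul_mul_assoc, map_smul, smul_eq_mul]; ring)
    (by intros; simp only [gammaEnd_eq, reEnd, mul_add, map_add]; ring)
    (by intros; simp only [gammaEnd_eq, reEnd, mul_smul_comm, map_smul, smul_eq_mul]; ring)

namespace TwistorSpace
variable {S : QuaternionKahlerStructure n g}
variable [FiniteDimensional ℝ E]

/-- The Riemannian metric
`g^Z (X ⊕ x, Y ⊕ y) = g(X, Y) + (16 n (n + 2) / κ) γ(x, y)` of the twistor space, where `κ` is the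
scalar curvature of `M`. -/
def twistorMetric (z : TwistorSpace S) :
    TangentSpace 𝓘(ℝ, TwistorModel E) z →L[ℝ] TangentSpace 𝓘(ℝ, TwistorModel E) z →L[ℝ] ℝ :=
  let H : TwistorModel E →ₗ[ℝ] E := horizontal z
  let W : TwistorModel E →ₗ[ℝ] EndT E z.pt := (QMinus z).subtype ∘ₗ vertical z
  let gp : E →L[ℝ] E →L[ℝ] ℝ := g.inner z.pt
  let B : TwistorModel E →ₗ[ℝ] TwistorModel E →ₗ[ℝ] ℝ :=
    gp.toLinearMap₁₂.compl₁₂ H H +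
      (16 * n * (n + 2) / scalarCurvature g.inner z.pt : ℝ) • (gammaBilin z.pt).compl₁₂ W W
  B.toContinuousBilinearMap

theorem twistorMetric_apply (z : TwistorSpace S) (a b : TangentSpace 𝓘(ℝ, TwistorModel E) z) :
    twistorMetric z a b = g.inner z.pt (split z a).1 (split z b).1 +
      16 * n * (n + 2) / scalarCurvature g.inner z.pt *
        gammaEnd ((split z a).2 : EndT E z.pt) ((split z b).2 : EndT E z.pt) := rfl

/-- The almost complex structure `X ⊕ x ↦ I X ⊕ I x` of the twistor space at `(p, I)`. -/
def complexStructure (z : TwistorSpace S) (a : TangentSpace 𝓘(ℝ, TwistorModel E) z) :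
    TangentSpace 𝓘(ℝ, TwistorModel E) z :=
  (split z).symm (z.cx (split z a).1,
    ⟨z.cx * ((split z a).2 : EndT E z.pt), cx_mul_mem_QMinus z (split z a).2.2⟩)

/-- The holomorphic bisectional curvature `K^Z (a, b) = g^Z (R^Z_{a, I^Z a} I^Z b, b)` of the
twistor space, with respect to the curvature tensor `R^Z` of the metric `g^Z`. -/
def bisectionalCurvature (z : TwistorSpace S) (a b : TangentSpace 𝓘(ℝ, TwistorModel E) z) : ℝ :=
  holomorphicBisectional (twistorMetric z)
    (fun u v w ↦ riemannCurvature (twistorMetric (S := S)) z u v w) (complexStructure z) a b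

/-- The holomorphic bisectional curvature `K^{CP} (a, b)` of the complex projective space of the
same complex dimension `2 n + 1` and the same scalar curvature as the twistor space. -/
def cpBisectionalCurvature (z : TwistorSpace S) (a b : TangentSpace 𝓘(ℝ, TwistorModel E) z) : ℝ :=
  holomorphicBisectional (twistorMetric z)
    (complexProjectiveCurvature (2 * n + 1) (scalarCurvature (twistorMetric (S := S)) z)
      (twistorMetric z) (complexStructure z)) (complexStructure z) a b

/-- The quaternionic bisectional curvature
`K_{H,I} (X, Y) = R(X, I X, I Y, Y) + κ / (8 n (n + 2)) (g(J X, Y) ^ 2 + g(K X, Y) ^ 2)`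
of `M` at `z = (p, I)`, computed with the orthonormal basis `J, K` of `Q⁻_p`. -/
def quaternionicBisectionalCurvature (z : TwistorSpace S) (J K : EndT E z.pt)
    (X Y : TangentSpace 𝓘(ℝ, E) z.pt) : ℝ :=
  g.inner z.pt (riemannCurvature g.inner z.pt X (z.cx X) (z.cx Y)) Y +
    scalarCurvature g.inner z.pt / (8 * n * (n + 2)) *
      (g.inner z.pt (J X) Y ^ 2 + g.inner z.pt (K X) Y ^ 2)

end TwistorSpace

end Twistor

end TwistorCurvature

end

/-! Put c = κ/(4n(n+2)), and let θ = ∇I be the covariant derivative of the tautological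
endomorphism, a one-form on ZM with values in Q⁻. The vertical part of a tangent vector is ½Iθ, so
the twistor metric is g + c⁻¹γ(θ, θ). For a metric h and a complex structure I write B_h(a, b) =
h(a, b)² + h(Ia, b)² + h(a, a)h(b, b). Everything comes down to two facts about the twistor metric H
= g^Z. With X, Y the projections of a, b, the first is `IsLocalTwistor.bisectional_eq`: K^Z(a, b) =
R(X, IX, IY, Y) + (c/2)(g(JX, Y)² + g(KX, Y)²) + (c/2)B_H(a, b) − (c/2)B_g(X, Y). The second is that
H is Einstein with scalar curvature c(2n+1)(2n+2) (`IsLocalTwistor.localScalarCurvature_eq`). As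
κ/(8n(n+2)) = c/2, the first two terms are the quaternionic bisectional curvature. The bisectional
curvature of complex projective space is 2s/(4m(m+1)) B_H, and with m = 2n+1 and s = c(2n+1)(2n+2)
the factor is c/2. On horizontal vectors H restricts to g, so the last term is the projective
curvature of X ⊕ 0, Y ⊕ 0.

The geometric input is the curvature of the bundle Q. The curvature operators normalize Q; taking
traces, and using n ≥ 2, one finds that the Q-component of R is determined by the Ricci tensor
(`IsQuatCurvature.phi_eq`) and then that M is Einstein (`IsQuatCurvature.ric_eq`). Hence [R_{v,w},
A] = (c/2)[Φ(v, w), A] for imaginary A, where Φ is the Q-valued two-form with γ(Φ(v, w), A) = g(v,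
Aw) (`IsLocalQK.bracket_curvature`). The differential Bianchi identity makes c locally constant
(`IsLocalQK.eventually_nscal_eq`), and Φ is parallel (`IsLocalQK.covEnd_quatMoment`). The
antisymmetric part of ∇θ is therefore (c/2)[Φ, I]. This suggests a candidate for the Levi-Civita
connection of H, which is verified by uniqueness (`IsLocalTwistor.christoffel_hor_ver`).
Differentiating it once more gives the horizontal and vertical parts of R^Z (`hor_curvature`,
`ver_curvature`) in terms of R, Φ, θ and I, and the two facts follow by quaternion algebra.

All of this takes place on open subsets of vector spaces. To return to the manifold one has to know
that covariant derivatives computed in different charts agree, because each tangent space is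
identified with the model space through the chart preferred at its own point. This follows from the
naturality of the connection under isometries (`IsIsometryOn.covEnd_map`); the local model is
supplied by `exists_isLocalTwistor`. -/

noncomputable section

namespace TwistorCurvature

/-! ### Riemannian metrics on open sets of a vector space: connection and curvature. -/

section LocalRiemannian

variable {V : Type*} [NormedAddCommGroup V] [NormedSpace ℝ V]

/-- `G` is a smooth Riemannian metric on the open subset `U` of a vector space. -/
structure IsMetricOn (G : V → V →L[ℝ] V →L[ℝ] ℝ) (U : Set V) : Prop where
  isOpen : IsOpen U
  smooth : ContDiffOn ℝ ∞ G U
  symm : ∀ x ∈ U, ∀ v w, G x v w = G x w v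
  pos : ∀ x ∈ U, ∀ v, v ≠ 0 → 0 < G x v v

theorem contDiffAt_apply_apply {W F : Type*} [NormedAddCommGroup W] [NormedSpace ℝ W]
    [NormedAddCommGroup F] [NormedSpace ℝ F] {f : W → V →L[ℝ] F} {x : W}
    (hf : ContDiffAt ℝ ∞ f x) (v : V) : ContDiffAt ℝ ∞ (fun y ↦ f y v) x :=
  hf.clm_apply contDiffAt_const

theorem fderiv_apply_const {W F : Type*} [NormedAddCommGroup W] [NormedSpace ℝ W]
    [NormedAddCommGroup F] [NormedSpace ℝ F] {f : W → V →L[ℝ] F} {x : W}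
    (hf : DifferentiableAt ℝ f x) (a : W) (v : V) :
    fderiv ℝ (fun y ↦ f y v) x a = fderiv ℝ f x a v := by
  have h := (hf.hasFDerivAt.clm_apply (hasFDerivAt_const v x)).fderiv
  rw [h]
  simp

theorem fderiv_app {W F F' : Type*} [NormedAddCommGroup W] [NormedSpace ℝ W]
    [NormedAddCommGroup F] [NormedSpace ℝ F] [NormedAddCommGroup F'] [NormedSpace ℝ F']
    {A : W → F →L[ℝ] F'} {f : W → F} {x : W}
    (hA : DifferentiableAt ℝ A x) (hf : DifferentiableAt ℝ f x) (a : W) :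
    fderiv ℝ (fun y ↦ A y (f y)) x a = A x (fderiv ℝ f x a) + fderiv ℝ A x a (f x) := by
  rw [(hA.hasFDerivAt.clm_apply hf.hasFDerivAt).fderiv]
  simp

theorem fderiv_app₂ {W F F' F'' : Type*} [NormedAddCommGroup W] [NormedSpace ℝ W]
    [NormedAddCommGroup F] [NormedSpace ℝ F] [NormedAddCommGroup F'] [NormedSpace ℝ F']
    [NormedAddCommGroup F''] [NormedSpace ℝ F'']
    {A : W → F →L[ℝ] F' →L[ℝ] F''} {f : W → F} {f' : W → F'} {x : W}
    (hA : DifferentiableAt ℝ A x) (hf : DifferentiableAt ℝ f x) (hf' : DifferentiableAt ℝ f' x)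
    (a : W) : fderiv ℝ (fun y ↦ A y (f y) (f' y)) x a =
      A x (f x) (fderiv ℝ f' x a) + A x (fderiv ℝ f x a) (f' x) + fderiv ℝ A x a (f x) (f' x) := by
  rw [fderiv_app (hA.clm_apply hf) hf', fderiv_app hA hf, add_apply, ← add_assoc]

theorem fderiv_comp_apply' {W F F' : Type*} [NormedAddCommGroup W] [NormedSpace ℝ W]
    [NormedAddCommGroup F] [NormedSpace ℝ F] [NormedAddCommGroup F'] [NormedSpace ℝ F']
    {g : F → F'} {f : W → F} {x : W}
    (hg : DifferentiableAt ℝ g (f x)) (hf : DifferentiableAt ℝ f x) (a : W) :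
    fderiv ℝ (fun y ↦ g (f y)) x a = fderiv ℝ g (f x) (fderiv ℝ f x a) := by
  have h := (hg.hasFDerivAt.comp x hf.hasFDerivAt).fderiv
  exact congrArg (fun T : W →L[ℝ] F' ↦ T a) h

theorem differentiableAt_comp' {W F F' : Type*} [NormedAddCommGroup W] [NormedSpace ℝ W]
    [NormedAddCommGroup F] [NormedSpace ℝ F] [NormedAddCommGroup F'] [NormedSpace ℝ F']
    {g : F → F'} {f : W → F} {x : W}
    (hg : DifferentiableAt ℝ g (f x)) (hf : DifferentiableAt ℝ f x) :
    DifferentiableAt ℝ (fun y ↦ g (f y)) x := hg.comp x hf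

theorem fderiv_fderiv_comm {W F : Type*} [NormedAddCommGroup W] [NormedSpace ℝ W]
    [NormedAddCommGroup F] [NormedSpace ℝ F] {f : W → F} {x : W}
    (hf : ContDiffAt ℝ ∞ f x) (a b : W) :
    fderiv ℝ (fderiv ℝ f) x a b = fderiv ℝ (fderiv ℝ f) x b a := by
  refine hf.isSymmSndFDerivAt ?_ a b
  simp only [minSmoothness_of_isRCLikeNormedField]
  exact WithTop.coe_le_coe.2 (le_top : (2 : ℕ∞) ≤ ⊤)

theorem differentiableAt_fderiv {W F : Type*} [NormedAddCommGroup W] [NormedSpace ℝ W]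
    [NormedAddCommGroup F] [NormedSpace ℝ F] {f : W → F} {x : W}
    (hf : ContDiffAt ℝ ∞ f x) : DifferentiableAt ℝ (fderiv ℝ f) x :=
  (hf.fderiv_right (m := ∞) (by simp)).differentiableAt (by simp)

theorem fderiv_mul_apply {W : Type*} [NormedAddCommGroup W] [NormedSpace ℝ W]
    {A B : W → V →L[ℝ] V} {x : W} (hA : DifferentiableAt ℝ A x) (hB : DifferentiableAt ℝ B x)
    (a : W) : fderiv ℝ (fun y ↦ A y * B y) x a = A x * fderiv ℝ B x a + fderiv ℝ A x a * B x := by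
  have h := (hA.hasFDerivAt.mul' hB.hasFDerivAt).fderiv
  have h1 := congrArg (fun T : W →L[ℝ] (V →L[ℝ] V) ↦ T a) h
  exact h1

variable [FiniteDimensional ℝ V]

/-- The Christoffel symbols as a bilinear map. -/
def christoffelL (G : V → V →L[ℝ] V →L[ℝ] ℝ) (u : V) : V →L[ℝ] V →L[ℝ] V :=
  LinearMap.toContinuousLinearMap
    { toFun := christoffel G u
      map_add' := christoffel_add G u
      map_smul' := fun c v ↦ christoffel_smul G u v c }

theorem christoffelL_apply (G : V → V →L[ℝ] V →L[ℝ] ℝ) (u v : V) :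
    christoffelL G u v = christoffel G u v := rfl

/-- A nondegenerate bilinear form as an isomorphism with the dual space. -/
def nondegEquiv (b : V →L[ℝ] V →L[ℝ] ℝ) (hb : ∀ v, v ≠ 0 → 0 < b v v) : V ≃L[ℝ] (V →L[ℝ] ℝ) :=
  (LinearEquiv.ofBijective (b : V →ₗ[ℝ] (V →L[ℝ] ℝ)) (by
    have hinj : Function.Injective (b : V →ₗ[ℝ] (V →L[ℝ] ℝ)) := by
      rw [injective_iff_map_eq_zero]
      intro v hv
      by_contra h
      have h1 := hb v h
      have h2 : b v = 0 := hv
      simp [h2] at h1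
    refine ⟨hinj, (LinearMap.injective_iff_surjective_of_finrank_eq_finrank ?_).1 hinj⟩
    rw [← LinearEquiv.finrank_eq (LinearMap.toContinuousLinearMap (𝕜 := ℝ) (E := V) (F' := ℝ))]
    exact (Subspace.dual_finrank_eq (K := ℝ) (V := V)).symm)).toContinuousLinearEquiv

theorem coe_nondegEquiv (b : V →L[ℝ] V →L[ℝ] ℝ) (hb : ∀ v, v ≠ 0 → 0 < b v v) :
    (nondegEquiv b hb : V →L[ℝ] (V →L[ℝ] ℝ)) = b := by
  ext v w; rfl

namespace IsMetricOn

variable {G : V → V →L[ℝ] V →L[ℝ] ℝ} {U : Set V} (hG : IsMetricOn G U) {u : V} (hu : u ∈ U)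
include hG hu

theorem contDiffAt : ContDiffAt ℝ ∞ G u := hG.smooth.contDiffAt (hG.isOpen.mem_nhds hu)

theorem differentiableAt : DifferentiableAt ℝ G u :=
  (hG.contDiffAt hu).differentiableAt (by simp)

set_option synthInstance.maxHeartbeats 200000 in
theorem hasFDerivAt : HasFDerivAt G (fderiv ℝ G u) u :=
  ((hG.contDiffAt hu).differentiableAt (by simp)).hasFDerivAt

theorem inverse_apply (v : V) : (G u).inverse (G u v) = v := by
  rw [← coe_nondegEquiv (G u) (hG.pos u hu), ContinuousLinearMap.inverse_equiv]
  exact (nondegEquiv (G u) (hG.pos u hu)).symm_apply_apply v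

theorem apply_inverse (f : V →L[ℝ] ℝ) : G u ((G u).inverse f) = f := by
  rw [← coe_nondegEquiv (G u) (hG.pos u hu), ContinuousLinearMap.inverse_equiv]
  exact (nondegEquiv (G u) (hG.pos u hu)).apply_symm_apply f

theorem ext_of_inner {v w : V} (h : ∀ z, G u v z = G u w z) : v = w := by
  rw [← hG.inverse_apply hu v, ← hG.inverse_apply hu w]
  exact congrArg _ (ContinuousLinearMap.ext h)

theorem contDiffAt_inverse : ContDiffAt ℝ ∞ (fun x ↦ (G x).inverse) u := by
  have h : ContDiffAt ℝ ∞ ContinuousLinearMap.inverse (G u) := by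
    rw [← coe_nondegEquiv (G u) (hG.pos u hu)]
    exact contDiffAt_map_inverse _
  exact h.comp u (hG.contDiffAt hu)

theorem inner_christoffel (v w z : V) :
    G u (christoffel G u v w) z =
      (1 / 2 : ℝ) * (fderiv ℝ G u v w z + fderiv ℝ G u w v z - fderiv ℝ G u z v w) := by
  rw [← christoffelLower_apply]
  change G u ((G u).inverse (christoffelLower G u v w)) z = _
  rw [hG.apply_inverse hu]

theorem contDiffAt_apply (v w : V) : ContDiffAt ℝ ∞ (fun x ↦ G x v w) u :=
  contDiffAt_apply_apply (contDiffAt_apply_apply (hG.contDiffAt hu) v) w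

theorem fderiv_apply (a v w : V) : fderiv ℝ (fun x ↦ G x v w) u a = fderiv ℝ G u a v w := by
  have h := ((hG.hasFDerivAt hu).clm_apply (hasFDerivAt_const v u)).clm_apply
    (hasFDerivAt_const w u)
  rw [h.fderiv]
  simp

theorem fderiv_symm (a v w : V) : fderiv ℝ G u a v w = fderiv ℝ G u a w v := by
  have h : (fun x ↦ G x v w) =ᶠ[nhds u] fun x ↦ G x w v := by
    filter_upwards [hG.isOpen.mem_nhds hu] with x hx using hG.symm x hx v w
  rw [← hG.fderiv_apply hu, ← hG.fderiv_apply hu, h.fderiv_eq]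

theorem christoffel_symm (v w : V) : christoffel G u v w = christoffel G u w v := by
  refine hG.ext_of_inner hu fun z ↦ ?_
  rw [hG.inner_christoffel hu, hG.inner_christoffel hu, hG.fderiv_symm hu z v w]
  ring

/-- Metric compatibility of the connection: in the sum of the two Koszul expressions everything but
D_a G(b, z) cancels by the symmetry of `G`. -/
theorem fderiv_eq (a b z : V) :
    fderiv ℝ G u a b z = G u (christoffel G u a b) z + G u b (christoffel G u a z) := by
  rw [hG.symm u hu b, hG.inner_christoffel hu, hG.inner_christoffel hu, hG.fderiv_symm hu b a z,
    hG.fderiv_symm hu z a b, hG.fderiv_symm hu a z b]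
  ring

/-- The Levi-Civita connection is the only torsion-free metric connection. -/
theorem christoffel_unique (T : V → V → V) (hT : ∀ v w, T v w = T w v)
    (hc : ∀ a b z, fderiv ℝ G u a b z = G u (T a b) z + G u b (T a z)) (v w : V) :
    christoffel G u v w = T v w := by
  refine hG.ext_of_inner hu fun z ↦ ?_
  -- Koszul's argument: after the three derivatives of `G` are expanded by `hc`, the symmetry of `T`
  -- cancels all terms but 2 G(T v w, z).
  rw [hG.inner_christoffel hu, hc, hc, hc, hT w v, hT z v, hT z w, hG.symm u hu w (T v z),
    hG.symm u hu v (T w z)]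
  ring

theorem contDiffAt_fderiv_apply (a v w : V) :
    ContDiffAt ℝ ∞ (fun x ↦ fderiv ℝ G x a v w) u := by
  have h : ContDiffAt ℝ ∞ (fun x ↦ fderiv ℝ (fun x ↦ G x v w) x a) u :=
    contDiffAt_apply_apply ((hG.contDiffAt_apply hu v w).fderiv_right (by simp)) a
  refine h.congr_of_eventuallyEq ?_
  filter_upwards [hG.isOpen.mem_nhds hu] with x hx using (hG.fderiv_apply hx a v w).symm

theorem contDiffAt_christoffel_apply (v w : V) :
    ContDiffAt ℝ ∞ (fun x ↦ christoffel G x v w) u := by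
  have hl : ContDiffOn ℝ ∞ (fun x ↦ christoffelLower G x v w) U := by
    rw [contDiffOn_clm_apply]
    intro z x hx
    simp only [christoffelLower_apply]
    exact (contDiffAt_const.mul (((hG.contDiffAt_fderiv_apply hx v w z).add
      (hG.contDiffAt_fderiv_apply hx w v z)).sub
      (hG.contDiffAt_fderiv_apply hx z v w))).contDiffWithinAt
  exact (hG.contDiffAt_inverse hu).clm_apply (hl.contDiffAt (hG.isOpen.mem_nhds hu))

/-- In finite dimension the smoothness of an operator-valued map is tested vector by vector. The
criterion speaks of sets, so it is applied on all of `U` and then restricted to the point. -/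
theorem contDiffAt_christoffel (v : V) : ContDiffAt ℝ ∞ (fun x ↦ christoffel G x v) u := by
  have key : ContDiffOn ℝ ∞ (fun x ↦ christoffel G x v) U := by
    rw [contDiffOn_clm_apply]
    exact fun w x hx ↦ (hG.contDiffAt_christoffel_apply hx v w).contDiffWithinAt
  exact key.contDiffAt (hG.isOpen.mem_nhds hu)

theorem contDiffAt_christoffelL : ContDiffAt ℝ ∞ (christoffelL G) u := by
  have key : ContDiffOn ℝ ∞ (christoffelL G) U := by
    rw [contDiffOn_clm_apply]
    exact fun w x hx ↦ (hG.contDiffAt_christoffel hx w).contDiffWithinAt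
  exact key.contDiffAt (hG.isOpen.mem_nhds hu)

theorem differentiableAt_christoffelL : DifferentiableAt ℝ (christoffelL G) u :=
  (hG.contDiffAt_christoffelL hu).differentiableAt (by simp)

theorem hasFDerivAt_christoffel (v : V) : HasFDerivAt (fun x ↦ christoffel G x v)
    (fderiv ℝ (fun x ↦ christoffel G x v) u) u :=
  ((hG.contDiffAt_christoffel hu v).differentiableAt (by simp)).hasFDerivAt

theorem fderiv_christoffel_apply (a v w : V) :
    fderiv ℝ (fun x ↦ christoffel G x v w) u a =
      fderiv ℝ (fun x ↦ christoffel G x v) u a w := by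
  have h := (hG.hasFDerivAt_christoffel hu v).clm_apply (hasFDerivAt_const w u)
  have h1 := congrArg (fun T : V →L[ℝ] V ↦ T a) h.fderiv
  simpa using! h1

theorem fderiv_christoffel_symm (a v w : V) :
    fderiv ℝ (fun x ↦ christoffel G x v) u a w = fderiv ℝ (fun x ↦ christoffel G x w) u a v := by
  have h : (fun x ↦ christoffel G x v w) =ᶠ[nhds u] fun x ↦ christoffel G x w v := by
    filter_upwards [hG.isOpen.mem_nhds hu] with x hx using hG.christoffel_symm hx v w
  rw [← hG.fderiv_christoffel_apply hu, ← hG.fderiv_christoffel_apply hu, h.fderiv_eq]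

omit hG hu in
theorem localCurvature_apply (v w z : V) :
    localCurvature G u v w z = fderiv ℝ (fun x ↦ christoffel G x w) u v z -
      fderiv ℝ (fun x ↦ christoffel G x v) u w z +
      christoffel G u v (christoffel G u w z) - christoffel G u w (christoffel G u v z) := rfl

omit hG hu in
theorem localCurvature_antisymm (v w : V) : localCurvature G u v w = -localCurvature G u w v := by
  simp only [localCurvature]; abel

/-- Since the connection is torsion-free, Γ and its derivatives are symmetric, and the terms of the
cyclic sum cancel in pairs. -/
theorem bianchi_first (x y z : V) :
    localCurvature G u x y z + localCurvature G u y z x + localCurvature G u z x y = 0 := by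
  simp only [localCurvature_apply]
  rw [hG.fderiv_christoffel_symm hu x z y, hG.fderiv_christoffel_symm hu y z x,
    hG.fderiv_christoffel_symm hu z y x]
  rw [hG.christoffel_symm hu z y, hG.christoffel_symm hu z x, hG.christoffel_symm hu y x]
  abel

/-- The reason is the symmetry of the second derivatives of G(x, y). Metric compatibility is
differentiated once more (`key`); antisymmetrizing in the two directions leaves exactly G(Rx, y) +
G(x, Ry) = 0. -/
theorem localCurvature_skew (v w x y : V) :
    G u (localCurvature G u v w x) y = -G u x (localCurvature G u v w y) := by
  have hsym : ∀ a c b z, fderiv ℝ (fun x ↦ fderiv ℝ G x a b z) u c =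
      fderiv ℝ (fun x ↦ fderiv ℝ G x c b z) u a := by
    intro a c b z
    have hD := ((hG.contDiffAt_apply hu b z).fderiv_right (m := ∞) (by simp)).differentiableAt
      (by simp)
    have h1 : ∀ a c, fderiv ℝ (fun x ↦ fderiv ℝ G x a b z) u c =
        fderiv ℝ (fderiv ℝ (fun x ↦ G x b z)) u c a := by
      intro a c
      have h2 : (fun x ↦ fderiv ℝ G x a b z) =ᶠ[nhds u] fun x ↦ fderiv ℝ (fun x ↦ G x b z) x a := by
        filter_upwards [hG.isOpen.mem_nhds hu] with x hx using (hG.fderiv_apply hx a b z).symm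
      have h3 := (hD.hasFDerivAt.clm_apply (hasFDerivAt_const a u)).fderiv
      rw [h2.fderiv_eq, h3]
      simp
    rw [h1, h1]
    exact fderiv_fderiv_comm (hG.contDiffAt_apply hu b z) _ _
  have key : ∀ c a b z, fderiv ℝ (fun x ↦ fderiv ℝ G x a b z) u c =
      fderiv ℝ G u c (christoffel G u a b) z + G u (fderiv ℝ (fun x ↦ christoffel G x a) u c b) z +
      (fderiv ℝ G u c b (christoffel G u a z) +
        G u b (fderiv ℝ (fun x ↦ christoffel G x a) u c z)) := by
    intro c a b z
    have h1 : (fun x ↦ fderiv ℝ G x a b z) =ᶠ[nhds u]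
        fun x ↦ G x (christoffel G x a b) z + G x b (christoffel G x a z) := by
      filter_upwards [hG.isOpen.mem_nhds hu] with x hx using hG.fderiv_eq hx a b z
    have hΓ : ∀ b, HasFDerivAt (fun x ↦ christoffel G x a b) _ u := fun b ↦
      (hG.hasFDerivAt_christoffel hu a).clm_apply (hasFDerivAt_const b u)
    have h3 := (((hG.hasFDerivAt hu).clm_apply (hΓ b)).clm_apply (hasFDerivAt_const z u)).add
      (((hG.hasFDerivAt hu).clm_apply (hasFDerivAt_const b u)).clm_apply (hΓ z))
    have h4 := congrArg (fun T : V →L[ℝ] ℝ ↦ T c) (h1.fderiv_eq.trans h3.fderiv)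
    simp at h4
    rw [h4]; ring
  have h1 := key v w x y
  have h2 := key w v x y
  rw [hsym w v, h2] at h1
  simp only [hG.fderiv_eq hu] at h1
  simp only [localCurvature_apply, map_add, map_sub, add_apply, sub_apply]
  linarith

/-- The differential Bianchi identity. -/
theorem bianchi_second (x y z : V) :
    (fderiv ℝ (fun p ↦ localCurvature G p y z) u x + christoffel G u x * localCurvature G u y z -
        localCurvature G u y z * christoffel G u x) +
      (fderiv ℝ (fun p ↦ localCurvature G p z x) u y + christoffel G u y * localCurvature G u z x -
        localCurvature G u z x * christoffel G u y) +
      (fderiv ℝ (fun p ↦ localCurvature G p x y) u z + christoffel G u z * localCurvature G u x y -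
        localCurvature G u x y * christoffel G u z) = 0 := by
  have hΓ := fun v ↦ hG.hasFDerivAt_christoffel hu v
  have hd := fun v ↦ (hΓ v).differentiableAt
  have hD : ∀ v w, DifferentiableAt ℝ (fun p ↦ fderiv ℝ (fun x ↦ christoffel G x w) p v) u :=
    fun v w ↦ (differentiableAt_fderiv (hG.contDiffAt_christoffel hu w)).clm_apply
      (differentiableAt_const v)
  have hD' : ∀ a v w, fderiv ℝ (fun p ↦ fderiv ℝ (fun x ↦ christoffel G x w) p v) u a =
      fderiv ℝ (fderiv ℝ (fun x ↦ christoffel G x w)) u a v := fun a v w ↦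
    fderiv_apply_const (differentiableAt_fderiv (hG.contDiffAt_christoffel hu w)) a v
  have hs := fun v w z ↦ fderiv_fderiv_comm (hG.contDiffAt_christoffel hu w) v z
  have key : ∀ x y z, fderiv ℝ (fun p ↦ localCurvature G p y z) u x =
      fderiv ℝ (fderiv ℝ (fun x ↦ christoffel G x z)) u x y -
      fderiv ℝ (fderiv ℝ (fun x ↦ christoffel G x y)) u x z +
      (christoffel G u y * fderiv ℝ (fun x ↦ christoffel G x z) u x +
        fderiv ℝ (fun x ↦ christoffel G x y) u x * christoffel G u z) -
      (christoffel G u z * fderiv ℝ (fun x ↦ christoffel G x y) u x +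
        fderiv ℝ (fun x ↦ christoffel G x z) u x * christoffel G u y) := by
    intro x y z
    have h1 : (fun p ↦ localCurvature G p y z) = fun p ↦
      fderiv ℝ (fun x ↦ christoffel G x z) p y - fderiv ℝ (fun x ↦ christoffel G x y) p z +
      christoffel G p y * christoffel G p z - christoffel G p z * christoffel G p y := rfl
    have hm : ∀ v w, DifferentiableAt ℝ (fun p ↦ christoffel G p v * christoffel G p w) u :=
      fun v w ↦ ((hΓ v).mul' (hΓ w)).differentiableAt
    rw [h1, fderiv_fun_sub (((hD y z).fun_sub (hD z y)).fun_add (hm y z)) (hm z y),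
      fderiv_fun_add ((hD y z).fun_sub (hD z y)) (hm y z), fderiv_fun_sub (hD y z) (hD z y)]
    simp only [add_apply, sub_apply, hD', fderiv_mul_apply (hd _) (hd _)]
  have hc : ∀ y z, localCurvature G u y z = fderiv ℝ (fun x ↦ christoffel G x z) u y -
      fderiv ℝ (fun x ↦ christoffel G x y) u z +
      christoffel G u y * christoffel G u z - christoffel G u z * christoffel G u y :=
    fun y z ↦ rfl
  -- Second derivatives cancel by symmetry. The rest is an identity in the ring of endomorphisms,
  -- whose cubic part is the Jacobi identity.
  rw [key, key, key, hc, hc, hc, hs x z y, hs y x z, hs z y x]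
  noncomm_ring

end IsMetricOn

end LocalRiemannian

/-! ### Ricci and scalar curvature, and their invariance under local isometries. -/

section LocalCurvature

variable {V : Type*} [NormedAddCommGroup V] [NormedSpace ℝ V] [FiniteDimensional ℝ V]
  {G : V → V →L[ℝ] V →L[ℝ] ℝ} {U : Set V} {u : V}

namespace IsMetricOn

set_option synthInstance.maxHeartbeats 200000 in
theorem fderiv_christoffelL (hG : IsMetricOn G U) (hu : u ∈ U) (a v : V) :
    fderiv ℝ (christoffelL G) u a v = fderiv ℝ (fun x ↦ christoffel G x v) u a :=
  (fderiv_apply_const (hG.differentiableAt_christoffelL hu) a v).symm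

-- The derivative of Γ(v, ·) depends linearly on v because it is a value of the derivative of the
-- bilinear map `christoffelL`.
set_option synthInstance.maxHeartbeats 200000 in
theorem localCurvature_add_left (hG : IsMetricOn G U) (hu : u ∈ U) (v v' w z : V) :
    localCurvature G u (v + v') w z = localCurvature G u v w z + localCurvature G u v' w z := by
  simp only [localCurvature_apply, ← hG.fderiv_christoffelL hu]
  simp only [map_add, add_apply, christoffel_add]
  abel

set_option synthInstance.maxHeartbeats 200000 in
theorem localCurvature_smul_left (hG : IsMetricOn G U) (hu : u ∈ U) (c : ℝ) (v w z : V) :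
    localCurvature G u (c • v) w z = c • localCurvature G u v w z := by
  simp only [localCurvature_apply, ← hG.fderiv_christoffelL hu]
  simp only [map_smul, smul_apply, christoffel_smul, smul_sub, smul_add]

theorem localCurvature_add_right (hG : IsMetricOn G U) (hu : u ∈ U) (v w w' z : V) :
    localCurvature G u v (w + w') z = localCurvature G u v w z + localCurvature G u v w' z := by
  simp only [localCurvature_antisymm v, neg_apply, hG.localCurvature_add_left hu]
  abel

theorem localCurvature_smul_right (hG : IsMetricOn G U) (hu : u ∈ U) (c : ℝ) (v w z : V) :
    localCurvature G u v (c • w) z = c • localCurvature G u v w z := by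
  simp only [localCurvature_antisymm v, neg_apply, hG.localCurvature_smul_left hu, smul_neg]

/-- The endomorphism `v ↦ R_{v, w} z`. -/
def ricciMap (hG : IsMetricOn G U) (hu : u ∈ U) (w z : V) : V →ₗ[ℝ] V where
  toFun v := localCurvature G u v w z
  map_add' v v' := hG.localCurvature_add_left hu v v' w z
  map_smul' c v := hG.localCurvature_smul_left hu c v w z

theorem localRicci_eq_trace (hG : IsMetricOn G U) (hu : u ∈ U) (w z : V) :
    localRicci G u w z = LinearMap.trace ℝ V (hG.ricciMap hu w z) := by
  rw [LinearMap.trace_eq_matrix_trace ℝ (Module.finBasis ℝ V), Matrix.trace]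
  simp [localRicci, LinearMap.toMatrix_apply, ricciMap]

/-- The Ricci tensor as a bilinear map. -/
def ricciForm (hG : IsMetricOn G U) (hu : u ∈ U) : V →ₗ[ℝ] V →ₗ[ℝ] ℝ :=
  LinearMap.mk₂ ℝ (localRicci G u)
    (by intros; simp only [localRicci, hG.localCurvature_add_right hu, map_add, Finset.sum_add_distrib])
    (by intros; simp only [localRicci, hG.localCurvature_smul_right hu, map_smul, smul_eq_mul,
      Finset.mul_sum])
    (by intros; simp only [localRicci, map_add, Finset.sum_add_distrib])
    (by intros; simp only [localRicci, map_smul, smul_eq_mul, Finset.mul_sum])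

/-- The scalar curvature is the trace of the Ricci endomorphism. -/
theorem localScalarCurvature_eq_trace (hG : IsMetricOn G U) (hu : u ∈ U) (ρ : V →ₗ[ℝ] V)
    (hρ : ∀ w z, G u (ρ w) z = localRicci G u w z) :
    localScalarCurvature G u = LinearMap.trace ℝ V ρ := by
  rw [LinearMap.trace_eq_matrix_trace ℝ (Module.finBasis ℝ V), Matrix.trace]
  simp only [localScalarCurvature, Matrix.diag_apply, LinearMap.toMatrix_apply]
  refine Finset.sum_congr rfl fun j _ ↦ ?_
  set b := Module.finBasis ℝ V
  -- By `hρ` the vector ρ(e_j) is dual to the form Ric(e_j, ·). Its expansion in the dual basis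
  -- produces the contraction that defines the scalar curvature.
  have h1 : ρ (b j) = ∑ k, localRicci G u (b j) (b k) •
      (G u).inverse (LinearMap.toContinuousLinearMap (b.coord k)) := by
    refine hG.ext_of_inner hu fun z ↦ ?_
    rw [hρ]
    simp only [map_sum, map_smul, hG.apply_inverse hu, sum_apply, smul_apply]
    change hG.ricciForm hu (b j) z = _
    conv_lhs => rw [← b.sum_repr z]
    simp only [map_sum, map_smul, smul_eq_mul, Module.Basis.coord_apply, mul_comm,
      LinearMap.coe_toContinuousLinearMap']
    rfl
  rw [h1, map_sum, Finset.sum_apply']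
  simp [mul_comm]

/-- The Ricci endomorphism. -/
def ricciEnd (hG : IsMetricOn G U) (hu : u ∈ U) : V →ₗ[ℝ] V where
  toFun w := (G u).inverse (LinearMap.toContinuousLinearMap (hG.ricciForm hu w))
  map_add' w w' := by simp
  map_smul' c w := by simp

theorem inner_ricciEnd (hG : IsMetricOn G U) (hu : u ∈ U) (w z : V) :
    G u (hG.ricciEnd hu w) z = localRicci G u w z := by
  change G u ((G u).inverse (LinearMap.toContinuousLinearMap (hG.ricciForm hu w))) z = _
  rw [hG.apply_inverse hu]; rfl

end IsMetricOn

/-- `φ` is a local isometry from the metric `G` on `U` to the metric `G'` on `U'`. -/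
structure IsIsometryOn (φ : V → V) (G G' : V → V →L[ℝ] V →L[ℝ] ℝ) (U U' : Set V) : Prop where
  left : IsMetricOn G U
  right : IsMetricOn G' U'
  mapsTo : ∀ x ∈ U, φ x ∈ U'
  smooth : ContDiffOn ℝ ∞ φ U
  inner : ∀ x ∈ U, ∀ v w, G x v w = G' (φ x) (fderiv ℝ φ x v) (fderiv ℝ φ x w)

namespace IsIsometryOn
variable {φ : V → V} {G' : V → V →L[ℝ] V →L[ℝ] ℝ} {U' : Set V}
  (h : IsIsometryOn φ G G' U U') (hu : u ∈ U)
include h hu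

theorem contDiffAt : ContDiffAt ℝ ∞ φ u := h.smooth.contDiffAt (h.left.isOpen.mem_nhds hu)

theorem differentiableAt : DifferentiableAt ℝ φ u := (h.contDiffAt hu).differentiableAt (by simp)

theorem contDiffAt_fderiv_apply (v : V) : ContDiffAt ℝ ∞ (fun x ↦ fderiv ℝ φ x v) u :=
  contDiffAt_apply_apply ((h.contDiffAt hu).fderiv_right (by simp)) v

theorem injective : Function.Injective (fderiv ℝ φ u) := by
  rw [injective_iff_map_eq_zero]
  intro v hv
  by_contra hne
  have := h.left.pos u hu v hne
  rw [h.inner u hu, hv] at this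
  simp at this

/-- The differential as an isomorphism. -/
def equiv : V ≃ₗ[ℝ] V :=
  LinearEquiv.ofBijective (fderiv ℝ φ u : V →ₗ[ℝ] V)
    ⟨h.injective hu, LinearMap.injective_iff_surjective.1 (h.injective hu)⟩

theorem equiv_apply (v : V) : h.equiv hu v = fderiv ℝ φ u v := rfl

theorem second_symm (v w : V) : fderiv ℝ (fun x ↦ fderiv ℝ φ x w) u v =
    fderiv ℝ (fun x ↦ fderiv ℝ φ x v) u w := by
  rw [fderiv_apply_const (differentiableAt_fderiv (h.contDiffAt hu)),
    fderiv_apply_const (differentiableAt_fderiv (h.contDiffAt hu)),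
    fderiv_fderiv_comm (h.contDiffAt hu)]

set_option synthInstance.maxHeartbeats 200000 in
theorem fderiv_inner (a b z : V) : fderiv ℝ G u a b z =
    fderiv ℝ G' (φ u) (fderiv ℝ φ u a) (fderiv ℝ φ u b) (fderiv ℝ φ u z) +
    G' (φ u) (fderiv ℝ (fun x ↦ fderiv ℝ φ x b) u a) (fderiv ℝ φ u z) +
    G' (φ u) (fderiv ℝ φ u b) (fderiv ℝ (fun x ↦ fderiv ℝ φ x z) u a) := by
  have hd : ∀ v, DifferentiableAt ℝ (fun x ↦ fderiv ℝ φ x v) u := fun v ↦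
    (h.contDiffAt_fderiv_apply hu v).differentiableAt (by simp)
  have h1 : (fun x ↦ G x b z) =ᶠ[nhds u]
      fun x ↦ G' (φ x) (fderiv ℝ φ x b) (fderiv ℝ φ x z) := by
    filter_upwards [h.left.isOpen.mem_nhds hu] with x hx using h.inner x hx b z
  have hG := h.right.differentiableAt (h.mapsTo u hu)
  rw [← h.left.fderiv_apply hu, h1.fderiv_eq,
    fderiv_app₂ (A := fun x ↦ G' (φ x)) 
      (differentiableAt_comp' (F' := V →L[ℝ] V →L[ℝ] ℝ) hG (h.differentiableAt hu)) (hd b) (hd z),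
    fderiv_comp_apply' (F' := V →L[ℝ] V →L[ℝ] ℝ) hG (h.differentiableAt hu)]
  ring

/-- The change of the Christoffel symbols under an isometry. -/
theorem map_christoffel (v w : V) : fderiv ℝ φ u (christoffel G u v w) =
    christoffel G' (φ u) (fderiv ℝ φ u v) (fderiv ℝ φ u w) +
      fderiv ℝ (fun x ↦ fderiv ℝ φ x w) u v := by
  have hφ := h.mapsTo u hu
  -- The candidate is the connection of `G'` pulled back by φ. It is symmetric and metric for `G`,
  -- so uniqueness identifies it.
  rw [h.left.christoffel_unique hu (fun v w ↦ (h.equiv hu).symm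
    (christoffel G' (φ u) (fderiv ℝ φ u v) (fderiv ℝ φ u w) +
      fderiv ℝ (fun x ↦ fderiv ℝ φ x w) u v))]
  · rw [← h.equiv_apply hu, LinearEquiv.apply_symm_apply]
  · intro v w
    rw [h.right.christoffel_symm hφ, h.second_symm hu]
  · intro a b z
    rw [h.inner u hu, h.inner u hu, h.fderiv_inner hu, h.right.fderiv_eq hφ]
    simp only [← h.equiv_apply hu, LinearEquiv.apply_symm_apply, map_add, add_apply]
    ring

set_option synthInstance.maxHeartbeats 200000 in
/-- Isometries preserve the curvature tensor. -/
theorem map_localCurvature (v w z : V) : fderiv ℝ φ u (localCurvature G u v w z) =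
    localCurvature G' (φ u) (fderiv ℝ φ u v) (fderiv ℝ φ u w) (fderiv ℝ φ u z) := by
  have hφ := h.mapsTo u hu
  have hd : ∀ v, DifferentiableAt ℝ (fun x ↦ fderiv ℝ φ x v) u := fun v ↦
    (h.contDiffAt_fderiv_apply hu v).differentiableAt (by simp)
  have hL : DifferentiableAt ℝ (christoffelL G') (φ u) :=
    (h.right.contDiffAt_christoffelL hφ).differentiableAt (by simp)
  -- This is the transformation law `map_christoffel`, differentiated in the direction v.
  have key : ∀ v w, fderiv ℝ (fun x ↦ fderiv ℝ φ x (christoffel G u w z)) u v +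
      fderiv ℝ φ u (fderiv ℝ (fun x ↦ christoffel G x w) u v z) =
      fderiv ℝ (fun x ↦ christoffel G' x (fderiv ℝ φ u w)) (φ u) (fderiv ℝ φ u v) (fderiv ℝ φ u z) +
      christoffel G' (φ u) (fderiv ℝ (fun x ↦ fderiv ℝ φ x w) u v) (fderiv ℝ φ u z) +
      christoffel G' (φ u) (fderiv ℝ φ u w) (fderiv ℝ (fun x ↦ fderiv ℝ φ x z) u v) +
      fderiv ℝ (fderiv ℝ (fun x ↦ fderiv ℝ φ x z)) u v w := by
    intro v w
    have h1 : (fun x ↦ fderiv ℝ φ x (christoffel G x w z)) =ᶠ[nhds u]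
        fun x ↦ christoffelL G' (φ x) (fderiv ℝ φ x w) (fderiv ℝ φ x z) +
          fderiv ℝ (fun x ↦ fderiv ℝ φ x z) x w := by
      filter_upwards [h.left.isOpen.mem_nhds hu] with x hx using h.map_christoffel hx w z
    have hΓ : DifferentiableAt ℝ (fun x ↦ christoffel G x w z) u :=
      (h.left.contDiffAt_christoffel_apply hu w z).differentiableAt (by simp)
    have hA : DifferentiableAt ℝ (fun x ↦ christoffelL G' (φ x)) u :=
      differentiableAt_comp' (F' := V →L[ℝ] V →L[ℝ] V) hL (h.differentiableAt hu)
    have h2 := congrArg (fun T : V →L[ℝ] V ↦ T v) h1.fderiv_eq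
    rw [fderiv_app (differentiableAt_fderiv (h.contDiffAt hu)) hΓ,
      fderiv_fun_add ((hA.clm_apply (hd w)).clm_apply (hd z))
        ((differentiableAt_fderiv (h.contDiffAt_fderiv_apply hu z)).clm_apply
          (differentiableAt_const w)), add_apply,
      fderiv_app₂ hA (hd w) (hd z), fderiv_comp_apply' (F' := V →L[ℝ] V →L[ℝ] V) hL (h.differentiableAt hu),
      fderiv_apply_const (differentiableAt_fderiv (h.contDiffAt_fderiv_apply hu z)),
      h.right.fderiv_christoffelL hφ, h.left.fderiv_christoffel_apply hu] at h2
    rw [fderiv_apply_const (differentiableAt_fderiv (h.contDiffAt hu)), add_comm, h2]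
    simp only [christoffelL_apply]
    abel
  have h1 := key v w
  have h2 := key w v
  -- Third derivatives of φ are symmetric in v and w, hence drop out of the curvature.
  have h3 := fderiv_fderiv_comm (h.contDiffAt_fderiv_apply hu z) v w
  have h4 : ∀ v w, fderiv ℝ (fun x ↦ fderiv ℝ φ x (christoffel G u w z)) u v =
      fderiv ℝ φ u (christoffel G u v (christoffel G u w z)) -
      (christoffel G' (φ u) (fderiv ℝ φ u v) (christoffel G' (φ u) (fderiv ℝ φ u w)
        (fderiv ℝ φ u z)) + christoffel G' (φ u) (fderiv ℝ φ u v)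
        (fderiv ℝ (fun x ↦ fderiv ℝ φ x z) u w)) := by
    intro v w
    rw [h.map_christoffel hu v (christoffel G u w z), h.map_christoffel hu w z, map_add]
    abel
  rw [h4] at h1 h2
  rw [h3] at h1
  rw [h.second_symm hu v w] at h1
  rw [IsMetricOn.localCurvature_apply, IsMetricOn.localCurvature_apply]
  simp only [map_add, map_sub]
  have h5 := congrArg₂ (· - ·) h1 h2
  rw [← sub_eq_zero] at h5 ⊢
  rw [← h5]
  abel

/-- The differential of φ conjugates the endomorphisms v ↦ R_{v,w} z of the two metrics, so their
traces agree. -/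
theorem trace_ricciMap (w z : V) : localRicci G u w z =
    localRicci G' (φ u) (fderiv ℝ φ u w) (fderiv ℝ φ u z) := by
  rw [h.left.localRicci_eq_trace hu, h.right.localRicci_eq_trace (h.mapsTo u hu),
    ← LinearMap.trace_conj' _ (h.equiv hu)]
  congr 1
  ext v
  rw [LinearEquiv.conj_apply_apply]
  change fderiv ℝ φ u (localCurvature G u ((h.equiv hu).symm v) w z) = _
  rw [h.map_localCurvature hu, ← h.equiv_apply hu, LinearEquiv.apply_symm_apply]
  rfl

/-- Isometries preserve the scalar curvature. -/
theorem localScalarCurvature_eq : localScalarCurvature G u = localScalarCurvature G' (φ u) := by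
  have hφ := h.mapsTo u hu
  rw [h.left.localScalarCurvature_eq_trace hu _ (h.left.inner_ricciEnd hu),
    h.right.localScalarCurvature_eq_trace hφ ((h.equiv hu).conj (h.left.ricciEnd hu)),
    LinearMap.trace_conj']
  intro w z
  obtain ⟨w, rfl⟩ := (h.equiv hu).surjective w
  obtain ⟨z, rfl⟩ := (h.equiv hu).surjective z
  rw [LinearEquiv.conj_apply_apply, LinearEquiv.symm_apply_apply, h.equiv_apply hu,
    h.equiv_apply hu, ← h.inner u hu, h.left.inner_ricciEnd hu, h.trace_ricciMap hu]
  rfl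

end IsIsometryOn
end LocalCurvature

/-! ### The Levi-Civita connection pulled back along a linear projection. -/

section PullbackConnection

variable {V : Type*} [NormedAddCommGroup V] [NormedSpace ℝ V]
  {N : Type*} [NormedAddCommGroup N] [NormedSpace ℝ N]

/-- The covariant derivative of a field of endomorphisms along the linear map `pr`. -/
def covEnd (G : V → V →L[ℝ] V →L[ℝ] ℝ) (pr : N →L[ℝ] V) (A : N → V →L[ℝ] V) (x c : N) : V →L[ℝ] V :=
  fderiv ℝ A x c + christoffel G (pr x) (pr c) * A x - A x * christoffel G (pr x) (pr c)

/-- The covariant derivative of a vector field along the linear map `pr`. -/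
def covVec (G : V → V →L[ℝ] V →L[ℝ] ℝ) (pr : N →L[ℝ] V) (f : N → V) (x c : N) : V :=
  fderiv ℝ f x c + christoffel G (pr x) (pr c) (f x)

variable (V) in
/-- The trace of a continuous endomorphism. -/
def trL [FiniteDimensional ℝ V] : (V →L[ℝ] V) →L[ℝ] ℝ :=
  LinearMap.toContinuousLinearMap
    ((LinearMap.trace ℝ V).comp (ContinuousLinearMap.coeLM ℝ))

theorem trL_apply [FiniteDimensional ℝ V] (A : V →L[ℝ] V) :
    trL V A = LinearMap.trace ℝ V A := rfl

theorem trL_mul_comm [FiniteDimensional ℝ V] (A B : V →L[ℝ] V) : trL V (A * B) = trL V (B * A) :=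
  LinearMap.trace_mul_comm ℝ (A : V →ₗ[ℝ] V) (B : V →ₗ[ℝ] V)

theorem trL_one [FiniteDimensional ℝ V] : trL V 1 = Module.finrank ℝ V :=
  LinearMap.trace_one ℝ V

variable {G : V → V →L[ℝ] V →L[ℝ] ℝ} {U : Set V} {pr : N →L[ℝ] V}
  {A B : N → V →L[ℝ] V} {f f' : N → V} {x : N}

theorem covEnd_mul (hA : DifferentiableAt ℝ A x) (hB : DifferentiableAt ℝ B x) (c : N) :
    covEnd G pr (fun y ↦ A y * B y) x c = covEnd G pr A x c * B x + A x * covEnd G pr B x c := by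
  simp only [covEnd, fderiv_mul_apply hA hB]
  noncomm_ring

theorem covVec_app (hA : DifferentiableAt ℝ A x) (hf : DifferentiableAt ℝ f x) (c : N) :
    covVec G pr (fun y ↦ A y (f y)) x c = covEnd G pr A x c (f x) + A x (covVec G pr f x c) := by
  simp only [covEnd, covVec, fderiv_app hA hf, add_apply, sub_apply, map_add,
    mul_apply_eq_comp]
  abel

theorem covEnd_add (hA : DifferentiableAt ℝ A x) (hB : DifferentiableAt ℝ B x) (c : N) :
    covEnd G pr (fun y ↦ A y + B y) x c = covEnd G pr A x c + covEnd G pr B x c := by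
  simp only [covEnd, fderiv_fun_add hA hB, add_apply]
  noncomm_ring

theorem covEnd_sub (hA : DifferentiableAt ℝ A x) (hB : DifferentiableAt ℝ B x) (c : N) :
    covEnd G pr (fun y ↦ A y - B y) x c = covEnd G pr A x c - covEnd G pr B x c := by
  simp only [covEnd, fderiv_fun_sub hA hB, sub_apply]
  noncomm_ring

theorem covEnd_smul {s : N → ℝ} (hs : DifferentiableAt ℝ s x) (hA : DifferentiableAt ℝ A x) (c : N) :
    covEnd G pr (fun y ↦ s y • A y) x c = fderiv ℝ s x c • A x + s x • covEnd G pr A x c := by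
  simp only [covEnd, fderiv_fun_smul hs hA, add_apply, smul_apply,
    ContinuousLinearMap.smulRight_apply, mul_smul_comm, smul_mul_assoc]
  module

theorem covEnd_const_smul (s : ℝ) (hA : DifferentiableAt ℝ A x) (c : N) :
    covEnd G pr (fun y ↦ s • A y) x c = s • covEnd G pr A x c := by
  rw [covEnd_smul (differentiableAt_const s) hA]
  simp

theorem covVec_sub (hf : DifferentiableAt ℝ f x) (hf' : DifferentiableAt ℝ f' x) (c : N) :
    covVec G pr (fun y ↦ f y - f' y) x c = covVec G pr f x c - covVec G pr f' x c := by
  simp only [covVec, fderiv_fun_sub hf hf', sub_apply, map_sub]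
  abel

theorem covVec_const_smul (s : ℝ) (hf : DifferentiableAt ℝ f x) (c : N) :
    covVec G pr (fun y ↦ s • f y) x c = s • covVec G pr f x c := by
  simp only [covVec, fderiv_fun_const_smul hf, smul_apply, map_smul, smul_add]

theorem covVec_const (v : V) (c : N) :
    covVec G pr (fun _ ↦ v) x c = christoffel G (pr x) (pr c) v := by
  simp [covVec]

theorem covEnd_congr (h : A =ᶠ[nhds x] B) (c : N) : covEnd G pr A x c = covEnd G pr B x c := by
  simp only [covEnd, h.fderiv_eq, h.eq_of_nhds]

theorem covEnd_add_right (a b : N) :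
    covEnd G pr A x (a + b) = covEnd G pr A x a + covEnd G pr A x b := by
  simp only [covEnd, map_add, christoffel_add]
  noncomm_ring

theorem covEnd_smul_right (s : ℝ) (a : N) :
    covEnd G pr A x (s • a) = s • covEnd G pr A x a := by
  simp only [covEnd, map_smul, christoffel_smul, smul_mul_assoc, mul_smul_comm]
  module

variable [FiniteDimensional ℝ V]

/-- The trace is parallel because commutators have trace zero. -/
theorem fderiv_trL (hA : DifferentiableAt ℝ A x) (c : N) :
    fderiv ℝ (fun y ↦ trL V (A y)) x c = trL V (covEnd G pr A x c) := by
  rw [fderiv_comp_apply' (trL V).differentiableAt hA, ContinuousLinearMap.fderiv]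
  simp only [covEnd, map_add, map_sub, trL_mul_comm (A x)]
  ring

section
variable (hG : IsMetricOn G U) (hx : pr x ∈ U)
include hG hx

set_option synthInstance.maxHeartbeats 200000 in
theorem fderiv_inner_pull (hf : DifferentiableAt ℝ f x) (hf' : DifferentiableAt ℝ f' x) (c : N) :
    fderiv ℝ (fun y ↦ G (pr y) (f y) (f' y)) x c =
      G (pr x) (covVec G pr f x c) (f' x) + G (pr x) (f x) (covVec G pr f' x c) := by
  have h : DifferentiableAt ℝ (fun y ↦ G (pr y)) x :=
    differentiableAt_comp' (F' := V →L[ℝ] V →L[ℝ] ℝ) (hG.differentiableAt hx) pr.differentiableAt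
  rw [fderiv_app₂ h hf hf', fderiv_comp_apply' (F' := V →L[ℝ] V →L[ℝ] ℝ) (hG.differentiableAt hx)
    pr.differentiableAt, ContinuousLinearMap.fderiv, hG.fderiv_eq hx]
  simp only [covVec, map_add, add_apply]
  ring

theorem contDiffAt_christoffel_pull (v : V) :
    ContDiffAt ℝ ∞ (fun y ↦ christoffel G (pr y) v) x :=
  (hG.contDiffAt_christoffel hx v).comp x pr.contDiff.contDiffAt

theorem fderiv_christoffel_pull (v : V) (c : N) :
    fderiv ℝ (fun y ↦ christoffel G (pr y) v) x c =
      fderiv ℝ (fun p ↦ christoffel G p v) (pr x) (pr c) := by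
  rw [fderiv_comp_apply' (hG.hasFDerivAt_christoffel hx v).differentiableAt pr.differentiableAt,
    ContinuousLinearMap.fderiv]

theorem contDiffAt_covEnd (hA : ContDiffAt ℝ ∞ A x) (c : N) :
    ContDiffAt ℝ ∞ (fun y ↦ covEnd G pr A y c) x := by
  have h1 := contDiffAt_christoffel_pull hG hx (pr c)
  have h2 : ContDiffAt ℝ ∞ (fun y ↦ fderiv ℝ A y c) x :=
    contDiffAt_apply_apply (hA.fderiv_right (by simp)) c
  exact (h2.add (h1.mul hA)).sub (hA.mul h1)

theorem contDiffAt_covVec (hf : ContDiffAt ℝ ∞ f x) (c : N) :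
    ContDiffAt ℝ ∞ (fun y ↦ covVec G pr f y c) x := by
  have h1 := contDiffAt_christoffel_pull hG hx (pr c)
  have h2 : ContDiffAt ℝ ∞ (fun y ↦ fderiv ℝ f y c) x :=
    contDiffAt_apply_apply (hf.fderiv_right (by simp)) c
  exact h2.add (h1.clm_apply hf)

theorem localCurvature_pull (c a : N) : localCurvature G (pr x) (pr c) (pr a) =
    fderiv ℝ (fun y ↦ christoffel G (pr y) (pr a)) x c -
      fderiv ℝ (fun y ↦ christoffel G (pr y) (pr c)) x a +
      christoffel G (pr x) (pr c) * christoffel G (pr x) (pr a) -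
      christoffel G (pr x) (pr a) * christoffel G (pr x) (pr c) := by
  rw [fderiv_christoffel_pull hG hx, fderiv_christoffel_pull hG hx]
  rfl

/-- The Ricci identity for endomorphisms. -/
theorem covEnd_comm (hA : ContDiffAt ℝ ∞ A x) (c a : N) :
    covEnd G pr (fun y ↦ covEnd G pr A y a) x c - covEnd G pr (fun y ↦ covEnd G pr A y c) x a =
      localCurvature G (pr x) (pr c) (pr a) * A x - A x * localCurvature G (pr x) (pr c) (pr a) := by
  have hd := hA.differentiableAt (by simp)
  have h1 := fun a : N ↦ (contDiffAt_christoffel_pull hG hx (pr a)).differentiableAt (by simp)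
  have h2 : ∀ a : N, DifferentiableAt ℝ (fun y ↦ fderiv ℝ A y a) x := fun a ↦
    (differentiableAt_fderiv hA).clm_apply (differentiableAt_const a)
  have key : ∀ a c : N, fderiv ℝ (fun y ↦ covEnd G pr A y a) x c =
      fderiv ℝ (fderiv ℝ A) x c a +
      (christoffel G (pr x) (pr a) * fderiv ℝ A x c +
        fderiv ℝ (fun y ↦ christoffel G (pr y) (pr a)) x c * A x) -
      (A x * fderiv ℝ (fun y ↦ christoffel G (pr y) (pr a)) x c +
        fderiv ℝ A x c * christoffel G (pr x) (pr a)) := by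
    intro a c
    have e : (fun y ↦ covEnd G pr A y a) = fun y ↦ fderiv ℝ A y a +
      christoffel G (pr y) (pr a) * A y - A y * christoffel G (pr y) (pr a) := rfl
    rw [e, fderiv_fun_sub ((h2 a).fun_add ((h1 a).fun_mul hd)) (hd.fun_mul (h1 a)),
      fderiv_fun_add (h2 a) ((h1 a).fun_mul hd), sub_apply, add_apply, fderiv_mul_apply (h1 a) hd,
      fderiv_mul_apply hd (h1 a), fderiv_apply_const (differentiableAt_fderiv hA)]
  rw [localCurvature_pull hG hx]
  simp only [covEnd] at key ⊢
  -- The directions a and c are constant fields, so there is no bracket term; the second derivatives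
  -- of `A` cancel and the curvature remains.
  rw [key, key, fderiv_fderiv_comm hA a c]
  noncomm_ring

/-- The Ricci identity for vector fields. -/
theorem covVec_comm (hf : ContDiffAt ℝ ∞ f x) (c a : N) :
    covVec G pr (fun y ↦ covVec G pr f y a) x c - covVec G pr (fun y ↦ covVec G pr f y c) x a =
      localCurvature G (pr x) (pr c) (pr a) (f x) := by
  have hd := hf.differentiableAt (by simp)
  have h1 := fun a : N ↦ (contDiffAt_christoffel_pull hG hx (pr a)).differentiableAt (by simp)
  have h2 : ∀ a : N, DifferentiableAt ℝ (fun y ↦ fderiv ℝ f y a) x := fun a ↦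
    (differentiableAt_fderiv hf).clm_apply (differentiableAt_const a)
  have key : ∀ a c : N, fderiv ℝ (fun y ↦ covVec G pr f y a) x c =
      fderiv ℝ (fderiv ℝ f) x c a +
      (christoffel G (pr x) (pr a) (fderiv ℝ f x c) +
        fderiv ℝ (fun y ↦ christoffel G (pr y) (pr a)) x c (f x)) := by
    intro a c
    have e : (fun y ↦ covVec G pr f y a) = fun y ↦ fderiv ℝ f y a +
      christoffel G (pr y) (pr a) (f y) := rfl
    rw [e, fderiv_fun_add (h2 a) ((h1 a).clm_apply hd), add_apply, fderiv_app (h1 a) hd,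
      fderiv_apply_const (differentiableAt_fderiv hf)]
  rw [localCurvature_pull hG hx]
  simp only [covVec] at key ⊢
  rw [key, key, fderiv_fderiv_comm hf a c]
  simp only [map_add, add_apply, sub_apply, mul_apply_eq_comp]
  abel

end

end PullbackConnection

/-! ### Algebra of curvature tensors that normalize a quaternionic structure. -/

section QuaternionicAlgebra

variable {V : Type*} [NormedAddCommGroup V] [NormedSpace ℝ V]

/-- `I, J, K = I J` is a basis of the imaginary quaternions acting on `V` by skew maps. -/
structure QuatTriple (g : V →L[ℝ] V →L[ℝ] ℝ) (I J K : V →L[ℝ] V) : Prop where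
  II : I * I = -1
  JJ : J * J = -1
  IJ : I * J = K
  JI : J * I = -K
  skewI : ∀ v w, g (I v) w = -g v (I w)
  skewJ : ∀ v w, g (J v) w = -g v (J w)

namespace QuatTriple
variable {g : V →L[ℝ] V →L[ℝ] ℝ} {I J K : V →L[ℝ] V} (h : QuatTriple g I J K)
include h

theorem JK : J * K = I := by rw [← neg_eq_iff_eq_neg.2 h.JI, mul_neg, ← mul_assoc, h.JJ]; simp
theorem IK : I * K = -J := by rw [← h.IJ, ← mul_assoc, h.II]; simp
theorem KJ : K * J = -I := by rw [← h.IJ, mul_assoc, h.JJ]; simp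
theorem KI : K * I = J := by rw [← h.IJ, mul_assoc, h.JI, mul_neg, h.IK, neg_neg]
theorem KK : K * K = -1 := by nth_rw 1 [← h.IJ]; rw [mul_assoc, h.JK, h.II]

theorem skewK (v w : V) : g (K v) w = -g v (K w) := by
  have h1 : K w = -(J (I w)) := by
    have := congrArg (fun A : V →L[ℝ] V ↦ A w) h.JI
    simp only [mul_apply_eq_comp, neg_apply] at this
    rw [this, neg_neg]
  rw [h1, ← h.IJ, mul_apply_eq_comp, h.skewI, h.skewJ, map_neg]

/-- The cyclic symmetry I → J → K → I: an identity proved for one member of the triple holds for the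
other two. -/
theorem rotate : QuatTriple g J K I where
  II := h.JJ
  JJ := h.KK
  IJ := h.JK
  JI := h.KJ
  skewI := h.skewJ
  skewJ := h.skewK

theorem apply_II (v : V) : I (I v) = -v := by
  have := congrArg (fun A : V →L[ℝ] V ↦ A v) h.II; simpa using this
theorem apply_JJ (v : V) : J (J v) = -v := h.rotate.apply_II v
theorem apply_KK (v : V) : K (K v) = -v := h.rotate.rotate.apply_II v
theorem apply_IJ (v : V) : I (J v) = K v := by
  have := congrArg (fun A : V →L[ℝ] V ↦ A v) h.IJ; simpa using this
theorem apply_JK (v : V) : J (K v) = I v := h.rotate.apply_IJ v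
theorem apply_KI (v : V) : K (I v) = J v := h.rotate.rotate.apply_IJ v
theorem apply_JI (v : V) : J (I v) = -K v := by
  have := congrArg (fun A : V →L[ℝ] V ↦ A v) h.JI; simpa using this
theorem apply_KJ (v : V) : K (J v) = -I v := h.rotate.apply_JI v
theorem apply_IK (v : V) : I (K v) = -J v := h.rotate.rotate.apply_JI v

theorem inner_I (v w : V) : g (I v) (I w) = g v w := by
  rw [h.skewI, h.apply_II, map_neg, neg_neg]

variable [FiniteDimensional ℝ V]

/-- From I = J(IJ) and the cyclicity of the trace, tr I = tr(IJJ) = −tr I. -/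
theorem trI : trL V I = 0 := by
  have h1 : J * (I * J) = I := by rw [h.IJ, h.JK]
  have h2 := congrArg (trL V) h1
  rw [trL_mul_comm, mul_assoc, h.JJ, mul_neg, mul_one, map_neg] at h2
  linarith
theorem trJ : trL V J = 0 := h.rotate.trI
theorem trK : trL V K = 0 := h.rotate.rotate.trI

theorem tr_comb (a b c : ℝ) : trL V ((a • I + b • J + c • K) * I) = -a * Module.finrank ℝ V := by
  simp only [add_mul, smul_mul_assoc, h.II, h.JI, h.KI, map_add, map_smul, map_neg, h.trJ, h.trK,
    trL_one, smul_eq_mul]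
  ring

end QuatTriple

/-- The symmetries of a Riemann curvature tensor. -/
structure IsAlgCurvature (g : V →L[ℝ] V →L[ℝ] ℝ) (R : V → V → V →L[ℝ] V) : Prop where
  add_left : ∀ v v' w, R (v + v') w = R v w + R v' w
  smul_left : ∀ (c : ℝ) v w, R (c • v) w = c • R v w
  antisymm : ∀ v w, R v w = -R w v
  bianchi : ∀ x y z, R x y z + R y z x + R z x y = 0
  skew : ∀ v w x y, g (R v w x) y = -g x (R v w y)

/-- Under the isomorphism of `V` with its dual given by `g`, the adjoint `B` becomes the transpose
of `A`, which has the same trace. -/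
theorem trace_eq_of_adjoint [FiniteDimensional ℝ V] {g : V →L[ℝ] V →L[ℝ] ℝ}
    (hpos : ∀ v, v ≠ 0 → 0 < g v v) (hsymm : ∀ v w, g v w = g w v)
    {A B : V →ₗ[ℝ] V} (h : ∀ v w, g (A v) w = g v (B w)) :
    LinearMap.trace ℝ V A = LinearMap.trace ℝ V B := by
  let e : V ≃ₗ[ℝ] Module.Dual ℝ V :=
    (nondegEquiv g hpos).toLinearEquiv.trans LinearMap.toContinuousLinearMap.symm
  have he : ∀ v w, e v w = g v w := fun v w ↦ rfl
  have h1 : e.conj B = Module.Dual.transpose (R := ℝ) A := by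
    ext f w
    obtain ⟨v, rfl⟩ := e.surjective f
    rw [LinearEquiv.conj_apply_apply, LinearEquiv.symm_apply_apply, he, Module.Dual.transpose_apply,
      LinearMap.comp_apply, he, hsymm, ← h, hsymm]
  rw [← LinearMap.trace_conj' B e, h1, LinearMap.trace_transpose']

namespace IsAlgCurvature
variable {g : V →L[ℝ] V →L[ℝ] ℝ} {R : V → V → V →L[ℝ] V} (hR : IsAlgCurvature g R)
include hR

theorem neg_left (v w : V) : R (-v) w = -R v w := by
  rw [← neg_one_smul ℝ, hR.smul_left, neg_one_smul]

/-- The classical consequence of the other symmetries: the Bianchi identities of the four cyclic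
shifts of (x, y, z, w) are combined, and the two antisymmetries cancel all terms but the wanted
ones. -/
theorem pair_symm (hsymm : ∀ v w, g v w = g w v) (x y z w : V) :
    g (R x y z) w = g (R z w x) y := by
  have b : ∀ x y z w, g (R x y z) w + g (R y z x) w + g (R z x y) w = 0 := by
    intro x y z w
    rw [← add_apply, ← map_add, ← add_apply, ← map_add, hR.bianchi]; simp
  have a : ∀ x y z w, g (R x y z) w = -g (R y x z) w := by
    intro x y z w
    rw [hR.antisymm x y]; simp
  have s : ∀ x y z w, g (R x y z) w = -g (R x y w) z := by
    intro x y z w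
    rw [hR.skew, hsymm]
  have b1 := b x y z w
  have b2 := b y z w x
  have b3 := b z w x y
  have b4 := b w x y z
  have e1 := s y z w x
  have e2 := s z w y x
  have e3 := a w y z x
  have e4 := a w x z y
  have e5 := s x w z y
  have e6 := a x z w y
  have e7 := s z x w y
  have e8 := a w x y z
  have e9 := s x y w z
  have e10 := s y w x z
  linarith

/-- The endomorphism `v ↦ R_{v, w} z`. -/
def ricMap (w z : V) : V →ₗ[ℝ] V where
  toFun v := R v w z
  map_add' v v' := by rw [hR.add_left]; rfl
  map_smul' c v := by rw [hR.smul_left]; rfl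

/-- The Ricci tensor. -/
def ric [FiniteDimensional ℝ V] (w z : V) : ℝ := LinearMap.trace ℝ V (hR.ricMap w z)

/-- Pair symmetry makes v ↦ R_{v,w} z and v ↦ R_{v,z} w adjoint to each other. -/
theorem ric_symm [FiniteDimensional ℝ V] (hpos : ∀ v, v ≠ 0 → 0 < g v v)
    (hsymm : ∀ v w, g v w = g w v) (w z : V) : hR.ric w z = hR.ric z w := by
  refine trace_eq_of_adjoint hpos hsymm fun v y ↦ ?_
  change g (R v w z) y = g v (R y z w)
  rw [hR.pair_symm hsymm, hR.skew, hR.antisymm z y]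
  simp

theorem ric_add_right [FiniteDimensional ℝ V] (w z z' : V) :
    hR.ric w (z + z') = hR.ric w z + hR.ric w z' := by
  have : hR.ricMap w (z + z') = hR.ricMap w z + hR.ricMap w z' := by
    ext v; simp [ricMap]
  rw [ric, this, map_add]; rfl

theorem ric_smul_right [FiniteDimensional ℝ V] (c : ℝ) (w z : V) :
    hR.ric w (c • z) = c * hR.ric w z := by
  have : hR.ricMap w (c • z) = c • hR.ricMap w z := by
    ext v; simp [ricMap]
  rw [ric, this, map_smul]; rfl

theorem ric_neg_right [FiniteDimensional ℝ V] (w z : V) : hR.ric w (-z) = -hR.ric w z := by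
  rw [← neg_one_smul ℝ, hR.ric_smul_right]; ring

variable [FiniteDimensional ℝ V] 

/-- The trace of `v ↦ A (R_{v, X} Y)`. -/
theorem tr_curvature_mul (hpos : ∀ v, v ≠ 0 → 0 < g v v) (hsymm : ∀ v w, g v w = g w v)
    {A : V →L[ℝ] V} (hA : ∀ v w, g (A v) w = -g v (A w)) (X Y : V) :
    trL V (R X Y * A) = -2 * LinearMap.trace ℝ V ((A : V →ₗ[ℝ] V) ∘ₗ hR.ricMap X Y) := by
  -- By pair symmetry and the skewness of `A`, the adjoint of v ↦ R_{Av,Y} X is w ↦ −A R_{w,X} Y.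
  have h1 : LinearMap.trace ℝ V ((A : V →ₗ[ℝ] V) ∘ₗ hR.ricMap Y X) =
      -LinearMap.trace ℝ V ((A : V →ₗ[ℝ] V) ∘ₗ hR.ricMap X Y) := by
    rw [← LinearMap.trace_comp_comm', ← map_neg]
    refine trace_eq_of_adjoint hpos hsymm fun v w ↦ ?_
    change g (R (A v) Y X) w = g v (-(A (R w X Y)))
    rw [hR.pair_symm hsymm, hR.skew, hA, hR.antisymm X w]
    simp
  -- The first Bianchi identity, in the form R_{X,Y} v = R_{v,Y} X − R_{v,X} Y.
  have h2 : (A : V →ₗ[ℝ] V) ∘ₗ (R X Y : V →ₗ[ℝ] V) =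
      (A : V →ₗ[ℝ] V) ∘ₗ hR.ricMap Y X - (A : V →ₗ[ℝ] V) ∘ₗ hR.ricMap X Y := by
    ext v
    have h3 := hR.bianchi X Y v
    have h4 : R v X Y = -(R X v Y) := by rw [hR.antisymm v X]; simp
    change A (R X Y v) = A (R v Y X) - A (R v X Y)
    rw [← map_sub]
    congr 1
    rw [hR.antisymm v Y, neg_apply]
    rw [eq_sub_iff_add_eq, ← sub_eq_zero, ← h3]; abel
  rw [trL_mul_comm, trL_apply]
  refine (congrArg (LinearMap.trace ℝ V) h2).trans ?_
  rw [map_sub, h1]; ring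

end IsAlgCurvature

/-- A curvature tensor whose operators normalize the quaternionic structure spanned by `I, J, K`. -/
structure IsQuatCurvature (n : ℕ) (g : V →L[ℝ] V →L[ℝ] ℝ) (R : V → V → V →L[ℝ] V)
    (I J K : V →L[ℝ] V) : Prop where
  curv : IsAlgCurvature g R
  quat : QuatTriple g I J K
  pos : ∀ v, v ≠ 0 → 0 < g v v
  symm : ∀ v w, g v w = g w v
  finrank_eq : Module.finrank ℝ V = 4 * n
  two_le : 2 ≤ n
  commI : ∀ v w, ∃ a b c : ℝ, R v w * I - I * R v w = a • I + b • J + c • K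
  commJ : ∀ v w, ∃ a b c : ℝ, R v w * J - J * R v w = a • I + b • J + c • K
  commK : ∀ v w, ∃ a b c : ℝ, R v w * K - K * R v w = a • I + b • J + c • K

namespace IsQuatCurvature

/-- The component of the curvature in the direction of `A`. -/
def phi [FiniteDimensional ℝ V] (n : ℕ) (R : V → V → V →L[ℝ] V) (A : V →L[ℝ] V) (v w : V) : ℝ :=
  -trL V (R v w * A) / (4 * n)

variable {n : ℕ} {g : V →L[ℝ] V →L[ℝ] ℝ} {R : V → V → V →L[ℝ] V} {I J K : V →L[ℝ] V}
  (h : IsQuatCurvature n g R I J K)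
include h

theorem rotate : IsQuatCurvature n g R J K I where
  curv := h.curv
  quat := h.quat.rotate
  pos := h.pos
  symm := h.symm
  finrank_eq := h.finrank_eq
  two_le := h.two_le
  commI v w := by
    obtain ⟨a, b, c, e⟩ := h.commJ v w
    exact ⟨b, c, a, by rw [e]; abel⟩
  commJ v w := by
    obtain ⟨a, b, c, e⟩ := h.commK v w
    exact ⟨b, c, a, by rw [e]; abel⟩
  commK v w := by
    obtain ⟨a, b, c, e⟩ := h.commI v w
    exact ⟨b, c, a, by rw [e]; abel⟩

theorem n_pos : (0 : ℝ) < n := by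
  have := h.two_le
  exact_mod_cast (by omega : 0 < n)

variable [FiniteDimensional ℝ V]

theorem trL_eq (A : V →L[ℝ] V) (v w : V) : trL V (R v w * A) = -(4 * n) * phi n R A v w := by
  have := h.n_pos.ne'
  rw [phi]; field_simp

/-- The coefficients of the commutator are read off by taking traces against I, J and K. Since
tr([R, I]A) = tr(R[I, A]), the one along I vanishes and the other two are components φ of the
curvature. -/
theorem comm_eq (v w : V) : R v w * I - I * R v w =
    (2 * phi n R K v w) • J - (2 * phi n R J v w) • K := by
  obtain ⟨a, b, c, e⟩ := h.commI v w
  have hn := h.n_pos.ne'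
  have hf : (Module.finrank ℝ V : ℝ) = 4 * n := by rw [h.finrank_eq]; push_cast; ring
  have t : ∀ A : V →L[ℝ] V, trL V ((R v w * I - I * R v w) * A) =
      trL V (R v w * (I * A)) - trL V (R v w * (A * I)) := by
    intro A
    rw [sub_mul, map_sub, mul_assoc, mul_assoc, trL_mul_comm I, mul_assoc]
  have ha : a = 0 := by
    have h1 := t I
    rw [sub_self, e, h.quat.tr_comb, hf] at h1
    have : a * (4 * n) = 0 := by linarith
    exact (mul_eq_zero.1 this).resolve_right (by positivity)
  have hb : b = 2 * phi n R K v w := by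
    have h1 := t J
    rw [e, h.quat.IJ, h.quat.JI, mul_neg, map_neg, h.trL_eq,
      show a • I + b • J + c • K = b • J + c • K + a • I by abel, h.quat.rotate.tr_comb, hf] at h1
    have : (b - 2 * phi n R K v w) * (4 * n) = 0 := by linarith
    exact sub_eq_zero.1 ((mul_eq_zero.1 this).resolve_right (by positivity))
  have hc : c = -(2 * phi n R J v w) := by
    have h1 := t K
    rw [e, h.quat.IK, h.quat.KI, mul_neg, map_neg, h.trL_eq,
      show a • I + b • J + c • K = c • K + a • I + b • J by abel,
      h.quat.rotate.rotate.tr_comb, hf] at h1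
    have : (c + 2 * phi n R J v w) * (4 * n) = 0 := by linarith
    exact eq_neg_of_add_eq_zero_left ((mul_eq_zero.1 this).resolve_right (by positivity))
  rw [e, ha, hb, hc]
  module

theorem phi_antisymm (A : V →L[ℝ] V) (v w : V) : phi n R A v w = -phi n R A w v := by
  simp only [phi, h.curv.antisymm v w, neg_mul, map_neg]
  ring

theorem phi_neg_right (A : V →L[ℝ] V) (v w : V) : phi n R A v (-w) = -phi n R A v w := by
  rw [h.phi_antisymm A v, h.phi_antisymm A v]
  simp only [phi, h.curv.neg_left, neg_mul, map_neg]
  ring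

/-- `φ_A (·, w)` as a linear form. -/
def phiL (A : V →L[ℝ] V) (w : V) : V →ₗ[ℝ] ℝ where
  toFun v := phi n R A v w
  map_add' v v' := by simp only [phi, h.curv.add_left, add_mul, map_add]; ring
  map_smul' c v := by
    simp only [phi, h.curv.smul_left, smul_mul_assoc, map_smul, smul_eq_mul, RingHom.id_apply]; ring

/-- By `comm_eq`, R_{v,X}(IY) = I R_{v,X} Y + 2φ_K(v, X) JY − 2φ_J(v, X) KY; now take the trace over
v. The first term contributes 2nφ_I(X, Y) by `tr_curvature_mul`, and the other two are maps of rank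
one. -/
theorem ric_I (X Y : V) : h.curv.ric X (I Y) =
    2 * n * phi n R I X Y + 2 * phi n R K (J Y) X - 2 * phi n R J (K Y) X := by
  have e : h.curv.ricMap X (I Y) = (I : V →ₗ[ℝ] V) ∘ₗ h.curv.ricMap X Y +
      ((2 : ℝ) • (h.phiL K X).smulRight (J Y) - (2 : ℝ) • (h.phiL J X).smulRight (K Y)) := by
    ext v
    have h1 := congrArg (fun A : V →L[ℝ] V ↦ A Y) (h.comm_eq v X)
    simp only [sub_apply, mul_apply_eq_comp, smul_apply] at h1
    change R v X (I Y) = I (R v X Y) + ((2 : ℝ) • (phi n R K v X) • J Y -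
      (2 : ℝ) • (phi n R J v X) • K Y)
    rw [smul_smul, smul_smul, ← h1]; abel
  have h1 := h.curv.tr_curvature_mul h.pos h.symm h.quat.skewI X Y
  rw [h.trL_eq] at h1
  rw [IsAlgCurvature.ric, e, map_add, map_sub, map_smul, map_smul, LinearMap.trace_smulRight,
    LinearMap.trace_smulRight]
  change _ + ((2 : ℝ) • phi n R K (J Y) X - (2 : ℝ) • phi n R J (K Y) X) = _
  simp only [smul_eq_mul]
  linarith

/-- This is `ric_I` with IY in place of Y, in a form whose left side does not change when the triple
is rotated. -/
theorem neg_ric (X Y : V) : -h.curv.ric X Y = 2 * n * phi n R I X (I Y) +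
    2 * phi n R J X (J Y) + 2 * phi n R K X (K Y) := by
  have h1 := h.ric_I X (I Y)
  rw [h.quat.apply_II, h.quat.apply_JI, h.quat.apply_KI, h.curv.ric_neg_right,
    h.phi_antisymm K (-K Y), h.phi_antisymm J (J Y), h.phi_neg_right] at h1
  linarith

/-- The three rotations of `neg_ric` are a linear system for φ_I(X, IY), φ_J(X, JY) and φ_K(X, KY).
Differences of the equations carry the factor 2n − 2, which is nonzero for n ≥ 2. So the three
numbers coincide, and each is −Ric(X, Y)/(2n + 4). -/
theorem phi_eq (X Y : V) : phi n R I X Y = h.curv.ric X (I Y) / (2 * n + 4) := by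
  have key : ∀ Y, phi n R I X (I Y) = -h.curv.ric X Y / (2 * n + 4) := by
    intro Y
    have h1 := h.neg_ric X Y
    have h2 := h.rotate.neg_ric X Y
    have h3 := h.rotate.rotate.neg_ric X Y
    have hn : (2 : ℝ) ≤ n := by exact_mod_cast h.two_le
    have e1 : (2 * n - 2 : ℝ) * (phi n R I X (I Y) - phi n R J X (J Y)) = 0 := by linarith
    have e2 : (2 * n - 2 : ℝ) * (phi n R I X (I Y) - phi n R K X (K Y)) = 0 := by linarith
    have h0 : (2 * n - 2 : ℝ) ≠ 0 := by linarith
    have e1' := (mul_eq_zero.1 e1).resolve_left h0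
    have e2' := (mul_eq_zero.1 e2).resolve_left h0
    rw [eq_div_iff (by positivity)]
    linarith
  have h1 := key (-(I Y))
  rw [map_neg, h.quat.apply_II, neg_neg, h.curv.ric_neg_right, neg_neg] at h1
  exact h1

/-- By `phi_eq` the form Ric(·, I·) is a multiple of φ_I, which is alternating; the symmetry of Ric
gives the rest. Equivalently, the Ricci tensor is invariant under I. -/
theorem ric_I_left (X Y : V) : h.curv.ric (I X) Y = -h.curv.ric X (I Y) := by
  have h1 := h.phi_eq X Y
  have h2 := h.phi_eq Y X
  have hn := h.n_pos
  rw [h.phi_antisymm, h2] at h1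
  rw [h.curv.ric_symm h.pos h.symm]
  field_simp at h1
  linarith

/-- The Ricci endomorphism. -/
theorem exists_ricEnd : ∃ ρ : V →L[ℝ] V, ∀ v w, g (ρ v) w = h.curv.ric v w := by
  let f : V →ₗ[ℝ] V →L[ℝ] ℝ :=
    { toFun := fun v ↦ LinearMap.toContinuousLinearMap
        { toFun := h.curv.ric v
          map_add' := h.curv.ric_add_right v
          map_smul' := fun c w ↦ h.curv.ric_smul_right c v w }
      map_add' := fun v v' ↦ by
        ext w
        change h.curv.ric (v + v') w = h.curv.ric v w + h.curv.ric v' w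
        simp only [h.curv.ric_symm h.pos h.symm _ w, h.curv.ric_add_right]
      map_smul' := fun c v ↦ by
        ext w
        change h.curv.ric (c • v) w = c * h.curv.ric v w
        simp only [h.curv.ric_symm h.pos h.symm _ w, h.curv.ric_smul_right] }
  refine ⟨LinearMap.toContinuousLinearMap
    ((nondegEquiv g h.pos).symm.toLinearEquiv.toLinearMap ∘ₗ f), fun v w ↦ ?_⟩
  exact congrArg (fun T : V →L[ℝ] ℝ ↦ T w) ((nondegEquiv g h.pos).apply_symm_apply (f v))

theorem ext_inner {v w : V} (hz : ∀ z, g v z = g w z) : v = w :=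
  (nondegEquiv g h.pos).injective (ContinuousLinearMap.ext hz)

/-- Quaternionic curvature tensors of dimension `n ≥ 2` are Einstein. -/
theorem ric_eq {ρ : V →L[ℝ] V} (hρ : ∀ v w, g (ρ v) w = h.curv.ric v w) (X Y : V) :
    h.curv.ric X Y = trL V ρ / (4 * n) * g X Y := by
  have hn := h.n_pos
  -- The adjoint of ρI is −Iρ, so tr(ρI) = −tr(Iρ) = −tr(ρI).
  have hρI : trL V (ρ * I) = 0 := by
    have h1 : trL V (ρ * I) = trL V (-(I * ρ)) := by
      refine trace_eq_of_adjoint h.pos h.symm fun v w ↦ ?_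
      change g (ρ (I v)) w = g v (-(I (ρ w)))
      rw [hρ, h.curv.ric_symm h.pos h.symm, ← hρ, h.symm, h.quat.skewI, map_neg]
    rw [map_neg, trL_mul_comm I ρ] at h1
    linarith
  have key : ∀ X Y, h.curv.ric X (J Y) = trL V ρ / (4 * n) * g X (J Y) := by
    intro X Y
    -- `comm_eq` for R_{Z,W}, paired with X and IY, is turned around by pair symmetry into a
    -- statement about R_{IX,IY} − R_{X,Y}; `phi_eq` replaces φ by the Ricci tensor.
    have hop : R (I X) (I Y) - R X Y =
        (2 / (2 * n + 4) : ℝ) • (g (K X) Y • (K * ρ) + g (J X) Y • (J * ρ)) := by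
      ext Z
      refine h.ext_inner fun W ↦ ?_
      have h1 := congrArg (fun A : V →L[ℝ] V ↦ g (A X) (I Y)) (h.comm_eq Z W)
      simp only [sub_apply, mul_apply_eq_comp, smul_apply, map_sub, map_smul, smul_eq_mul] at h1
      rw [h.quat.inner_I, ← neg_eq_iff_eq_neg.2 (h.quat.skewI (J X) Y),
        ← neg_eq_iff_eq_neg.2 (h.quat.skewI (K X) Y), h.quat.apply_IJ, h.quat.apply_IK,
        h.rotate.phi_eq, h.rotate.rotate.phi_eq, ← hρ, ← hρ,
        ← neg_eq_iff_eq_neg.2 (h.quat.skewJ (ρ Z) W),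
        ← neg_eq_iff_eq_neg.2 (h.quat.skewK (ρ Z) W)] at h1
      simp only [sub_apply, smul_apply, add_apply, mul_apply_eq_comp, map_sub, map_smul, map_add,
        smul_eq_mul, map_neg, neg_apply] at h1 ⊢
      rw [h.curv.pair_symm h.symm (I X), h.curv.pair_symm h.symm X Y, h1]; ring
    -- In the trace against J the left side becomes 8n Ric(X, JY)/(2n + 4). On the right tr(KρJ) =
    -- tr(ρI) = 0 and tr(JρJ) = −tr ρ.
    have h2 := congrArg (fun A ↦ trL V (A * J)) hop
    simp only [sub_mul, smul_mul_assoc, add_mul, map_sub, map_smul, map_add, smul_eq_mul,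
      h.trL_eq] at h2
    rw [trL_mul_comm (K * ρ) J, trL_mul_comm (J * ρ) J, ← mul_assoc, ← mul_assoc, h.quat.JK,
      h.quat.JJ, trL_mul_comm I ρ, hρI, h.rotate.phi_eq, h.rotate.phi_eq, h.quat.apply_JI,
      h.curv.ric_neg_right, h.ric_I_left, h.quat.apply_IK, h.curv.ric_neg_right,
      h.quat.skewJ] at h2
    simp only [neg_mul, one_mul, map_neg] at h2
    field_simp at h2 ⊢
    linarith
  have h3 := key X (-(J Y))
  rwa [map_neg, h.quat.apply_JJ, neg_neg] at h3

end IsQuatCurvature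
end QuaternionicAlgebra

/-! ### Quaternion-Kähler metrics on open sets of a vector space are Einstein. -/

section LocalQuaternionKahler

variable {V : Type*} [NormedAddCommGroup V] [NormedSpace ℝ V]
  {N : Type*} [NormedAddCommGroup N] [NormedSpace ℝ N]

/-- The span of `I`, `J` and `I J`. -/
def imQuat (I J : V →L[ℝ] V) : Submodule ℝ (V →L[ℝ] V) := Submodule.span ℝ {I, J, I * J}

theorem mem_imQuat {I J A : V →L[ℝ] V} :
    A ∈ imQuat I J ↔ ∃ a b c : ℝ, a • I + b • J + c • (I * J) = A := Submodule.mem_span_triple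

theorem QuatTriple.eq_comb [FiniteDimensional ℝ V] {g : V →L[ℝ] V →L[ℝ] ℝ} {I J K : V →L[ℝ] V}
    (h : QuatTriple g I J K) (hV : 0 < Module.finrank ℝ V) {A : V →L[ℝ] V} (hA : A ∈ imQuat I J) :
    A = (-trL V (A * I) / Module.finrank ℝ V) • I + (-trL V (A * J) / Module.finrank ℝ V) • J +
      (-trL V (A * K) / Module.finrank ℝ V) • K := by
  obtain ⟨a, b, c, rfl⟩ := mem_imQuat.1 hA
  have hV' : (Module.finrank ℝ V : ℝ) ≠ 0 := by positivity
  rw [h.IJ]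
  have e1 := h.tr_comb a b c
  have e2 := h.rotate.tr_comb b c a
  have e3 := h.rotate.rotate.tr_comb c a b
  rw [show b • J + c • K + a • I = a • I + b • J + c • K by abel] at e2
  rw [show c • K + a • I + b • J = a • I + b • J + c • K by abel] at e3
  rw [e1, e2, e3]
  congr 2 <;> congr 1 <;> field_simp

/-- A quaternion-Kähler structure on an open set `U` of a vector space: the almost complex structures
`J₁`, `J₂`, `J₁ J₂` are skew and span a parallel bundle. -/
structure IsLocalQK (n : ℕ) (G : V → V →L[ℝ] V →L[ℝ] ℝ) (J₁ J₂ : V → V →L[ℝ] V) (U : Set V) :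
    Prop where
  metric : IsMetricOn G U
  smooth₁ : ContDiffOn ℝ ∞ J₁ U
  smooth₂ : ContDiffOn ℝ ∞ J₂ U
  triple : ∀ u ∈ U, QuatTriple (G u) (J₁ u) (J₂ u) (J₁ u * J₂ u)
  parallel₁ : ∀ u ∈ U, ∀ v,
    covEnd G (ContinuousLinearMap.id ℝ V) J₁ u v ∈ imQuat (J₁ u) (J₂ u)
  parallel₂ : ∀ u ∈ U, ∀ v,
    covEnd G (ContinuousLinearMap.id ℝ V) J₂ u v ∈ imQuat (J₁ u) (J₂ u)
  finrank_eq : Module.finrank ℝ V = 4 * n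
  two_le : 2 ≤ n

/-- The normalized scalar curvature `κ / (4 n (n + 2))`. -/
def nscal [FiniteDimensional ℝ V] (n : ℕ) (G : V → V →L[ℝ] V →L[ℝ] ℝ) (u : V) : ℝ :=
  localScalarCurvature G u / (4 * n * (n + 2))

namespace IsLocalQK

variable {n : ℕ} {G : V → V →L[ℝ] V →L[ℝ] ℝ} {J₁ J₂ : V → V →L[ℝ] V} {U : Set V}
  (h : IsLocalQK n G J₁ J₂ U)
include h

theorem mono {U' : Set V} (hU' : IsOpen U') (hsub : U' ⊆ U) : IsLocalQK n G J₁ J₂ U' where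
  metric := ⟨hU', h.metric.smooth.mono hsub, fun x hx ↦ h.metric.symm x (hsub hx),
    fun x hx ↦ h.metric.pos x (hsub hx)⟩
  smooth₁ := h.smooth₁.mono hsub
  smooth₂ := h.smooth₂.mono hsub
  triple u hu := h.triple u (hsub hu)
  parallel₁ u hu := h.parallel₁ u (hsub hu)
  parallel₂ u hu := h.parallel₂ u (hsub hu)
  finrank_eq := h.finrank_eq
  two_le := h.two_le

theorem n_pos : (0 : ℝ) < n := by
  have := h.two_le
  exact_mod_cast (by omega : 0 < n)

theorem finrank_pos : 0 < Module.finrank ℝ V := by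
  have := h.finrank_eq; have := h.two_le; omega

theorem finrank_cast : (Module.finrank ℝ V : ℝ) = 4 * n := by rw [h.finrank_eq]; push_cast; ring

variable {pr : N →L[ℝ] V} {x : N}

theorem contDiffAt₁ {u : V} (hu : u ∈ U) : ContDiffAt ℝ ∞ J₁ u :=
  h.smooth₁.contDiffAt (h.metric.isOpen.mem_nhds hu)

theorem contDiffAt₂ {u : V} (hu : u ∈ U) : ContDiffAt ℝ ∞ J₂ u :=
  h.smooth₂.contDiffAt (h.metric.isOpen.mem_nhds hu)

omit h in
theorem covEnd_comp {A : V → V →L[ℝ] V} (hA : DifferentiableAt ℝ A (pr x)) (c : N) :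
    covEnd G pr (fun y ↦ A (pr y)) x c = covEnd G (ContinuousLinearMap.id ℝ V) A (pr x) (pr c) := by
  rw [covEnd, fderiv_comp_apply' hA pr.differentiableAt, ContinuousLinearMap.fderiv]
  rfl

omit h in
theorem mem₁ (u : V) : J₁ u ∈ imQuat (J₁ u) (J₂ u) := Submodule.subset_span (by simp)
omit h in
theorem mem₂ (u : V) : J₂ u ∈ imQuat (J₁ u) (J₂ u) := Submodule.subset_span (by simp)
omit h in
theorem mem₃ (u : V) : J₁ u * J₂ u ∈ imQuat (J₁ u) (J₂ u) := Submodule.subset_span (by simp)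

variable [FiniteDimensional ℝ V]

theorem trace_eq_zero {u : V} (hu : u ∈ U) {A : V →L[ℝ] V} (hA : A ∈ imQuat (J₁ u) (J₂ u)) :
    trL V A = 0 := by
  obtain ⟨a, b, c, rfl⟩ := mem_imQuat.1 hA
  have ht := h.triple u hu
  simp [ht.trI, ht.trJ, ht.trK]

/-- By the Leibniz rule ∇(J₁J₂) is an imaginary quaternion plus a multiple of the identity. Its
trace is the derivative of tr(J₁J₂) = 0, so that multiple is zero. -/
theorem parallel₃ {u : V} (hu : u ∈ U) (v : V) :
    covEnd G (ContinuousLinearMap.id ℝ V) (fun y ↦ J₁ y * J₂ y) u v ∈ imQuat (J₁ u) (J₂ u) := by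
  have d1 := (h.contDiffAt₁ hu).differentiableAt (by simp)
  have d2 := (h.contDiffAt₂ hu).differentiableAt (by simp)
  have ht := h.triple u hu
  have h0 := fderiv_trL (G := G) (pr := ContinuousLinearMap.id ℝ V) (d1.mul d2) v
  have hz : (fun y ↦ trL V ((J₁ * J₂) y)) =ᶠ[nhds u] fun _ ↦ 0 := by
    filter_upwards [h.metric.isOpen.mem_nhds hu] with y hy using (h.triple y hy).trK
  rw [hz.fderiv_eq, fderiv_const_apply, zero_apply] at h0
  change 0 = trL V (covEnd G (ContinuousLinearMap.id ℝ V) (fun y ↦ J₁ y * J₂ y) u v) at h0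
  rw [covEnd_mul d1 d2] at h0 ⊢
  obtain ⟨a, b, c, e⟩ := mem_imQuat.1 (h.parallel₁ u hu v)
  obtain ⟨a', b', c', e'⟩ := mem_imQuat.1 (h.parallel₂ u hu v)
  have key : covEnd G (ContinuousLinearMap.id ℝ V) J₁ u v * J₂ u +
      J₁ u * covEnd G (ContinuousLinearMap.id ℝ V) J₂ u v = (-c : ℝ) • J₁ u + (-c' : ℝ) • J₂ u +
        (a + b') • (J₁ u * J₂ u) - (b + a') • (1 : V →L[ℝ] V) := by
    rw [← e, ← e']
    simp only [add_mul, mul_add, smul_mul_assoc, mul_smul_comm, ht.JJ, ht.II, ht.KJ, ht.IK]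
    module
  rw [key] at h0 ⊢
  simp only [map_sub, map_add, map_smul, ht.trI, ht.trJ, ht.trK, trL_one, smul_eq_mul] at h0
  have hV : (Module.finrank ℝ V : ℝ) ≠ 0 := by exact_mod_cast h.finrank_pos.ne'
  have : (b + a') * (Module.finrank ℝ V : ℝ) = 0 := by linarith
  rw [(mul_eq_zero.1 this).resolve_right hV, zero_smul, sub_zero]
  exact mem_imQuat.2 ⟨_, _, _, rfl⟩

/-- The covariant derivative of an imaginary section is imaginary. -/
theorem covEnd_mem (hx : pr x ∈ U) {A : N → V →L[ℝ] V} (hA : DifferentiableAt ℝ A x)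
    (hmem : ∀ᶠ y in nhds x, A y ∈ imQuat (J₁ (pr y)) (J₂ (pr y))) (c : N) :
    covEnd G pr A x c ∈ imQuat (J₁ (pr x)) (J₂ (pr x)) := by
  have d1 : DifferentiableAt ℝ (fun y ↦ J₁ (pr y)) x :=
    ((h.contDiffAt₁ hx).differentiableAt (by simp)).comp x pr.differentiableAt
  have d2 : DifferentiableAt ℝ (fun y ↦ J₂ (pr y)) x :=
    ((h.contDiffAt₂ hx).differentiableAt (by simp)).comp x pr.differentiableAt
  have d3 : DifferentiableAt ℝ (fun y ↦ J₁ (pr y) * J₂ (pr y)) x := d1.fun_mul d2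
  have hcoef : ∀ {J : N → V →L[ℝ] V}, DifferentiableAt ℝ J x →
      DifferentiableAt ℝ (fun y ↦ -trL V (A y * J y) / Module.finrank ℝ V) x := fun hJ ↦ by
    simp only [div_eq_mul_inv]
    exact (((trL V).differentiableAt.comp x (hA.fun_mul hJ)).fun_neg).mul_const _
  -- The coefficients in the frame are traces, hence differentiable, and the Leibniz rule reduces
  -- the claim to the frame.
  have he : A =ᶠ[nhds x] fun y ↦
      (-trL V (A y * J₁ (pr y)) / Module.finrank ℝ V) • J₁ (pr y) +
      (-trL V (A y * J₂ (pr y)) / Module.finrank ℝ V) • J₂ (pr y) +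
      (-trL V (A y * (J₁ (pr y) * J₂ (pr y))) / Module.finrank ℝ V) • (J₁ (pr y) * J₂ (pr y)) := by
    filter_upwards [hmem, pr.continuous.continuousAt.preimage_mem_nhds
      (h.metric.isOpen.mem_nhds hx)] with y hy hyU
    exact (h.triple _ hyU).eq_comb h.finrank_pos hy
  rw [covEnd_congr he, covEnd_add (((hcoef d1).fun_smul d1).fun_add ((hcoef d2).fun_smul d2))
    ((hcoef d3).fun_smul d3), covEnd_add ((hcoef d1).fun_smul d1) ((hcoef d2).fun_smul d2),
    covEnd_smul (hcoef d1) d1, covEnd_smul (hcoef d2) d2, covEnd_smul (hcoef d3) d3,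
    covEnd_comp ((h.contDiffAt₁ hx).differentiableAt (by simp)),
    covEnd_comp ((h.contDiffAt₂ hx).differentiableAt (by simp)),
    covEnd_comp (A := fun y ↦ J₁ y * J₂ y) (((h.contDiffAt₁ hx).differentiableAt (by simp)).fun_mul
      ((h.contDiffAt₂ hx).differentiableAt (by simp)))]
  refine add_mem (add_mem (add_mem ?_ ?_) (add_mem ?_ ?_)) (add_mem ?_ ?_) <;>
    apply Submodule.smul_mem
  exacts [mem₁ _, h.parallel₁ _ hx _, mem₂ _, h.parallel₂ _ hx _, mem₃ _, h.parallel₃ hx _]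

theorem contDiffAt_localCurvature {u : V} (hu : u ∈ U) (v w : V) :
    ContDiffAt ℝ ∞ (fun p ↦ localCurvature G p v w) u := by
  have h1 := fun v ↦ h.metric.contDiffAt_christoffel hu v
  have h2 : ∀ v w, ContDiffAt ℝ ∞ (fun p ↦ fderiv ℝ (fun x ↦ christoffel G x w) p v) u :=
    fun v w ↦ contDiffAt_apply_apply ((h1 w).fderiv_right (by simp)) v
  exact (((h2 v w).sub (h2 w v)).add ((h1 v).mul (h1 w))).sub ((h1 w).mul (h1 v))

theorem isAlgCurvature {u : V} (hu : u ∈ U) : IsAlgCurvature (G u) (localCurvature G u) where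
  add_left v v' w := by ext z; exact h.metric.localCurvature_add_left hu v v' w z
  smul_left c v w := by ext z; exact h.metric.localCurvature_smul_left hu c v w z
  antisymm v w := IsMetricOn.localCurvature_antisymm v w
  bianchi := h.metric.bianchi_first hu
  skew := h.metric.localCurvature_skew hu

/-- By the Ricci identity the commutator is the antisymmetrized second covariant derivative of the
section `A`, and covariant derivatives of imaginary sections are imaginary. -/
theorem comm_mem {u : V} (hu : u ∈ U) {A : V → V →L[ℝ] V} (hA : ContDiffAt ℝ ∞ A u)
    (hmem : ∀ y ∈ U, A y ∈ imQuat (J₁ y) (J₂ y)) (v w : V) :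
    localCurvature G u v w * A u - A u * localCurvature G u v w ∈ imQuat (J₁ u) (J₂ u) := by
  have h1 := covEnd_comm (pr := ContinuousLinearMap.id ℝ V) h.metric hu hA v w
  have hn := h.metric.isOpen.mem_nhds hu
  -- First-order regularity is enough here, and regularity of finite order at a point holds in a
  -- neighbourhood of it.
  have h2 : ∀ᶠ y in nhds u, ContDiffAt ℝ 1 A y :=
    (hA.of_le (m := 1) (by exact_mod_cast le_top)).eventually (by simp)
  have key : ∀ v w, covEnd G (ContinuousLinearMap.id ℝ V)
      (fun y ↦ covEnd G (ContinuousLinearMap.id ℝ V) A y w) u v ∈ imQuat (J₁ u) (J₂ u) := by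
    intro v w
    refine h.covEnd_mem (pr := ContinuousLinearMap.id ℝ V) hu
      ((contDiffAt_covEnd (pr := ContinuousLinearMap.id ℝ V) h.metric hu hA w).differentiableAt
        (by simp)) ?_ v
    filter_upwards [hn, h2] with y hy hy2
    exact h.covEnd_mem (pr := ContinuousLinearMap.id ℝ V) hy (hy2.differentiableAt (by simp))
      (Filter.eventually_of_mem (h.metric.isOpen.mem_nhds hy) hmem) w
  exact h1 ▸ sub_mem (key v w) (key w v)

theorem isQuatCurvature {u : V} (hu : u ∈ U) :
    IsQuatCurvature n (G u) (localCurvature G u) (J₁ u) (J₂ u) (J₁ u * J₂ u) where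
  curv := h.isAlgCurvature hu
  quat := h.triple u hu
  pos := h.metric.pos u hu
  symm := h.metric.symm u hu
  finrank_eq := h.finrank_eq
  two_le := h.two_le
  commI v w := by
    obtain ⟨a, b, c, e⟩ := mem_imQuat.1 (h.comm_mem hu (h.contDiffAt₁ hu) (fun y _ ↦ mem₁ y) v w)
    exact ⟨a, b, c, e.symm⟩
  commJ v w := by
    obtain ⟨a, b, c, e⟩ := mem_imQuat.1 (h.comm_mem hu (h.contDiffAt₂ hu) (fun y _ ↦ mem₂ y) v w)
    exact ⟨a, b, c, e.symm⟩
  commK v w := by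
    obtain ⟨a, b, c, e⟩ := mem_imQuat.1 (h.comm_mem hu
      ((h.contDiffAt₁ hu).mul (h.contDiffAt₂ hu)) (fun y _ ↦ mem₃ y) v w)
    exact ⟨a, b, c, e.symm⟩

/-- Quaternion-Kähler metrics are Einstein. -/
theorem localRicci_eq {u : V} (hu : u ∈ U) (v w : V) :
    localRicci G u v w = (n + 2) * nscal n G u * G u v w := by
  have hq := h.isQuatCurvature hu
  have hn := h.n_pos
  have e : ∀ v w, localRicci G u v w = hq.curv.ric v w := fun v w ↦
    h.metric.localRicci_eq_trace hu v w
  obtain ⟨ρ, hρ⟩ := hq.exists_ricEnd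
  rw [e, hq.ric_eq hρ, nscal, h.metric.localScalarCurvature_eq_trace hu (ρ : V →ₗ[ℝ] V)
    (fun v w ↦ (hρ v w).trans (e v w).symm), ← trL_apply]
  field_simp

/-- With the Einstein equation Ric = (n + 2)c g, `phi_eq` becomes φ_A(v, w) = (c/2) g(v, Aw), and
the trace is −4n times this. -/
theorem trL_curvature {u : V} (hu : u ∈ U) {A : V →L[ℝ] V} (hA : A ∈ imQuat (J₁ u) (J₂ u))
    (v w : V) : trL V (localCurvature G u v w * A) = -(2 * n) * nscal n G u * G u v (A w) := by
  have hq := h.isQuatCurvature hu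
  have hn := h.n_pos
  have e : ∀ v w, hq.curv.ric v w = (n + 2) * nscal n G u * G u v w := fun v w ↦
    (h.metric.localRicci_eq_trace hu v w).symm.trans (h.localRicci_eq hu v w)
  have e' : ∀ v w, hq.curv.ric v w / (2 * n + 4) = nscal n G u / 2 * G u v w := fun v w ↦ by
    rw [e]; field_simp; ring
  obtain ⟨a, b, c, rfl⟩ := mem_imQuat.1 hA
  simp only [mul_add, mul_smul_comm, map_add, map_smul, smul_eq_mul, hq.trL_eq, hq.phi_eq,
    hq.rotate.phi_eq, hq.rotate.rotate.phi_eq, add_apply, smul_apply]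
  simp only [e']
  ring

end IsLocalQK
end LocalQuaternionKahler

/-! ### The scalar curvature is locally constant. -/

section ScalarConstant

variable {V : Type*} [NormedAddCommGroup V] [NormedSpace ℝ V] [FiniteDimensional ℝ V]

namespace IsLocalQK

variable {n : ℕ} {G : V → V →L[ℝ] V →L[ℝ] ℝ} {J₁ J₂ : V → V →L[ℝ] V} {U : Set V} {u : V}
  (h : IsLocalQK n G J₁ J₂ U)
include h

/-- `trL_curvature` is solved for c. With the fixed vectors y ≠ 0 and z = −J₁y, where J₁ is taken at
u, the denominator is a nonzero multiple of G(y, y) at u, so c is a quotient of smooth functions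
near u. -/
theorem contDiffAt_nscal (hu : u ∈ U) : ContDiffAt ℝ ∞ (nscal n G) u := by
  have ht := h.triple u hu
  have hn := h.n_pos
  have : Nontrivial V := Module.finrank_pos_iff.1 h.finrank_pos
  obtain ⟨y, hy⟩ := exists_ne (0 : V)
  have hJ := h.contDiffAt₁ hu
  set z := -J₁ u y with hz
  have hd : ContDiffAt ℝ ∞ (fun p ↦ G p y (J₁ p z)) u :=
    ((h.metric.contDiffAt hu).clm_apply contDiffAt_const).clm_apply (hJ.clm_apply contDiffAt_const)
  have h0 : G u y (J₁ u z) ≠ 0 := by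
    rw [hz, map_neg, ht.apply_II, neg_neg]
    exact (h.metric.pos u hu y hy).ne'
  have hR : ContDiffAt ℝ ∞ (fun p ↦ trL V (localCurvature G p y z * J₁ p)) u :=
    (trL V).contDiff.contDiffAt.comp u ((h.contDiffAt_localCurvature hu y z).mul hJ)
  have hf : ContDiffAt ℝ ∞ (fun p ↦ trL V (localCurvature G p y z * J₁ p) *
      (-(2 * n) * G p y (J₁ p z))⁻¹) u :=
    hR.mul ((contDiffAt_const.mul hd).inv (mul_ne_zero (by simpa using hn.ne') h0))
  refine hf.congr_of_eventuallyEq ?_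
  filter_upwards [h.metric.isOpen.mem_nhds hu, hd.continuousAt.eventually_ne h0] with p hp hp0
  rw [h.trL_curvature hp (mem₁ p)]
  field_simp

/-- The derivative of tr(R_{y,z}J₁) = −2nc g(y, J₁z) for constant y and z. The terms with ∇J₁ agree
on both sides, again by `trL_curvature`, because ∇J₁ is imaginary. -/
theorem tr_covEnd_curvature (hu : u ∈ U) (x y z : V) :
    trL V (covEnd G (ContinuousLinearMap.id ℝ V) (fun p ↦ localCurvature G p y z) u x * J₁ u) =
      -(2 * n) * (fderiv ℝ (nscal n G) u x * G u y (J₁ u z) +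
        nscal n G u * (G u (christoffel G u x y) (J₁ u z) + G u y (J₁ u (christoffel G u x z)))) := by
  have hR := (h.contDiffAt_localCurvature hu y z).differentiableAt (by simp)
  have hJ := (h.contDiffAt₁ hu).differentiableAt (by simp)
  have hc := (h.contDiffAt_nscal hu).differentiableAt (by simp)
  have hJz : DifferentiableAt ℝ (fun p ↦ J₁ p z) u := hJ.clm_apply (differentiableAt_const z)
  have hG : DifferentiableAt ℝ (fun p ↦ G p y (J₁ p z)) u :=
    ((h.metric.differentiableAt hu).clm_apply (differentiableAt_const y)).clm_apply hJz
  have e : (fun p ↦ trL V (localCurvature G p y z * J₁ p)) =ᶠ[nhds u]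
      fun p ↦ -(2 * n) * (nscal n G p * G p y (J₁ p z)) := by
    filter_upwards [h.metric.isOpen.mem_nhds hu] with p hp
    rw [h.trL_curvature hp (mem₁ p)]; ring
  have e1 := fderiv_trL (G := G) (pr := ContinuousLinearMap.id ℝ V) (hR.fun_mul hJ) x
  rw [e.fderiv_eq, covEnd_mul hR hJ, map_add,
    h.trL_curvature hu (h.covEnd_mem (pr := ContinuousLinearMap.id ℝ V) hu hJ
      (Filter.Eventually.of_forall fun p ↦ mem₁ p) x),
    fderiv_const_mul (hc.fun_mul hG), fderiv_fun_mul hc hG] at e1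
  have e2 := fderiv_inner_pull (pr := ContinuousLinearMap.id ℝ V) h.metric hu
    (differentiableAt_const y) hJz x
  rw [covVec_app hJ (differentiableAt_const z), covVec_const, covVec_const] at e2
  simp only [ContinuousLinearMap.id_apply] at e2
  simp only [smul_apply, add_apply, smul_eq_mul, e2, map_add] at e1
  linear_combination -e1

/-- The trace of the differential Bianchi identity against J₁. The Christoffel terms cancel by
symmetry, and what remains is dc ∧ ω = 0 for the form ω = g(·, J₁·). -/
theorem fderiv_nscal_cyclic (hu : u ∈ U) (x y z : V) :
    fderiv ℝ (nscal n G) u x * G u y (J₁ u z) + fderiv ℝ (nscal n G) u y * G u z (J₁ u x) +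
      fderiv ℝ (nscal n G) u z * G u x (J₁ u y) = 0 := by
  have hn := h.n_pos
  have hsk : ∀ v w, G u v (J₁ u w) = -G u w (J₁ u v) := fun v w ↦ by
    rw [← neg_eq_iff_eq_neg.2 ((h.triple u hu).skewI w v), h.metric.symm u hu v]
    simp
  have h1 := h.tr_covEnd_curvature hu x y z
  have h2 := h.tr_covEnd_curvature hu y z x
  have h3 := h.tr_covEnd_curvature hu z x y
  have hb := congrArg (fun A ↦ trL V (A * J₁ u)) (h.metric.bianchi_second hu x y z)
  simp only [add_mul _ _ (J₁ u), map_add, zero_mul, map_zero] at hb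
  simp only [covEnd, ContinuousLinearMap.id_apply] at h1 h2 h3
  have key : ∀ v w t, G u v (J₁ u (christoffel G u w t)) = -G u (christoffel G u w t) (J₁ u v) :=
    fun v w t ↦ hsk _ _
  simp only [key, h.metric.christoffel_symm hu y x, h.metric.christoffel_symm hu z x,
    h.metric.christoffel_symm hu z y] at h1 h2 h3
  have : (2 * n : ℝ) * (fderiv ℝ (nscal n G) u x * G u y (J₁ u z) +
      fderiv ℝ (nscal n G) u y * G u z (J₁ u x) + fderiv ℝ (nscal n G) u z * G u x (J₁ u y)) = 0 := by
    simp only [sub_mul, map_sub, add_mul, map_add] at hb h1 h2 h3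
    linear_combination -hb + h1 + h2 + h3
  exact (mul_eq_zero.1 this).resolve_left (by positivity)

theorem fderiv_nscal (hu : u ∈ U) : fderiv ℝ (nscal n G) u = 0 := by
  set D := fderiv ℝ (nscal n G) u
  have ht := h.triple u hu
  let f : V →ₗ[ℝ] ℝ × ℝ := (D : V →ₗ[ℝ] ℝ).prod ((D : V →ₗ[ℝ] ℝ) ∘ₗ (J₁ u : V →ₗ[ℝ] V))
  -- As dim V = 4n > 2, some y ≠ 0 is killed by both D and D∘J₁. The cyclic identity at (x, y, J₁y)
  -- then reduces to D(x) g(y, y) = 0.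
  have hk : LinearMap.ker f ≠ ⊥ := LinearMap.ker_ne_bot_of_finrank_lt (by
    have := h.finrank_eq; have := h.two_le
    simp only [Module.finrank_prod, Module.finrank_self]; omega)
  obtain ⟨y, hy, hy0⟩ := Submodule.exists_mem_ne_zero_of_ne_bot hk
  have h1 : D y = 0 := congrArg Prod.fst (LinearMap.mem_ker.1 hy)
  have h2 : D (J₁ u y) = 0 := congrArg Prod.snd (LinearMap.mem_ker.1 hy)
  ext x
  have h3 := h.fderiv_nscal_cyclic hu x y (J₁ u y)
  rw [h1, h2, ht.apply_II, map_neg] at h3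
  have h4 := (h.metric.pos u hu y hy0).ne'
  have h5 : D x * G u y y = 0 := by linarith
  simpa using (mul_eq_zero.1 h5).resolve_right h4

/-- The scalar curvature of a quaternion-Kähler metric is locally constant. -/
theorem eventually_nscal_eq (hu : u ∈ U) : ∀ᶠ p in nhds u, nscal n G p = nscal n G u := by
  obtain ⟨r, hr, hb⟩ := Metric.isOpen_iff.1 h.metric.isOpen u hu
  filter_upwards [Metric.ball_mem_nhds u hr] with p hp
  exact (convex_ball u r).is_const_of_fderivWithin_eq_zero (𝕜 := ℝ)
    (fun x hx ↦ ((h.contDiffAt_nscal (hb hx)).differentiableAt (by simp)).differentiableWithinAt)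
    (fun x hx ↦ by
      rw [fderivWithin_of_isOpen Metric.isOpen_ball hx]; exact h.fderiv_nscal (hb hx))
    hp (Metric.mem_ball_self hr)

end IsLocalQK
end ScalarConstant

/-! ### The scalar product on Q, the moment form Φ and the curvature of Q. -/

section ScalarProduct

variable {V : Type*} [NormedAddCommGroup V] [NormedSpace ℝ V] [FiniteDimensional ℝ V]

variable (V) in
/-- The normalized trace form `- tr (A B) / dim V`. -/
def gam (A B : V →L[ℝ] V) : ℝ := -trL V (A * B) / Module.finrank ℝ V

theorem gam_add_left (A A' B : V →L[ℝ] V) : gam V (A + A') B = gam V A B + gam V A' B := by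
  simp only [gam, add_mul, map_add]; ring
theorem gam_add_right (A B B' : V →L[ℝ] V) : gam V A (B + B') = gam V A B + gam V A B' := by
  simp only [gam, mul_add, map_add]; ring
theorem gam_sub_left (A A' B : V →L[ℝ] V) : gam V (A - A') B = gam V A B - gam V A' B := by
  simp only [gam, sub_mul, map_sub]; ring
theorem gam_sub_right (A B B' : V →L[ℝ] V) : gam V A (B - B') = gam V A B - gam V A B' := by
  simp only [gam, mul_sub, map_sub]; ring
theorem gam_smul_left (c : ℝ) (A B : V →L[ℝ] V) : gam V (c • A) B = c * gam V A B := by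
  simp only [gam, smul_mul_assoc, map_smul, smul_eq_mul]; ring
theorem gam_smul_right (c : ℝ) (A B : V →L[ℝ] V) : gam V A (c • B) = c * gam V A B := by
  simp only [gam, mul_smul_comm, map_smul, smul_eq_mul]; ring
theorem gam_comm (A B : V →L[ℝ] V) : gam V A B = gam V B A := by
  simp only [gam, trL_mul_comm A]
theorem gam_neg_left (A B : V →L[ℝ] V) : gam V (-A) B = -gam V A B := by
  simp only [gam, neg_mul, map_neg]; ring
theorem gam_neg_right (A B : V →L[ℝ] V) : gam V A (-B) = -gam V A B := by
  simp only [gam, mul_neg, map_neg]; ring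
-- The invariance of the trace form under brackets, from the cyclicity of the trace.
theorem gam_bracket (A B C : V →L[ℝ] V) : gam V (A * B - B * A) C = gam V A (B * C - C * B) := by
  simp only [gam, sub_mul, mul_sub, map_sub]
  rw [trL_mul_comm (B * A) C, mul_assoc A B C, ← mul_assoc C, trL_mul_comm (C * B) A]

/-- The element of the span of `I, J, I J` dual to `A ↦ g (v, A w)`. -/
def quatMoment (g : V →L[ℝ] V →L[ℝ] ℝ) (I J : V →L[ℝ] V) (v w : V) : V →L[ℝ] V :=
  g v (I w) • I + g v (J w) • J + g v (I (J w)) • (I * J)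

namespace QuatTriple

variable {g : V →L[ℝ] V →L[ℝ] ℝ} {I J K : V →L[ℝ] V} (h : QuatTriple g I J K) {A B : V →L[ℝ] V}
include h

theorem gam_comb (hV : 0 < Module.finrank ℝ V) (a b c a' b' c' : ℝ) :
    gam V (a • I + b • J + c • K) (a' • I + b' • J + c' • K) = a * a' + b * b' + c * c' := by
  have e1 := h.tr_comb a b c
  have e2 := h.rotate.tr_comb b c a
  have e3 := h.rotate.rotate.tr_comb c a b
  rw [show b • J + c • K + a • I = a • I + b • J + c • K by abel] at e2
  rw [show c • K + a • I + b • J = a • I + b • J + c • K by abel] at e3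
  rw [gam, mul_add, mul_add, mul_smul_comm, mul_smul_comm, mul_smul_comm, map_add, map_add,
    map_smul, map_smul, map_smul, e1, e2, e3]
  have hV' : (Module.finrank ℝ V : ℝ) ≠ 0 := by positivity
  simp only [smul_eq_mul]
  field_simp
  ring

theorem mem_iff : A ∈ imQuat I J ↔ ∃ a b c : ℝ, a • I + b • J + c • K = A := by
  rw [← h.IJ]; exact mem_imQuat

theorem skew (hA : A ∈ imQuat I J) (v w : V) : g (A v) w = -g v (A w) := by
  obtain ⟨a, b, c, rfl⟩ := h.mem_iff.1 hA
  simp only [add_apply, smul_apply, map_add, map_smul, h.skewI, h.skewJ, h.skewK, smul_eq_mul]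
  ring

/-- The Clifford relation of the imaginary quaternions; it translates orthogonality into
anticommutation. -/
theorem mul_add_mul (hV : 0 < Module.finrank ℝ V) (hA : A ∈ imQuat I J) (hB : B ∈ imQuat I J) :
    A * B + B * A = (-2 * gam V A B) • (1 : V →L[ℝ] V) := by
  obtain ⟨a, b, c, rfl⟩ := h.mem_iff.1 hA
  obtain ⟨a', b', c', rfl⟩ := h.mem_iff.1 hB
  rw [h.gam_comb hV]
  simp only [add_mul, mul_add, smul_mul_assoc, mul_smul_comm, h.II, h.JJ, h.KK, h.IJ, h.JI, h.JK,
    h.KJ, h.KI, h.IK]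
  module

theorem bracket_mem (hA : A ∈ imQuat I J) (hB : B ∈ imQuat I J) : A * B - B * A ∈ imQuat I J := by
  obtain ⟨a, b, c, rfl⟩ := h.mem_iff.1 hA
  obtain ⟨a', b', c', rfl⟩ := h.mem_iff.1 hB
  refine h.mem_iff.2 ⟨2 * (b * c' - c * b'), 2 * (c * a' - a * c'), 2 * (a * b' - b * a'), ?_⟩
  simp only [add_mul, mul_add, smul_mul_assoc, mul_smul_comm, h.II, h.JJ, h.KK, h.IJ, h.JI, h.JK,
    h.KJ, h.KI, h.IK]
  module

theorem eq_zero_of_gam (hV : 0 < Module.finrank ℝ V) (hA : A ∈ imQuat I J)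
    (h0 : ∀ B ∈ imQuat I J, gam V A B = 0) : A = 0 := by
  have h1 := h0 A hA
  obtain ⟨a, b, c, rfl⟩ := h.mem_iff.1 hA
  rw [h.gam_comb hV] at h1
  have ha : a = 0 := by nlinarith [sq_nonneg a, sq_nonneg b, sq_nonneg c]
  have hb : b = 0 := by nlinarith [sq_nonneg a, sq_nonneg b, sq_nonneg c]
  have hc : c = 0 := by nlinarith [sq_nonneg a, sq_nonneg b, sq_nonneg c]
  simp [ha, hb, hc]

omit [FiniteDimensional ℝ V] h in
theorem quatMoment_mem (g : V →L[ℝ] V →L[ℝ] ℝ) (I J : V →L[ℝ] V) (v w : V) :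
    quatMoment g I J v w ∈ imQuat I J :=
  mem_imQuat.2 ⟨_, _, _, rfl⟩

/-- The property that determines the moment form, which therefore does not depend on the frame I, J,
IJ used to write it. -/
theorem gam_quatMoment (hV : 0 < Module.finrank ℝ V) (hA : A ∈ imQuat I J) (v w : V) :
    gam V (quatMoment g I J v w) A = g v (A w) := by
  obtain ⟨a, b, c, rfl⟩ := h.mem_iff.1 hA
  rw [quatMoment, h.IJ, h.gam_comb hV]
  simp only [add_apply, smul_apply, map_add, map_smul, h.apply_IJ, smul_eq_mul]
  ring

theorem quatMoment_antisymm (hs : ∀ v w, g v w = g w v) (v w : V) :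
    quatMoment g I J v w = -quatMoment g I J w v := by
  have e : ∀ A ∈ imQuat I J, g v (A w) = -g w (A v) := fun A hA ↦ by
    rw [hs, h.skew hA]
  rw [quatMoment, quatMoment, ← mul_apply_eq_comp, e _ (mem_imQuat.2 ⟨1, 0, 0, by simp⟩),
    e _ (mem_imQuat.2 ⟨0, 1, 0, by simp⟩), e _ (mem_imQuat.2 ⟨0, 0, 1, by simp⟩)]
  simp only [mul_apply_eq_comp]
  module

end QuatTriple

omit [FiniteDimensional ℝ V] in
theorem quatMoment_add_right (g : V →L[ℝ] V →L[ℝ] ℝ) (I J : V →L[ℝ] V) (v w w' : V) :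
    quatMoment g I J v (w + w') = quatMoment g I J v w + quatMoment g I J v w' := by
  simp only [quatMoment, map_add]; module

omit [FiniteDimensional ℝ V] in
theorem quatMoment_smul_right (g : V →L[ℝ] V →L[ℝ] ℝ) (I J : V →L[ℝ] V) (c : ℝ) (v w : V) :
    quatMoment g I J v (c • w) = c • quatMoment g I J v w := by
  simp only [quatMoment, map_smul, smul_eq_mul]; module

namespace IsLocalQK

variable {N : Type*} [NormedAddCommGroup N] [NormedSpace ℝ N]
  {n : ℕ} {G : V → V →L[ℝ] V →L[ℝ] ℝ} {J₁ J₂ : V → V →L[ℝ] V} {U : Set V} {u : V}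
  (h : IsLocalQK n G J₁ J₂ U)
include h

/-- The curvature of the bundle Q. In `comm_eq` and its rotations the components φ_A are (c/2) g(·,
A·), that is, the coordinates of (c/2)Φ. It is through this formula that the curvature of M enters
the vertical geometry of the twistor space. -/
theorem bracket_curvature (hu : u ∈ U) {A : V →L[ℝ] V} (hA : A ∈ imQuat (J₁ u) (J₂ u)) (v w : V) :
    localCurvature G u v w * A - A * localCurvature G u v w =
      (nscal n G u / 2) • (quatMoment (G u) (J₁ u) (J₂ u) v w * A -
        A * quatMoment (G u) (J₁ u) (J₂ u) v w) := by
  have hq := h.isQuatCurvature hu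
  have ht := h.triple u hu
  have hn := h.n_pos
  have hphi : ∀ A ∈ imQuat (J₁ u) (J₂ u), IsQuatCurvature.phi n (localCurvature G u) A v w =
      nscal n G u / 2 * G u v (A w) := fun A hA ↦ by
    rw [IsQuatCurvature.phi, h.trL_curvature hu hA]; field_simp; ring
  obtain ⟨a, b, c, rfl⟩ := mem_imQuat.1 hA
  have e1 := hq.comm_eq v w
  have e2 := hq.rotate.comm_eq v w
  have e3 := hq.rotate.rotate.comm_eq v w
  simp only [hphi _ (mem₁ _), hphi _ (mem₂ _), hphi _ (mem₃ _)] at e1 e2 e3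
  have e : ∀ R A B C : V →L[ℝ] V, R * (a • A + b • B + c • C) - (a • A + b • B + c • C) * R =
      a • (R * A - A * R) + b • (R * B - B * R) + c • (R * C - C * R) := fun R A B C ↦ by
    simp only [mul_add, add_mul, smul_mul_assoc, mul_smul_comm]; module
  rw [e, e, e1, e2, e3, quatMoment, ← mul_apply_eq_comp]
  set K := J₁ u * J₂ u
  simp only [add_mul, mul_add, smul_mul_assoc, mul_smul_comm, ht.II, ht.JJ, ht.KK, ht.IJ, ht.JI,
    ht.JK, ht.KJ, ht.KI, ht.IK]
  module

variable {pr : N →L[ℝ] V} {x : N}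

omit h in
theorem fderiv_gam {A B : N → V →L[ℝ] V} (hA : DifferentiableAt ℝ A x)
    (hB : DifferentiableAt ℝ B x) (c : N) :
    fderiv ℝ (fun y ↦ gam V (A y) (B y)) x c =
      gam V (covEnd G pr A x c) (B x) + gam V (A x) (covEnd G pr B x c) := by
  have e : (fun y ↦ gam V (A y) (B y)) = fun y ↦
      (-(Module.finrank ℝ V : ℝ)⁻¹) * trL V (A y * B y) := by
    funext y; rw [gam]; ring
  rw [e, fderiv_const_mul (differentiableAt_comp' (trL V).differentiableAt (hA.fun_mul hB)), smul_apply,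
    fderiv_trL (G := G) (pr := pr) (hA.fun_mul hB), covEnd_mul hA hB, map_add, gam, gam, smul_eq_mul]
  ring

theorem differentiableAt_quatMoment (hx : pr x ∈ U) {f f' : N → V} (hf : DifferentiableAt ℝ f x)
    (hf' : DifferentiableAt ℝ f' x) : DifferentiableAt ℝ
      (fun y ↦ quatMoment (G (pr y)) (J₁ (pr y)) (J₂ (pr y)) (f y) (f' y)) x := by
  have d1 : DifferentiableAt ℝ (fun y ↦ J₁ (pr y)) x :=
    ((h.contDiffAt₁ hx).differentiableAt (by simp)).comp x pr.differentiableAt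
  have d2 : DifferentiableAt ℝ (fun y ↦ J₂ (pr y)) x :=
    ((h.contDiffAt₂ hx).differentiableAt (by simp)).comp x pr.differentiableAt
  have d3 : DifferentiableAt ℝ (fun y ↦ J₁ (pr y) * J₂ (pr y)) x := d1.fun_mul d2
  have hG : DifferentiableAt ℝ (fun y ↦ G (pr y)) x :=
    differentiableAt_comp' (F' := V →L[ℝ] V →L[ℝ] ℝ) (h.metric.differentiableAt hx)
      pr.differentiableAt
  have hs : ∀ {A : N → V →L[ℝ] V}, DifferentiableAt ℝ A x →
      DifferentiableAt ℝ (fun y ↦ G (pr y) (f y) (A y (f' y))) x := fun hA ↦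
    (hG.clm_apply hf).clm_apply (hA.clm_apply hf')
  exact (((hs d1).fun_smul d1).fun_add ((hs d2).fun_smul d2)).fun_add ((hs d3).fun_smul d3)

/-- The quaternionic moment form is parallel. -/
theorem covEnd_quatMoment (hx : pr x ∈ U) {f f' : N → V} (hf : DifferentiableAt ℝ f x)
    (hf' : DifferentiableAt ℝ f' x) (c : N) :
    covEnd G pr (fun y ↦ quatMoment (G (pr y)) (J₁ (pr y)) (J₂ (pr y)) (f y) (f' y)) x c =
      quatMoment (G (pr x)) (J₁ (pr x)) (J₂ (pr x)) (covVec G pr f x c) (f' x) +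
      quatMoment (G (pr x)) (J₁ (pr x)) (J₂ (pr x)) (f x) (covVec G pr f' x c) := by
  have ht := h.triple _ hx
  have hV := h.finrank_pos
  have d1 : DifferentiableAt ℝ (fun y ↦ J₁ (pr y)) x :=
    ((h.contDiffAt₁ hx).differentiableAt (by simp)).comp x pr.differentiableAt
  have d2 : DifferentiableAt ℝ (fun y ↦ J₂ (pr y)) x :=
    ((h.contDiffAt₂ hx).differentiableAt (by simp)).comp x pr.differentiableAt
  have d3 : DifferentiableAt ℝ (fun y ↦ J₁ (pr y) * J₂ (pr y)) x := d1.fun_mul d2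
  have hΦ := h.differentiableAt_quatMoment hx hf hf'
  have hm : ∀ v w, quatMoment (G (pr x)) (J₁ (pr x)) (J₂ (pr x)) v w ∈
      imQuat (J₁ (pr x)) (J₂ (pr x)) := fun v w ↦ QuatTriple.quatMoment_mem _ _ _ v w
  have hcov := h.covEnd_mem hx hΦ
    (Filter.Eventually.of_forall fun y ↦ QuatTriple.quatMoment_mem _ _ _ _ _) c
  rw [← sub_eq_zero]
  -- The equation γ(Φ(f, f'), A) = g(f, Af') is differentiated for an imaginary section `A`. The
  -- terms with ∇A agree because ∇A is imaginary too.
  have key : ∀ A : N → V →L[ℝ] V, DifferentiableAt ℝ A x →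
      (∀ y, A y ∈ imQuat (J₁ (pr y)) (J₂ (pr y))) →
      gam V (covEnd G pr (fun y ↦ quatMoment (G (pr y)) (J₁ (pr y)) (J₂ (pr y)) (f y) (f' y)) x c -
        (quatMoment (G (pr x)) (J₁ (pr x)) (J₂ (pr x)) (covVec G pr f x c) (f' x) +
        quatMoment (G (pr x)) (J₁ (pr x)) (J₂ (pr x)) (f x) (covVec G pr f' x c))) (A x) = 0 := by
    intro A hA hmem
    have e1 := fderiv_gam (G := G) (pr := pr) hΦ hA c
    have e : (fun y ↦ gam V (quatMoment (G (pr y)) (J₁ (pr y)) (J₂ (pr y)) (f y) (f' y)) (A y))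
        =ᶠ[nhds x] fun y ↦ G (pr y) (f y) (A y (f' y)) := by
      filter_upwards [pr.continuous.continuousAt.preimage_mem_nhds
        (h.metric.isOpen.mem_nhds hx)] with y hy
      exact (h.triple _ hy).gam_quatMoment hV (hmem y) _ _
    rw [e.fderiv_eq, fderiv_inner_pull h.metric hx hf (hA.clm_apply hf'), covVec_app hA hf',
      ht.gam_quatMoment hV (h.covEnd_mem hx hA (Filter.Eventually.of_forall hmem) c)] at e1
    rw [gam_sub_left, gam_add_left, ht.gam_quatMoment hV (hmem x), ht.gam_quatMoment hV (hmem x)]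
    simp only [map_add] at e1
    linear_combination -e1
  -- The difference is imaginary, so it is enough to test it against imaginary B; each B extends to
  -- a section with constant coefficients in the frame.
  refine ht.eq_zero_of_gam hV (sub_mem hcov (add_mem (hm _ _) (hm _ _))) fun B hB ↦ ?_
  obtain ⟨a, b, c', rfl⟩ := mem_imQuat.1 hB
  exact key (fun y ↦ a • J₁ (pr y) + b • J₂ (pr y) + c' • (J₁ (pr y) * J₂ (pr y)))
    (((d1.fun_const_smul a).fun_add (d2.fun_const_smul b)).fun_add (d3.fun_const_smul c'))
    (fun y ↦ mem_imQuat.2 ⟨a, b, c', rfl⟩)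

end IsLocalQK
end ScalarProduct

/-! ### The Levi-Civita connection of the twistor metric. -/

section LocalTwistor

variable {V : Type*} [NormedAddCommGroup V] [NormedSpace ℝ V] [FiniteDimensional ℝ V]
  {N : Type*} [NormedAddCommGroup N] [NormedSpace ℝ N] [FiniteDimensional ℝ N]

/-- The twistor space of a quaternion-Kähler metric of normalized scalar curvature `c` on an open set
`U`, in a chart whose domain is the open set `W`: `pr` is the projection, `I` the tautological almost
complex structure, and `H` the metric of the twistor space. -/
structure IsLocalTwistor (n : ℕ) (c : ℝ) (G : V → V →L[ℝ] V →L[ℝ] ℝ) (J₁ J₂ : V → V →L[ℝ] V)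
    (U : Set V) (pr : N →L[ℝ] V) (I : N → V →L[ℝ] V) (H : N → N →L[ℝ] N →L[ℝ] ℝ) (W : Set N) :
    Prop where
  base : IsLocalQK n G J₁ J₂ U
  pos : 0 < c
  nscal_eq : ∀ u ∈ U, nscal n G u = c
  isOpen : IsOpen W
  maps : ∀ x ∈ W, pr x ∈ U
  smooth : ContDiffOn ℝ ∞ I W
  mem : ∀ x ∈ W, I x ∈ imQuat (J₁ (pr x)) (J₂ (pr x))
  sq : ∀ x ∈ W, I x * I x = -1
  inj : ∀ x ∈ W, ∀ a, pr a = 0 → covEnd G pr I x a = 0 → a = 0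
  surj : ∀ x ∈ W, ∀ X : V, ∀ A ∈ imQuat (J₁ (pr x)) (J₂ (pr x)), gam V (I x) A = 0 →
    ∃ a, pr a = X ∧ covEnd G pr I x a = A
  metric_eq : ∀ x ∈ W, ∀ a b, H x a b =
    G (pr x) (pr a) (pr b) + c⁻¹ * gam V (covEnd G pr I x a) (covEnd G pr I x b)

namespace IsLocalTwistor

variable {n : ℕ} {c : ℝ} {G : V → V →L[ℝ] V →L[ℝ] ℝ} {J₁ J₂ : V → V →L[ℝ] V} {U : Set V}
  {pr : N →L[ℝ] V} {I : N → V →L[ℝ] V} {H : N → N →L[ℝ] N →L[ℝ] ℝ} {W : Set N}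
  (h : IsLocalTwistor n c G J₁ J₂ U pr I H W) {x : N} (hx : x ∈ W)

include h hx

theorem contDiffAt_I : ContDiffAt ℝ ∞ I x := h.smooth.contDiffAt (h.isOpen.mem_nhds hx)

theorem eventually_mem : ∀ᶠ y in nhds x, y ∈ W := h.isOpen.mem_nhds hx

/-- The expression `covEnd G pr I y a` is the one-form θ evaluated on a, written θ_a below. The pair
of pr(a) and θ_a determines the vector a. -/
theorem contDiffAt_theta (a : N) : ContDiffAt ℝ ∞ (fun y ↦ covEnd G pr I y a) x :=
  contDiffAt_covEnd h.base.metric (h.maps x hx) (h.contDiffAt_I hx) a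

theorem triple : QuatTriple (G (pr x)) (J₁ (pr x)) (J₂ (pr x)) (J₁ (pr x) * J₂ (pr x)) :=
  h.base.triple _ (h.maps x hx)

theorem theta_mem (a : N) : covEnd G pr I x a ∈ imQuat (J₁ (pr x)) (J₂ (pr x)) :=
  h.base.covEnd_mem (h.maps x hx) ((h.contDiffAt_I hx).differentiableAt (by simp))
    ((h.eventually_mem hx).mono h.mem) a

theorem theta_mem₂ (a b : N) :
    covEnd G pr (fun y ↦ covEnd G pr I y b) x a ∈ imQuat (J₁ (pr x)) (J₂ (pr x)) :=
  h.base.covEnd_mem (h.maps x hx) ((h.contDiffAt_theta hx b).differentiableAt (by simp))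
    ((h.eventually_mem hx).mono fun _ hy ↦ h.theta_mem hy b) a

theorem gam_I : gam V (I x) (I x) = 1 := by
  have hV : (Module.finrank ℝ V : ℝ) ≠ 0 := by exact_mod_cast h.base.finrank_pos.ne'
  rw [gam, h.sq x hx, map_neg, trL_one, neg_neg, div_self hV]

theorem gam_I_theta (a : N) : gam V (I x) (covEnd G pr I x a) = 0 := by
  have hd := (h.contDiffAt_I hx).differentiableAt (by simp)
  have h1 := IsLocalQK.fderiv_gam (G := G) (pr := pr) hd hd a
  have e : (fun y ↦ gam V (I y) (I y)) =ᶠ[nhds x] fun _ ↦ 1 :=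
    (h.eventually_mem hx).mono fun y hy ↦ h.gam_I hy
  rw [e.fderiv_eq, fderiv_const_apply, zero_apply, gam_comm _ (I x)] at h1
  linarith

/-- The derivative of γ(I, θ_b) = 0. The component of ∇_a θ_b along I is the second fundamental form
of the unit sphere in Im Q. -/
theorem gam_I_theta₂ (a b : N) : gam V (I x) (covEnd G pr (fun y ↦ covEnd G pr I y b) x a) =
    -gam V (covEnd G pr I x a) (covEnd G pr I x b) := by
  have hd := (h.contDiffAt_I hx).differentiableAt (by simp)
  have h1 := IsLocalQK.fderiv_gam (G := G) (pr := pr) hd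
    ((h.contDiffAt_theta hx b).differentiableAt (by simp)) a
  have e : (fun y ↦ gam V (I y) (covEnd G pr I y b)) =ᶠ[nhds x] fun _ ↦ 0 :=
    (h.eventually_mem hx).mono fun y hy ↦ h.gam_I_theta hy b
  rw [e.fderiv_eq, fderiv_const_apply, zero_apply] at h1
  linarith

theorem theta_mul_I (a : N) : covEnd G pr I x a * I x = -(I x * covEnd G pr I x a) := by
  have h1 := (h.triple hx).mul_add_mul h.base.finrank_pos (h.theta_mem hx a) (h.mem x hx)
  rw [gam_comm, h.gam_I_theta hx, mul_zero, zero_smul] at h1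
  exact eq_neg_of_add_eq_zero_left h1

theorem I_mul_theta (a : N) : I x * covEnd G pr I x a ∈ imQuat (J₁ (pr x)) (J₂ (pr x)) ∧
    gam V (I x) (I x * covEnd G pr I x a) = 0 := by
  refine ⟨?_, ?_⟩
  · have h1 := Submodule.smul_mem _ (1 / 2 : ℝ)
      ((h.triple hx).bracket_mem (h.mem x hx) (h.theta_mem hx a))
    rwa [h.theta_mul_I hx, sub_neg_eq_add, ← two_smul ℝ, smul_smul, show (1 / 2 * 2 : ℝ) = 1 by norm_num,
      one_smul] at h1
  · have h1 : trL V (covEnd G pr I x a) = 0 :=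
      h.base.trace_eq_zero (h.maps x hx) (h.theta_mem hx a)
    rw [gam, ← mul_assoc, h.sq x hx, neg_mul, one_mul, map_neg, h1]
    simp

theorem differentiableAt_gam_theta (a b : N) : ContDiffAt ℝ ∞
    (fun y ↦ gam V (covEnd G pr I y a) (covEnd G pr I y b)) x := by
  have e : (fun y ↦ gam V (covEnd G pr I y a) (covEnd G pr I y b)) = fun y ↦
      (-(Module.finrank ℝ V : ℝ)⁻¹) * trL V (covEnd G pr I y a * covEnd G pr I y b) := by
    funext y; rw [gam]; ring
  rw [e]
  exact contDiffAt_const.mul ((trL V).contDiff.contDiffAt.comp x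
    ((h.contDiffAt_theta hx a).mul (h.contDiffAt_theta hx b)))

-- Positivity: γ is positive definite on imaginary quaternions and c > 0, and for a ≠ 0 either pr(a)
-- or θ_a is nonzero.
set_option synthInstance.maxHeartbeats 200000 in
omit hx in
theorem isMetricOn : IsMetricOn H W where
  isOpen := h.isOpen
  smooth := by
    refine contDiffOn_clm_apply.2 fun a ↦ contDiffOn_clm_apply.2 fun b ↦ ?_
    refine ContDiffOn.congr (f := fun x ↦ G (pr x) (pr a) (pr b) +
      c⁻¹ * gam V (covEnd G pr I x a) (covEnd G pr I x b)) (fun x hx ↦ ?_)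
      (fun x hx ↦ h.metric_eq x hx a b)
    have h1 : ContDiffAt ℝ ∞ (fun x ↦ G (pr x) (pr a) (pr b)) x :=
      (h.base.metric.contDiffAt_apply (h.maps x hx) (pr a) (pr b)).comp x pr.contDiff.contDiffAt
    exact (h1.add (contDiffAt_const.mul
      (h.differentiableAt_gam_theta hx a b))).contDiffWithinAt
  symm x hx a b := by
    rw [h.metric_eq x hx, h.metric_eq x hx, gam_comm, h.base.metric.symm _ (h.maps x hx)]
  pos x hx a ha := by
    have ht := h.triple hx
    have hc := h.pos
    rw [h.metric_eq x hx]
    have h2 : 0 ≤ gam V (covEnd G pr I x a) (covEnd G pr I x a) ∧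
        (gam V (covEnd G pr I x a) (covEnd G pr I x a) = 0 → covEnd G pr I x a = 0) := by
      obtain ⟨p, q, r, e⟩ := ht.mem_iff.1 (h.theta_mem hx a)
      rw [← e, ht.gam_comb h.base.finrank_pos]
      refine ⟨by nlinarith [sq_nonneg p, sq_nonneg q, sq_nonneg r], fun h0 ↦ ?_⟩
      have hp : p = 0 := by nlinarith [sq_nonneg p, sq_nonneg q, sq_nonneg r]
      have hq : q = 0 := by nlinarith [sq_nonneg p, sq_nonneg q, sq_nonneg r]
      have hr : r = 0 := by nlinarith [sq_nonneg p, sq_nonneg q, sq_nonneg r]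
      simp [hp, hq, hr]
    by_cases h1 : pr a = 0
    · have h3 : gam V (covEnd G pr I x a) (covEnd G pr I x a) ≠ 0 := fun h0 ↦
        ha (h.inj x hx a h1 (h2.2 h0))
      have h4 := lt_of_le_of_ne h2.1 h3.symm
      rw [h1, map_zero, zero_add]
      positivity
    · have := h.base.metric.pos _ (h.maps x hx) _ h1
      have h3 := h2.1
      positivity

/-- The horizontal part of the Christoffel symbols of the twistor metric. -/
def horChr (G : V → V →L[ℝ] V →L[ℝ] ℝ) (pr : N →L[ℝ] V) (I : N → V →L[ℝ] V) (x a b : N) : V :=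
  christoffel G (pr x) (pr a) (pr b) - (1 / 2 : ℝ) • (I x (covEnd G pr I x b (pr a))) -
    (1 / 2 : ℝ) • (I x (covEnd G pr I x a (pr b)))

/-- The vertical part of the Christoffel symbols of the twistor metric. -/
def verChr (c : ℝ) (G : V → V →L[ℝ] V →L[ℝ] ℝ) (J₁ J₂ : V → V →L[ℝ] V) (pr : N →L[ℝ] V)
    (I : N → V →L[ℝ] V) (x a b : N) : V →L[ℝ] V :=
  covEnd G pr (fun y ↦ covEnd G pr I y b) x a -
    (c / 4) • (quatMoment (G (pr x)) (J₁ (pr x)) (J₂ (pr x)) (pr a) (pr b) * I x -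
      I x * quatMoment (G (pr x)) (J₁ (pr x)) (J₂ (pr x)) (pr a) (pr b)) +
    gam V (covEnd G pr I x a) (covEnd G pr I x b) • I x

/-- The Ricci identity for the section I, combined with the curvature of Q. It measures how far the
horizontal distribution ker θ is from being integrable. -/
theorem theta₂_sub (a b : N) : covEnd G pr (fun y ↦ covEnd G pr I y b) x a -
    covEnd G pr (fun y ↦ covEnd G pr I y a) x b =
      (c / 2) • (quatMoment (G (pr x)) (J₁ (pr x)) (J₂ (pr x)) (pr a) (pr b) * I x -
        I x * quatMoment (G (pr x)) (J₁ (pr x)) (J₂ (pr x)) (pr a) (pr b)) := by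
  rw [covEnd_comm h.base.metric (h.maps x hx) (h.contDiffAt_I hx),
    h.base.bracket_curvature (h.maps x hx) (h.mem x hx), h.nscal_eq _ (h.maps x hx)]

theorem horChr_symm (a b : N) : horChr G pr I x a b = horChr G pr I x b a := by
  rw [horChr, horChr, h.base.metric.christoffel_symm (h.maps x hx)]; abel

/-- The term with c/4 in `verChr` is half of the antisymmetric expression in `theta₂_sub`;
subtracting it symmetrizes ∇_a θ_b. -/
theorem verChr_symm (a b : N) : verChr c G J₁ J₂ pr I x a b = verChr c G J₁ J₂ pr I x b a := by
  have h1 := h.theta₂_sub hx a b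
  rw [verChr, verChr, (h.triple hx).quatMoment_antisymm (h.base.metric.symm _ (h.maps x hx)) (pr b),
    gam_comm (covEnd G pr I x b), eq_add_of_sub_eq h1]
  rw [neg_mul, mul_neg]
  module

theorem verChr_mem (a b : N) : verChr c G J₁ J₂ pr I x a b ∈ imQuat (J₁ (pr x)) (J₂ (pr x)) := by
  have ht := h.triple hx
  exact add_mem (sub_mem (h.theta_mem₂ hx a b) (Submodule.smul_mem _ _
    (ht.bracket_mem (QuatTriple.quatMoment_mem _ _ _ _ _) (h.mem x hx))))
    (Submodule.smul_mem _ _ (h.mem x hx))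

/-- The last term of `verChr` removes the component of ∇_a θ_b along I, and a bracket with I has
none. Hence the expression is the value of θ on some vector. -/
theorem gam_I_verChr (a b : N) : gam V (I x) (verChr c G J₁ J₂ pr I x a b) = 0 := by
  rw [verChr, gam_add_right, gam_sub_right, gam_smul_right, gam_smul_right, h.gam_I hx,
    h.gam_I_theta₂ hx, gam_comm (I x), gam_bracket, sub_self]
  simp [gam]

/-- The inner product of a vertical vector with a bracket of the moment form. -/
theorem gam_bracket_quatMoment (v w : V) (a : N) :
    gam V (quatMoment (G (pr x)) (J₁ (pr x)) (J₂ (pr x)) v w * I x -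
      I x * quatMoment (G (pr x)) (J₁ (pr x)) (J₂ (pr x)) v w) (covEnd G pr I x a) =
      2 * G (pr x) v (I x (covEnd G pr I x a w)) := by
  have ht := h.triple hx
  rw [gam_bracket, ht.gam_quatMoment h.base.finrank_pos
    (ht.bracket_mem (h.mem x hx) (h.theta_mem hx a)), h.theta_mul_I hx, sub_neg_eq_add, ← two_smul ℝ]
  simp

-- The candidate connection is metric. Its mixed terms cancel: by `gam_bracket_quatMoment` the
-- bracket in `verChr` contributes c⁻¹ · (c/4) · 2 = 1/2 times g(·, Iθ·), which offsets the halves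
-- in `horChr`.
set_option synthInstance.maxHeartbeats 200000 in
theorem fderiv_metric (c' a b : N) : fderiv ℝ H x c' a b =
    G (pr x) (horChr G pr I x c' a) (pr b) + G (pr x) (pr a) (horChr G pr I x c' b) +
    c⁻¹ * (gam V (verChr c G J₁ J₂ pr I x c' a) (covEnd G pr I x b) +
      gam V (covEnd G pr I x a) (verChr c G J₁ J₂ pr I x c' b)) := by
  have hc := h.pos.ne'
  have hm := h.maps x hx
  have ht := h.triple hx
  have hd := fun a ↦ (h.contDiffAt_theta hx a).differentiableAt (by simp)
  have e : (fun y ↦ H y a b) =ᶠ[nhds x] fun y ↦ G (pr y) (pr a) (pr b) +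
      c⁻¹ * gam V (covEnd G pr I y a) (covEnd G pr I y b) :=
    (h.eventually_mem hx).mono fun y hy ↦ h.metric_eq y hy a b
  have h1 : DifferentiableAt ℝ (fun y ↦ G (pr y) (pr a) (pr b)) x :=
    ((h.base.metric.contDiffAt_apply hm (pr a) (pr b)).comp x pr.contDiff.contDiffAt).differentiableAt
      (by simp)
  have h2 := (h.differentiableAt_gam_theta hx a b).differentiableAt (by simp)
  rw [← h.isMetricOn.fderiv_apply hx, e.fderiv_eq, fderiv_fun_add h1 (h2.const_mul _), add_apply,
    fderiv_const_mul h2, smul_apply, IsLocalQK.fderiv_gam (G := G) (pr := pr) (hd a) (hd b),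
    fderiv_inner_pull h.base.metric hm (differentiableAt_const _) (differentiableAt_const _),
    covVec_const, covVec_const]
  have hsk : ∀ a v w, G (pr x) (I x (covEnd G pr I x a v)) w =
      -G (pr x) v (I x (covEnd G pr I x a w)) := fun a v w ↦
    ht.skew (h.I_mul_theta hx a).1 v w
  have hsk' : G (pr x) (pr b) (I x (covEnd G pr I x c' (pr a))) =
      -G (pr x) (pr a) (I x (covEnd G pr I x c' (pr b))) := by
    rw [h.base.metric.symm _ hm, hsk]
  rw [gam_comm (covEnd G pr I x a) (verChr _ _ _ _ _ _ _ _ _),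
    gam_comm (covEnd G pr I x a) (covEnd _ _ _ _ _), h.base.metric.symm _ hm (pr a) (horChr _ _ _ _ _ _)]
  simp only [horChr, verChr, gam_add_left, gam_sub_left, gam_smul_left,
    h.gam_I_theta hx, h.gam_bracket_quatMoment hx, map_sub, sub_apply, map_smul, smul_apply,
    smul_eq_mul, hsk, hsk', h.base.metric.symm _ hm (pr a) (christoffel _ _ _ _)]
  field_simp
  ring

/-- The horizontal part of the Levi-Civita connection of the twistor metric. -/
theorem christoffel_hor_ver (a b : N) : pr (christoffel H x a b) = horChr G pr I x a b ∧
    covEnd G pr I x (christoffel H x a b) = verChr c G J₁ J₂ pr I x a b := by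
  -- The candidate is defined by its projection and its value under θ; the rest of the proof checks
  -- that it is symmetric and metric.
  choose T hT1 hT2 using fun a b ↦ h.surj x hx (horChr G pr I x a b) _ (h.verChr_mem hx a b)
    (h.gam_I_verChr hx a b)
  have key : christoffel H x a b = T a b := by
    refine h.isMetricOn.christoffel_unique hx T (fun v w ↦ ?_) (fun a b z ↦ ?_) a b
    · rw [← sub_eq_zero]
      refine h.inj x hx _ ?_ ?_
      · rw [map_sub, hT1, hT1, h.horChr_symm hx, sub_self]
      · rw [sub_eq_add_neg, ← neg_one_smul ℝ, covEnd_add_right, covEnd_smul_right, hT2, hT2,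
          h.verChr_symm hx]
        module
    · rw [h.fderiv_metric hx, h.metric_eq x hx, h.metric_eq x hx, hT1, hT1, hT2, hT2]
      ring
  rw [key]
  exact ⟨hT1 a b, hT2 a b⟩

end IsLocalTwistor
end LocalTwistor

/-! ### The curvature tensor of the twistor metric. -/

section TwistorCurvatureTensor

variable {V : Type*} [NormedAddCommGroup V] [NormedSpace ℝ V] [FiniteDimensional ℝ V]
  {N : Type*} [NormedAddCommGroup N] [NormedSpace ℝ N] [FiniteDimensional ℝ N]

namespace IsLocalTwistor

variable {n : ℕ} {c : ℝ} {G : V → V →L[ℝ] V →L[ℝ] ℝ} {J₁ J₂ : V → V →L[ℝ] V} {U : Set V}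
  {pr : N →L[ℝ] V} {I : N → V →L[ℝ] V} {H : N → N →L[ℝ] N →L[ℝ] ℝ} {W : Set N}
  (h : IsLocalTwistor n c G J₁ J₂ U pr I H W) {x : N} (hx : x ∈ W)

include h hx

/-- The Leibniz rule for θ on a variable vector field; it is applied to the Christoffel vectors,
which depend on the point. -/
theorem covEnd_theta_field {f : N → N} (hf : DifferentiableAt ℝ f x) (p : N) :
    covEnd G pr (fun y ↦ covEnd G pr I y (f y)) x p =
      covEnd G pr (fun y ↦ covEnd G pr I y (f x)) x p + covEnd G pr I x (fderiv ℝ f x p) := by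
  let θ : N → N →L[ℝ] (V →L[ℝ] V) := fun y ↦ LinearMap.toContinuousLinearMap
    { toFun := covEnd G pr I y
      map_add' := covEnd_add_right
      map_smul' := covEnd_smul_right }
  have hθ : DifferentiableAt ℝ θ x := by
    have key : ContDiffOn ℝ ∞ θ W := by
      rw [contDiffOn_clm_apply]
      exact fun a y hy ↦ (h.contDiffAt_theta hy a).contDiffWithinAt
    exact (key.contDiffAt (h.isOpen.mem_nhds hx)).differentiableAt (by simp)
  have e1 := fderiv_app hθ hf p
  have e2 := fderiv_apply_const hθ p (f x)
  change fderiv ℝ (fun y ↦ covEnd G pr I y (f y)) x p = covEnd G pr I x (fderiv ℝ f x p) + _ at e1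
  change fderiv ℝ (fun y ↦ covEnd G pr I y (f x)) x p = _ at e2
  rw [show covEnd G pr (fun y ↦ covEnd G pr I y (f y)) x p =
      fderiv ℝ (fun y ↦ covEnd G pr I y (f y)) x p +
        christoffel G (pr x) (pr p) * covEnd G pr I x (f x) -
        covEnd G pr I x (f x) * christoffel G (pr x) (pr p) from rfl,
    show covEnd G pr (fun y ↦ covEnd G pr I y (f x)) x p =
      fderiv ℝ (fun y ↦ covEnd G pr I y (f x)) x p +
        christoffel G (pr x) (pr p) * covEnd G pr I x (f x) -
        covEnd G pr I x (f x) * christoffel G (pr x) (pr p) from rfl, e1, e2]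
  abel

theorem gam_theta_I (a : N) : gam V (covEnd G pr I x a) (I x) = 0 := by
  rw [gam_comm, h.gam_I_theta hx]

theorem I_theta_I (a : N) (v : V) : I x (covEnd G pr I x a (I x v)) = covEnd G pr I x a v := by
  have h1 := congrArg (fun A : V →L[ℝ] V ↦ I x (A v)) (h.theta_mul_I hx a)
  have h2 := congrArg (fun A : V →L[ℝ] V ↦ A (covEnd G pr I x a v)) (h.sq x hx)
  simp only [mul_apply_eq_comp, neg_apply, map_neg] at h1 h2
  rw [h1, h2]
  simp

theorem covVec_horChr (p a b : N) : covVec G pr (fun y ↦ horChr G pr I y a b) x p =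
    covVec G pr (fun y ↦ covVec G pr (fun _ ↦ pr b) y a) x p -
    (1 / 2 : ℝ) • (covEnd G pr I x p (covEnd G pr I x b (pr a)) +
      I x (covEnd G pr (fun y ↦ covEnd G pr I y b) x p (pr a)) +
      I x (covEnd G pr I x b (christoffel G (pr x) (pr p) (pr a)))) -
    (1 / 2 : ℝ) • (covEnd G pr I x p (covEnd G pr I x a (pr b)) +
      I x (covEnd G pr (fun y ↦ covEnd G pr I y a) x p (pr b)) +
      I x (covEnd G pr I x a (christoffel G (pr x) (pr p) (pr b)))) := by
  have hI := (h.contDiffAt_I hx).differentiableAt (by simp)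
  have hth := fun a ↦ (h.contDiffAt_theta hx a).differentiableAt (by simp)
  have hthc : ∀ a b : N, DifferentiableAt ℝ (fun y ↦ covEnd G pr I y b (pr a)) x := fun a b ↦
    (hth b).clm_apply (differentiableAt_const _)
  have hd : ∀ a b : N, DifferentiableAt ℝ (fun y ↦ I y (covEnd G pr I y b (pr a))) x := fun a b ↦
    hI.clm_apply (hthc a b)
  have h0 : DifferentiableAt ℝ (fun y ↦ covVec G pr (fun _ ↦ pr b) y a) x :=
    (contDiffAt_covVec h.base.metric (h.maps x hx) contDiffAt_const a).differentiableAt (by simp)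
  -- The base Christoffel term is the covariant derivative of the constant field pr(b); in this form
  -- the Ricci identity `covVec_comm` applies to it later.
  have e : (fun y ↦ horChr G pr I y a b) = fun y ↦ covVec G pr (fun _ ↦ pr b) y a -
      (1 / 2 : ℝ) • (I y (covEnd G pr I y b (pr a))) -
      (1 / 2 : ℝ) • (I y (covEnd G pr I y a (pr b))) := by
    funext y; rw [horChr, covVec_const]
  rw [e, covVec_sub (h0.fun_sub ((hd a b).fun_const_smul _)) ((hd b a).fun_const_smul _),
    covVec_sub h0 ((hd a b).fun_const_smul _), covVec_const_smul _ (hd a b),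
    covVec_const_smul _ (hd b a), covVec_app hI (hthc a b), covVec_app hI (hthc b a),
    covVec_app (hth a) (differentiableAt_const _), covVec_app (hth b) (differentiableAt_const _),
    covVec_const, covVec_const, map_add, map_add, add_assoc, add_assoc]

/-- Because Φ is parallel and c is constant, the derivative of the moment form contains only the
Christoffel vectors of its two arguments. -/
theorem covEnd_verChr (p a b : N) : covEnd G pr (fun y ↦ verChr c G J₁ J₂ pr I y a b) x p =
    covEnd G pr (fun y ↦ covEnd G pr (fun y ↦ covEnd G pr I y b) y a) x p -
    (c / 4) • ((quatMoment (G (pr x)) (J₁ (pr x)) (J₂ (pr x))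
          (christoffel G (pr x) (pr p) (pr a)) (pr b) +
        quatMoment (G (pr x)) (J₁ (pr x)) (J₂ (pr x)) (pr a)
          (christoffel G (pr x) (pr p) (pr b))) * I x -
      I x * (quatMoment (G (pr x)) (J₁ (pr x)) (J₂ (pr x))
          (christoffel G (pr x) (pr p) (pr a)) (pr b) +
        quatMoment (G (pr x)) (J₁ (pr x)) (J₂ (pr x)) (pr a)
          (christoffel G (pr x) (pr p) (pr b))) +
      (quatMoment (G (pr x)) (J₁ (pr x)) (J₂ (pr x)) (pr a) (pr b) * covEnd G pr I x p -
        covEnd G pr I x p * quatMoment (G (pr x)) (J₁ (pr x)) (J₂ (pr x)) (pr a) (pr b))) +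
    (gam V (covEnd G pr (fun y ↦ covEnd G pr I y a) x p) (covEnd G pr I x b) +
      gam V (covEnd G pr I x a) (covEnd G pr (fun y ↦ covEnd G pr I y b) x p)) • I x +
    gam V (covEnd G pr I x a) (covEnd G pr I x b) • covEnd G pr I x p := by
  have hm := h.maps x hx
  have hI := (h.contDiffAt_I hx).differentiableAt (by simp)
  have hth := fun a ↦ (h.contDiffAt_theta hx a).differentiableAt (by simp)
  have hth₂ : DifferentiableAt ℝ (fun y ↦ covEnd G pr (fun y ↦ covEnd G pr I y b) y a) x :=
    (contDiffAt_covEnd h.base.metric hm (h.contDiffAt_theta hx b) a).differentiableAt (by simp)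
  have hg := (h.differentiableAt_gam_theta hx a b).differentiableAt (by simp)
  have hΦ : DifferentiableAt ℝ
      (fun y ↦ quatMoment (G (pr y)) (J₁ (pr y)) (J₂ (pr y)) (pr a) (pr b)) x :=
    h.base.differentiableAt_quatMoment hm (differentiableAt_const _) (differentiableAt_const _)
  have hb := (hΦ.fun_mul hI).fun_sub (hI.fun_mul hΦ)
  unfold verChr
  rw [covEnd_add (hth₂.fun_sub (hb.fun_const_smul _)) (hg.fun_smul hI),
    covEnd_sub hth₂ (hb.fun_const_smul _), covEnd_const_smul _ hb,
    covEnd_sub (hΦ.fun_mul hI) (hI.fun_mul hΦ), covEnd_mul hΦ hI, covEnd_mul hI hΦ,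
    covEnd_smul hg hI, IsLocalQK.fderiv_gam (G := G) (pr := pr) (hth a) (hth b),
    h.base.covEnd_quatMoment hm (differentiableAt_const _) (differentiableAt_const _),
    covVec_const, covVec_const]
  module

/-- The projection is linear, so it commutes with differentiation and the task is to differentiate
`horChr`. Antisymmetrization in p and a turns second covariant derivatives into R and derivatives of
θ into (c/2)[Φ, I]; the other derivatives cancel. -/
theorem hor_curvature (p a b : N) : pr (localCurvature H x p a b) =
    localCurvature G (pr x) (pr p) (pr a) (pr b) -
    (1 / 4 : ℝ) • covEnd G pr I x p (covEnd G pr I x b (pr a)) +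
    (1 / 4 : ℝ) • covEnd G pr I x a (covEnd G pr I x b (pr p)) -
    (1 / 4 : ℝ) • (covEnd G pr I x p (covEnd G pr I x a (pr b)) -
      covEnd G pr I x a (covEnd G pr I x p (pr b))) +
    (1 / 2 : ℝ) • (gam V (covEnd G pr I x a) (covEnd G pr I x b) • pr p -
      gam V (covEnd G pr I x p) (covEnd G pr I x b) • pr a) -
    (c / 4) • I x ((quatMoment (G (pr x)) (J₁ (pr x)) (J₂ (pr x)) (pr p) (pr a) * I x -
      I x * quatMoment (G (pr x)) (J₁ (pr x)) (J₂ (pr x)) (pr p) (pr a)) (pr b)) +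
    (c / 8) • I x ((quatMoment (G (pr x)) (J₁ (pr x)) (J₂ (pr x)) (pr a) (pr b) * I x -
      I x * quatMoment (G (pr x)) (J₁ (pr x)) (J₂ (pr x)) (pr a) (pr b)) (pr p)) -
    (c / 8) • I x ((quatMoment (G (pr x)) (J₁ (pr x)) (J₂ (pr x)) (pr p) (pr b) * I x -
      I x * quatMoment (G (pr x)) (J₁ (pr x)) (J₂ (pr x)) (pr p) (pr b)) (pr a)) := by
  have hm := h.maps x hx
  have hdF : ∀ a b, DifferentiableAt ℝ (fun y ↦ christoffel H y a b) x := fun a b ↦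
    (h.isMetricOn.contDiffAt_christoffel_apply hx a b).differentiableAt (by simp)
  have key : ∀ p a b : N, pr (fderiv ℝ (fun y ↦ christoffel H y a b) x p) =
      covVec G pr (fun y ↦ horChr G pr I y a b) x p -
        christoffel G (pr x) (pr p) (horChr G pr I x a b) := by
    intro p a b
    have e : (fun y ↦ pr (christoffel H y a b)) =ᶠ[nhds x] fun y ↦ horChr G pr I y a b :=
      (h.eventually_mem hx).mono fun y hy ↦ (h.christoffel_hor_ver hy a b).1
    have e1 := fderiv_comp_apply' pr.differentiableAt (hdF a b) (a := p)
    rw [e.fderiv_eq, ContinuousLinearMap.fderiv] at e1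
    rw [← e1, covVec]; abel
  have hsq : ∀ v, I x (I x v) = -v := fun v ↦ by
    have := congrArg (fun A : V →L[ℝ] V ↦ A v) (h.sq x hx); simpa using this
  -- The two sources of curvature: the antisymmetric part of ∇θ, and the Ricci identity for the
  -- constant field pr(b).
  have h2 := h.theta₂_sub hx p a
  have h3 := covVec_comm h.base.metric hm (contDiffAt_const (c := pr b)) p a
  have hsy := h.base.metric.christoffel_symm hm (pr a) (pr p)
  rw [IsMetricOn.localCurvature_apply, ← h.isMetricOn.fderiv_christoffel_apply hx,
    ← h.isMetricOn.fderiv_christoffel_apply hx]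
  simp only [map_add, map_sub, key, (h.christoffel_hor_ver hx _ _).1]
  rw [h.covVec_horChr hx, h.covVec_horChr hx]
  conv_lhs => simp only [horChr, (h.christoffel_hor_ver hx _ _).1, (h.christoffel_hor_ver hx _ _).2]
  rw [← h3, eq_add_of_sub_eq h2]
  simp only [verChr, covVec_const, hsy]
  simp only [map_add, map_sub, map_smul, add_apply, sub_apply, smul_apply,
    mul_apply_eq_comp, hsq, h.I_theta_I hx]
  module

/-- The vertical analogue of `hor_curvature`. As θ varies with the point, differentiating θ of a
Christoffel vector brings in the correction of `covEnd_theta_field`. -/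
theorem ver_curvature (p a b : N) : covEnd G pr I x (localCurvature H x p a b) =
    (c / 2) • (quatMoment (G (pr x)) (J₁ (pr x)) (J₂ (pr x)) (pr p) (pr a) * covEnd G pr I x b -
      covEnd G pr I x b * quatMoment (G (pr x)) (J₁ (pr x)) (J₂ (pr x)) (pr p) (pr a)) -
    (c / 4) • (quatMoment (G (pr x)) (J₁ (pr x)) (J₂ (pr x)) (pr a) (pr b) * covEnd G pr I x p -
      covEnd G pr I x p * quatMoment (G (pr x)) (J₁ (pr x)) (J₂ (pr x)) (pr a) (pr b)) +
    (c / 4) • (quatMoment (G (pr x)) (J₁ (pr x)) (J₂ (pr x)) (pr p) (pr b) * covEnd G pr I x a -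
      covEnd G pr I x a * quatMoment (G (pr x)) (J₁ (pr x)) (J₂ (pr x)) (pr p) (pr b)) +
    gam V (covEnd G pr I x a) (covEnd G pr I x b) • covEnd G pr I x p -
    gam V (covEnd G pr I x p) (covEnd G pr I x b) • covEnd G pr I x a +
    (c / 2 * gam V (quatMoment (G (pr x)) (J₁ (pr x)) (J₂ (pr x)) (pr p) (pr a) * I x -
      I x * quatMoment (G (pr x)) (J₁ (pr x)) (J₂ (pr x)) (pr p) (pr a)) (covEnd G pr I x b) -
      c / 4 * gam V (quatMoment (G (pr x)) (J₁ (pr x)) (J₂ (pr x)) (pr a) (pr b) * I x -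
      I x * quatMoment (G (pr x)) (J₁ (pr x)) (J₂ (pr x)) (pr a) (pr b)) (covEnd G pr I x p) +
      c / 4 * gam V (quatMoment (G (pr x)) (J₁ (pr x)) (J₂ (pr x)) (pr p) (pr b) * I x -
      I x * quatMoment (G (pr x)) (J₁ (pr x)) (J₂ (pr x)) (pr p) (pr b)) (covEnd G pr I x a)) • I x +
    (c / 8) • (quatMoment (G (pr x)) (J₁ (pr x)) (J₂ (pr x)) (pr p)
        (I x (covEnd G pr I x b (pr a)) + I x (covEnd G pr I x a (pr b))) * I x -
      I x * quatMoment (G (pr x)) (J₁ (pr x)) (J₂ (pr x)) (pr p)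
        (I x (covEnd G pr I x b (pr a)) + I x (covEnd G pr I x a (pr b)))) -
    (c / 8) • (quatMoment (G (pr x)) (J₁ (pr x)) (J₂ (pr x)) (pr a)
        (I x (covEnd G pr I x b (pr p)) + I x (covEnd G pr I x p (pr b))) * I x -
      I x * quatMoment (G (pr x)) (J₁ (pr x)) (J₂ (pr x)) (pr a)
        (I x (covEnd G pr I x b (pr p)) + I x (covEnd G pr I x p (pr b)))) := by
  have hm := h.maps x hx
  have hF : ∀ a b, ContDiffAt ℝ ∞ (fun y ↦ christoffel H y a b) x := fun a b ↦
    h.isMetricOn.contDiffAt_christoffel_apply hx a b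
  have hdF : ∀ a b, DifferentiableAt ℝ (fun y ↦ christoffel H y a b) x := fun a b ↦
    (hF a b).differentiableAt (by simp)
  have key : ∀ p a b : N, covEnd G pr I x (fderiv ℝ (fun y ↦ christoffel H y a b) x p) =
      covEnd G pr (fun y ↦ verChr c G J₁ J₂ pr I y a b) x p -
        covEnd G pr (fun y ↦ covEnd G pr I y (christoffel H x a b)) x p := by
    intro p a b
    have e : (fun y ↦ covEnd G pr I y (christoffel H y a b)) =ᶠ[nhds x]
        fun y ↦ verChr c G J₁ J₂ pr I y a b :=
      (h.eventually_mem hx).mono fun y hy ↦ (h.christoffel_hor_ver hy a b).2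
    rw [← covEnd_congr e, h.covEnd_theta_field hx (hdF a b)]
    abel
  have h2 := h.theta₂_sub hx p a
  -- Second covariant derivatives of θ_b antisymmetrize to [R, θ_b], which is (c/2)[Φ, θ_b] because
  -- θ_b is imaginary.
  have h3 := covEnd_comm h.base.metric hm (h.contDiffAt_theta hx b) p a
  have hsy := h.base.metric.christoffel_symm hm (pr a) (pr p)
  rw [h.base.bracket_curvature hm (h.theta_mem hx b), h.nscal_eq _ hm] at h3
  rw [IsMetricOn.localCurvature_apply, ← h.isMetricOn.fderiv_christoffel_apply hx,
    ← h.isMetricOn.fderiv_christoffel_apply hx]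
  conv_lhs => simp only [sub_eq_add_neg, ← neg_one_smul ℝ (christoffel _ _ _ _),
    ← neg_one_smul ℝ (fderiv _ _ _ _), covEnd_add_right, covEnd_smul_right, key,
    (h.christoffel_hor_ver hx _ _).2]
  rw [h.covEnd_verChr hx, h.covEnd_verChr hx, verChr, verChr, (h.christoffel_hor_ver hx _ _).1,
    (h.christoffel_hor_ver hx _ _).1, (h.christoffel_hor_ver hx _ _).2,
    (h.christoffel_hor_ver hx _ _).2]
  have h2g : gam V (covEnd G pr (fun y ↦ covEnd G pr I y a) x p) (covEnd G pr I x b) =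
      gam V (covEnd G pr (fun y ↦ covEnd G pr I y p) x a) (covEnd G pr I x b) +
      c / 2 * gam V (quatMoment (G (pr x)) (J₁ (pr x)) (J₂ (pr x)) (pr p) (pr a) * I x -
      I x * quatMoment (G (pr x)) (J₁ (pr x)) (J₂ (pr x)) (pr p) (pr a)) (covEnd G pr I x b) := by
    rw [eq_add_of_sub_eq h2, gam_add_left, gam_smul_left]; ring
  rw [h2g, eq_add_of_sub_eq h3]
  have hg : ∀ (A : V →L[ℝ] V) (a : N), gam V (A * I x - I x * A) (covEnd G pr I x a) =
      gam V (covEnd G pr I x a) (A * I x) - gam V (covEnd G pr I x a) (I x * A) := fun A a ↦ by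
    rw [gam_comm, gam_sub_right]
  rw [hg, hg, hg]
  simp only [verChr, horChr, hsy, gam_add_right, gam_sub_right, gam_smul_right, h.gam_theta_I hx]
  simp only [sub_eq_add_neg, ← neg_smul, quatMoment_add_right, quatMoment_smul_right, add_mul, mul_add,
    smul_mul_assoc, mul_smul_comm]
  module

end IsLocalTwistor
end TwistorCurvatureTensor

/-! ### Adapted quaternionic frames and traces over a splitting. -/

section TwistorRicci

variable {V : Type*} [NormedAddCommGroup V] [NormedSpace ℝ V] [FiniteDimensional ℝ V]
  {N : Type*} [NormedAddCommGroup N] [NormedSpace ℝ N] [FiniteDimensional ℝ N]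

namespace QuatTriple

variable {g : V →L[ℝ] V →L[ℝ] ℝ} {J₁ J₂ K₁ I J : V →L[ℝ] V}

theorem eq_neg_one_of_gam (h : QuatTriple g J₁ J₂ K₁) (hV : 0 < Module.finrank ℝ V)
    {A : V →L[ℝ] V} (hA : A ∈ imQuat J₁ J₂) (h1 : gam V A A = 1) : A * A = -1 := by
  have := h.mul_add_mul hV hA hA
  rw [h1, ← two_smul ℝ] at this
  have h2 := congrArg (fun B : V →L[ℝ] V ↦ (1 / 2 : ℝ) • B) this
  simp only [smul_smul] at h2
  norm_num at h2
  exact h2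

/-- Orthonormal elements of the imaginary part of the quaternions are part of a quaternionic triple. -/
theorem of_gam (h : QuatTriple g J₁ J₂ K₁) (hV : 0 < Module.finrank ℝ V) (hI : I ∈ imQuat J₁ J₂)
    (hJ : J ∈ imQuat J₁ J₂) (hII : gam V I I = 1) (hJJ : gam V J J = 1) (hIJ : gam V I J = 0) :
    QuatTriple g I J (I * J) where
  II := h.eq_neg_one_of_gam hV hI hII
  JJ := h.eq_neg_one_of_gam hV hJ hJJ
  IJ := rfl
  JI := by
    have := h.mul_add_mul hV hJ hI
    rw [gam_comm, hIJ, mul_zero, zero_smul] at this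
    exact eq_neg_of_add_eq_zero_left this
  skewI := h.skew hI
  skewJ := h.skew hJ

theorem gam_frame (h : QuatTriple g J₁ J₂ K₁) (hV : 0 < Module.finrank ℝ V) :
    gam V J₁ J₁ = 1 ∧ gam V J₂ J₂ = 1 ∧ gam V K₁ K₁ = 1 ∧ gam V J₁ J₂ = 0 ∧ gam V J₁ K₁ = 0 ∧
      gam V J₂ K₁ = 0 := by
  refine ⟨?_, ?_, ?_, ?_, ?_, ?_⟩
  · simpa using h.gam_comb hV 1 0 0 1 0 0
  · simpa using h.gam_comb hV 0 1 0 0 1 0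
  · simpa using h.gam_comb hV 0 0 1 0 0 1
  · simpa using h.gam_comb hV 1 0 0 0 1 0
  · simpa using h.gam_comb hV 1 0 0 0 0 1
  · simpa using h.gam_comb hV 0 1 0 0 0 1

theorem anticomm_of_gam (h : QuatTriple g J₁ J₂ K₁) (hV : 0 < Module.finrank ℝ V)
    (hI : I ∈ imQuat J₁ J₂) (hJ : J ∈ imQuat J₁ J₂) (hIJ : gam V I J = 0) : J * I = -(I * J) := by
  have h1 := h.mul_add_mul hV hJ hI
  rw [gam_comm, hIJ, mul_zero, zero_smul] at h1
  exact eq_neg_of_add_eq_zero_left h1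

theorem mul_mem_of_gam (h : QuatTriple g J₁ J₂ K₁) (hV : 0 < Module.finrank ℝ V)
    (hI : I ∈ imQuat J₁ J₂) (hJ : J ∈ imQuat J₁ J₂) (hIJ : gam V I J = 0) : I * J ∈ imQuat J₁ J₂ := by
  have h2 := Submodule.smul_mem _ (1 / 2 : ℝ) (h.bracket_mem hI hJ)
  rwa [h.anticomm_of_gam hV hI hJ hIJ, sub_neg_eq_add, ← two_smul ℝ, smul_smul,
    show (1 / 2 * 2 : ℝ) = 1 by norm_num, one_smul] at h2

/-- The part B of A orthogonal to I, J and K = IJ anticommutes with all three. Anticommuting with I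
and J, it commutes with K. So KB = 0, and B = 0 as K is invertible. -/
theorem eq_comb_of_gam (h : QuatTriple g J₁ J₂ K₁) (hV : 0 < Module.finrank ℝ V)
    (hI : I ∈ imQuat J₁ J₂) (hJ : J ∈ imQuat J₁ J₂) (hII : gam V I I = 1) (hJJ : gam V J J = 1)
    (hIJ : gam V I J = 0) {A : V →L[ℝ] V} (hA : A ∈ imQuat J₁ J₂) :
    A = gam V I A • I + gam V J A • J + gam V (I * J) A • (I * J) := by
  have ht := h.of_gam hV hI hJ hII hJJ hIJ
  have hK := h.mul_mem_of_gam hV hI hJ hIJ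
  obtain ⟨-, -, hKK, -, hIK, hJK⟩ := ht.gam_frame hV
  set K := I * J
  set B := A - (gam V I A • I + gam V J A • J + gam V K A • K) with hB
  have hBm : B ∈ imQuat J₁ J₂ := sub_mem hA (add_mem (add_mem (Submodule.smul_mem _ _ hI)
    (Submodule.smul_mem _ _ hJ)) (Submodule.smul_mem _ _ hK))
  have gI : gam V I B = 0 := by
    simp only [hB, gam_sub_right, gam_add_right, gam_smul_right, hII, hIJ, hIK]; ring
  have gJ : gam V J B = 0 := by
    simp only [hB, gam_sub_right, gam_add_right, gam_smul_right, hJJ, gam_comm J I, hIJ, hJK]; ring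
  have gK : gam V K B = 0 := by
    simp only [hB, gam_sub_right, gam_add_right, gam_smul_right, hKK, gam_comm K I, hIK,
      gam_comm K J, hJK]; ring
  have aI := h.anticomm_of_gam hV hI hBm gI
  have aJ := h.anticomm_of_gam hV hJ hBm gJ
  have aK := h.anticomm_of_gam hV hK hBm gK
  have c1 : B * K = K * B := by
    change B * (I * J) = I * J * B
    rw [← mul_assoc, aI, neg_mul, mul_assoc, aJ, mul_neg, neg_neg, mul_assoc]
  have h0 : K * B = 0 := by
    have h2 : (2 : ℝ) • (K * B) = 0 := by
      rw [two_smul]; nth_rw 1 [← c1]; rw [aK]; abel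
    exact (smul_eq_zero.1 h2).resolve_left (by norm_num)
  have hB0 : B = 0 := by
    have h3 : K * (K * B) = 0 := by rw [h0, mul_zero]
    rw [← mul_assoc, ht.KK] at h3
    simpa using h3
  exact sub_eq_zero.1 hB0

theorem quatMoment_eq_of_gam (h : QuatTriple g J₁ J₂ (J₁ * J₂)) (hV : 0 < Module.finrank ℝ V)
    (hI : I ∈ imQuat J₁ J₂) (hJ : J ∈ imQuat J₁ J₂) (hII : gam V I I = 1) (hJJ : gam V J J = 1)
    (hIJ : gam V I J = 0) (v w : V) : quatMoment g J₁ J₂ v w = quatMoment g I J v w := by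
  have hK := h.mul_mem_of_gam hV hI hJ hIJ
  rw [h.eq_comb_of_gam hV hI hJ hII hJJ hIJ (quatMoment_mem g J₁ J₂ v w), gam_comm, gam_comm J,
    gam_comm (I * J), h.gam_quatMoment hV hI, h.gam_quatMoment hV hJ, h.gam_quatMoment hV hK,
    quatMoment, mul_apply_eq_comp]

end QuatTriple

/-- The trace of an endomorphism of a space with a splitting into `V` and two lines. -/
theorem trace_eq_of_splitting {E F : Type*} [AddCommGroup E] [Module ℝ E] [AddCommGroup F] [Module ℝ F]
    [FiniteDimensional ℝ E] [FiniteDimensional ℝ F] (pr : F →ₗ[ℝ] E) (ι : E →ₗ[ℝ] F)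
    (α β : F →ₗ[ℝ] ℝ) (a b : F) (hid : ∀ v, ι (pr v) + α v • a + β v • b = v) (f : F →ₗ[ℝ] F) :
    LinearMap.trace ℝ F f = LinearMap.trace ℝ E (pr ∘ₗ f ∘ₗ ι) + α (f a) + β (f b) := by
  -- The map f factors through the projection up to two maps of rank one, whose traces are explicit.
  have e : f = (f ∘ₗ ι) ∘ₗ pr + (α.smulRight (f a) + β.smulRight (f b)) := by
    ext v
    change f v = f (ι (pr v)) + (α v • f a + β v • f b)
    conv_lhs => rw [← hid v]
    simp only [map_add, map_smul]; abel
  conv_lhs => rw [e]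
  rw [map_add, map_add, LinearMap.trace_smulRight, LinearMap.trace_smulRight, add_assoc]
  congr 1
  exact LinearMap.trace_comp_comm' _ _

namespace IsLocalTwistor

variable {n : ℕ} {c : ℝ} {G : V → V →L[ℝ] V →L[ℝ] ℝ} {J₁ J₂ : V → V →L[ℝ] V} {U : Set V}
  {pr : N →L[ℝ] V} {I : N → V →L[ℝ] V} {H : N → N →L[ℝ] N →L[ℝ] ℝ} {W : Set N}
  (h : IsLocalTwistor n c G J₁ J₂ U pr I H W) {x : N} (hx : x ∈ W)
  {J : V →L[ℝ] V} (hJ : J ∈ imQuat (J₁ (pr x)) (J₂ (pr x))) (hJJ : gam V J J = 1)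
  (hIJ : gam V (I x) J = 0)

include h hx hJ hJJ hIJ

/-- The frame for pointwise computations: J is any unit imaginary quaternion orthogonal to the
tautological structure at x. -/
theorem adapted : QuatTriple (G (pr x)) (I x) J (I x * J) :=
  (h.triple hx).of_gam h.base.finrank_pos (h.mem x hx) hJ (h.gam_I hx) hJJ hIJ

theorem theta_eq (a : N) : covEnd G pr I x a =
    gam V J (covEnd G pr I x a) • J + gam V (I x * J) (covEnd G pr I x a) • (I x * J) := by
  have := (h.triple hx).eq_comb_of_gam h.base.finrank_pos (h.mem x hx) hJ (h.gam_I hx) hJJ hIJ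
    (h.theta_mem hx a)
  rwa [h.gam_I_theta hx, zero_smul, zero_add] at this

theorem gam_theta_theta (a b : N) : gam V (covEnd G pr I x a) (covEnd G pr I x b) =
    gam V J (covEnd G pr I x a) * gam V J (covEnd G pr I x b) +
    gam V (I x * J) (covEnd G pr I x a) * gam V (I x * J) (covEnd G pr I x b) := by
  obtain ⟨-, -, hKK, -, hIK, hJK⟩ := (h.adapted hx hJ hJJ hIJ).gam_frame h.base.finrank_pos
  conv_lhs => rw [h.theta_eq hx hJ hJJ hIJ a, h.theta_eq hx hJ hJJ hIJ b]
  simp only [gam_add_left, gam_add_right, gam_smul_left, gam_smul_right, hJJ, hKK, hJK,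
    gam_comm (I x * J) J]
  ring

theorem quatMoment_eq (v w : V) : quatMoment (G (pr x)) (J₁ (pr x)) (J₂ (pr x)) v w =
    G (pr x) v (I x w) • I x + G (pr x) v (J w) • J + G (pr x) v ((I x * J) w) • (I x * J) := by
  rw [(h.triple hx).quatMoment_eq_of_gam h.base.finrank_pos (h.mem x hx) hJ (h.gam_I hx) hJJ hIJ,
    quatMoment, mul_apply_eq_comp]

end IsLocalTwistor
end TwistorRicci

/-! ### The holomorphic bisectional curvature of the twistor metric. -/

section TwistorBisectional

variable {V : Type*} [NormedAddCommGroup V] [NormedSpace ℝ V] [FiniteDimensional ℝ V]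
  {N : Type*} [NormedAddCommGroup N] [NormedSpace ℝ N] [FiniteDimensional ℝ N]

namespace IsLocalTwistor

variable {n : ℕ} {c : ℝ} {G : V → V →L[ℝ] V →L[ℝ] ℝ} {J₁ J₂ : V → V →L[ℝ] V} {U : Set V}
  {pr : N →L[ℝ] V} {I : N → V →L[ℝ] V} {H : N → N →L[ℝ] N →L[ℝ] ℝ} {W : Set N}
  (h : IsLocalTwistor n c G J₁ J₂ U pr I H W) {x : N} (hx : x ∈ W)
  {J : V →L[ℝ] V} (hJ : J ∈ imQuat (J₁ (pr x)) (J₂ (pr x))) (hJJ : gam V J J = 1)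
  (hIJ : gam V (I x) J = 0)

include h hx hJ hJJ hIJ

/-- The holomorphic bisectional curvature of the twistor metric. -/
theorem bisectional_eq {a a' b b' : N} (ha : pr a' = I x (pr a))
    (ha' : covEnd G pr I x a' = I x * covEnd G pr I x a) (hb : pr b' = I x (pr b))
    (hb' : covEnd G pr I x b' = I x * covEnd G pr I x b) :
    H x (localCurvature H x a a' b') b =
      G (pr x) (localCurvature G (pr x) (pr a) (I x (pr a)) (I x (pr b))) (pr b) +
      c / 2 * (G (pr x) (J (pr a)) (pr b) ^ 2 + G (pr x) ((I x * J) (pr a)) (pr b) ^ 2) +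
      c / 2 * (H x a b ^ 2 + H x a' b ^ 2 + H x a a * H x b b) -
      c / 2 * (G (pr x) (pr a) (pr b) ^ 2 + G (pr x) (I x (pr a)) (pr b) ^ 2 +
        G (pr x) (pr a) (pr a) * G (pr x) (pr b) (pr b)) := by
  have hc := h.pos.ne'
  have ht := h.adapted hx hJ hJJ hIJ
  obtain ⟨-, -, gKK, -, gIK, gJK⟩ := ht.gam_frame h.base.finrank_pos
  have gKJ : gam V (I x * J) J = 0 := by rw [gam_comm, gJK]
  have hs := h.base.metric.symm _ (h.maps x hx)
  have ea := h.theta_eq hx hJ hJJ hIJ a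
  have eb := h.theta_eq hx hJ hJJ hIJ b
  simp only [h.metric_eq x hx]
  rw [h.hor_curvature hx, h.ver_curvature hx, ha, hb, ha', hb']
  simp only [h.quatMoment_eq hx hJ hJJ hIJ]
  -- With K = IJ one has θ_a = a₂J + a₃K and θ_b = b₂J + b₃K. From here on the claim is an identity
  -- in these four numbers, the triple I, J, K, the vectors X, Y and the base curvature term.
  generalize gam V J (covEnd G pr I x a) = a₂ at *
  generalize gam V (I x * J) (covEnd G pr I x a) = a₃ at *
  generalize gam V J (covEnd G pr I x b) = b₂ at *
  generalize gam V (I x * J) (covEnd G pr I x b) = b₃ at *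
  rw [ea, eb]
  generalize localCurvature G (pr x) (pr a) (I x (pr a)) (I x (pr b)) = R
  generalize hK : I x * J = K at *
  generalize pr a = X
  generalize pr b = Y
  generalize hg : G (pr x) = g at *
  generalize I x = I at *
  simp only [mul_add, add_mul, smul_mul_assoc, mul_smul_comm, ht.II, ht.JJ, ht.KK,
    ht.IJ, ht.JI, ht.JK, ht.KJ, ht.KI, ht.IK, mul_neg, smul_neg, neg_mul]
  have g1J : gam V 1 J = 0 := by simp [gam, ht.trJ]
  have g1K : gam V 1 K = 0 := by simp [gam, ht.trK]
  -- This disposes of the terms in which a skew endomorphism is paired twice with the same vector.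
  have z : ∀ A : V →L[ℝ] V, (∀ v w, g (A v) w = -g v (A w)) → ∀ v, g v (A v) = 0 := fun A hA v ↦ by
    have h1 := hA v v
    rw [hs] at h1; linarith
  have zI := z I ht.skewI
  have zJ := z J ht.skewJ
  have zK := z K ht.skewK
  simp only [add_apply, sub_apply, smul_apply, neg_apply, one_apply_eq_self, map_add, map_sub, map_smul,
    map_neg, smul_eq_mul, ht.apply_II, ht.apply_JJ, ht.apply_KK, ht.apply_IJ, ht.apply_JI, ht.apply_JK,
    ht.apply_KJ, ht.apply_KI, ht.apply_IK, gam_add_left, gam_sub_left, gam_smul_left, gam_neg_left,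
    gam_add_right, gam_smul_right, gam_neg_right, gKK, hJJ, hIJ, gIK, gJK, gKJ, g1J, g1K, ht.skewI, ht.skewJ, ht.skewK, zI, zJ, zK]
  field_simp
  ring

end IsLocalTwistor
end TwistorBisectional

/-! ### The twistor metric is Einstein. -/

section TwistorScalar

variable {V : Type*} [NormedAddCommGroup V] [NormedSpace ℝ V] [FiniteDimensional ℝ V]
  {N : Type*} [NormedAddCommGroup N] [NormedSpace ℝ N] [FiniteDimensional ℝ N]

namespace IsLocalTwistor

variable {n : ℕ} {c : ℝ} {G : V → V →L[ℝ] V →L[ℝ] ℝ} {J₁ J₂ : V → V →L[ℝ] V} {U : Set V}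
  {pr : N →L[ℝ] V} {I : N → V →L[ℝ] V} {H : N → N →L[ℝ] N →L[ℝ] ℝ} {W : Set N}
  (h : IsLocalTwistor n c G J₁ J₂ U pr I H W) {x : N} (hx : x ∈ W)
  {J : V →L[ℝ] V} (hJ : J ∈ imQuat (J₁ (pr x)) (J₂ (pr x))) (hJJ : gam V J J = 1)
  (hIJ : gam V (I x) J = 0)

include h hx hJ hJJ hIJ

/-- The splitting of the tangent space of the twistor space in an adapted quaternionic frame. -/
theorem exists_splitting : ∃ (ι : V →ₗ[ℝ] N) (α β : N →ₗ[ℝ] ℝ) (j k : N),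
    (∀ v, ι (pr v) + α v • j + β v • k = v) ∧
    (∀ v, α v = gam V J (covEnd G pr I x v)) ∧ (∀ v, β v = gam V (I x * J) (covEnd G pr I x v)) ∧
    (∀ X, pr (ι X) = X ∧ covEnd G pr I x (ι X) = 0) ∧
    pr j = 0 ∧ covEnd G pr I x j = J ∧ pr k = 0 ∧ covEnd G pr I x k = I x * J := by
  have ht := h.adapted hx hJ hJJ hIJ
  obtain ⟨-, -, gKK, -, gIK, gJK⟩ := ht.gam_frame h.base.finrank_pos
  have hinj : ∀ a b, pr a = pr b → covEnd G pr I x a = covEnd G pr I x b → a = b := by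
    intro a b h1 h2
    rw [← sub_eq_zero]
    refine h.inj x hx _ (by rw [map_sub, h1, sub_self]) ?_
    rw [sub_eq_add_neg, ← neg_one_smul ℝ, covEnd_add_right, covEnd_smul_right, h2]
    module
  -- ι is the horizontal lift; j and k below are the vertical vectors with θ = J and θ = IJ.
  choose ι hι using fun X ↦ h.surj x hx X 0 (zero_mem _) (by simp [gam])
  obtain ⟨j, hj, hj'⟩ := h.surj x hx 0 J hJ hIJ
  obtain ⟨k, hk, hk'⟩ := h.surj x hx 0 (I x * J)
    ((h.triple hx).mul_mem_of_gam h.base.finrank_pos (h.mem x hx) hJ hIJ) gIK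
  refine ⟨{ toFun := ι, map_add' := fun X Y ↦ hinj _ _ ?_ ?_, map_smul' := fun s X ↦ hinj _ _ ?_ ?_ },
    { toFun := fun v ↦ gam V J (covEnd G pr I x v)
      map_add' := fun v w ↦ by rw [covEnd_add_right, gam_add_right]
      map_smul' := fun s v ↦ by rw [covEnd_smul_right, gam_smul_right]; rfl },
    { toFun := fun v ↦ gam V (I x * J) (covEnd G pr I x v)
      map_add' := fun v w ↦ by rw [covEnd_add_right, gam_add_right]
      map_smul' := fun s v ↦ by rw [covEnd_smul_right, gam_smul_right]; rfl }, j, k, fun v ↦ hinj _ _ ?_ ?_,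
    fun v ↦ rfl, fun v ↦ rfl, hι, hj, hj', hk, hk'⟩
  · rw [map_add, (hι _).1, (hι _).1, (hι _).1]
  · rw [covEnd_add_right, (hι _).2, (hι _).2, (hι _).2, add_zero]
  · rw [map_smul, (hι _).1, (hι _).1]; rfl
  · rw [covEnd_smul_right, (hι _).2, (hι _).2, smul_zero]
  · simp [hj, hk, (hι _).1]
  · have := h.theta_eq hx hJ hJJ hIJ v
    simp only [covEnd_add_right, covEnd_smul_right, hj', hk']
    change covEnd G pr I x (ι (pr v)) + _ + _ = _
    rw [(hι _).2, zero_add]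
    exact this.symm

/-- The horizontal contribution to the Ricci tensor. The base gives (n + 2)c g; the rank-one terms
give −(2·c/2 + 2·c/4) g = −(3c/2) g. The terms quadratic in θ give −nγ + 2nγ, and J and K have trace
zero. -/
theorem trace_hor {ι : V →ₗ[ℝ] N} (hι : ∀ X, pr (ι X) = X ∧ covEnd G pr I x (ι X) = 0) (a b : N) :
    LinearMap.trace ℝ V ((pr : N →ₗ[ℝ] V) ∘ₗ h.isMetricOn.ricciMap hx a b ∘ₗ ι) =
      (n + 2 - 3 / 2) * c * G (pr x) (pr a) (pr b) +
        n * gam V (covEnd G pr I x a) (covEnd G pr I x b) := by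
  have hm := h.maps x hx
  have ht := h.adapted hx hJ hJJ hIJ
  obtain ⟨-, -, gKK, -, gIK, gJK⟩ := ht.gam_frame h.base.finrank_pos
  have hs := h.base.metric.symm _ hm
  set K := I x * J with hK
  have g0 : ∀ A : V →L[ℝ] V, gam V 0 A = 0 := fun A ↦ by simp [gam]
  have e : (pr : N →ₗ[ℝ] V) ∘ₗ h.isMetricOn.ricciMap hx a b ∘ₗ ι =
      h.base.metric.ricciMap hm (pr a) (pr b) +
      (((1 / 4 : ℝ) • (covEnd G pr I x a * covEnd G pr I x b) +
        (1 / 2 * gam V (covEnd G pr I x a) (covEnd G pr I x b)) • (1 : V →L[ℝ] V) +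
        (c / 4 * G (pr x) (pr a) (J (pr b))) • J + (c / 4 * G (pr x) (pr a) (K (pr b))) • K :
          V →L[ℝ] V) : V →ₗ[ℝ] V) -
      (c / 2) • ((((G (pr x)).flip (J (pr a))) : V →ₗ[ℝ] ℝ).smulRight (J (pr b)) +
        (((G (pr x)).flip (K (pr a))) : V →ₗ[ℝ] ℝ).smulRight (K (pr b))) -
      (c / 4) • ((((G (pr x)).flip (J (pr b))) : V →ₗ[ℝ] ℝ).smulRight (J (pr a)) +
        (((G (pr x)).flip (K (pr b))) : V →ₗ[ℝ] ℝ).smulRight (K (pr a))) := by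
    ext X
    change pr (localCurvature H x (ι X) a b) = localCurvature G (pr x) X (pr a) (pr b) +
      ((1 / 4 : ℝ) • covEnd G pr I x a (covEnd G pr I x b X) +
        (1 / 2 * gam V (covEnd G pr I x a) (covEnd G pr I x b)) • X +
        (c / 4 * G (pr x) (pr a) (J (pr b))) • J X + (c / 4 * G (pr x) (pr a) (K (pr b))) • K X) -
      (c / 2) • (G (pr x) X (J (pr a)) • J (pr b) + G (pr x) X (K (pr a)) • K (pr b)) -
      (c / 4) • (G (pr x) X (J (pr b)) • J (pr a) + G (pr x) X (K (pr b)) • K (pr a))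
    rw [h.hor_curvature hx, (hι X).1, (hι X).2]
    simp only [h.quatMoment_eq hx hJ hJJ hIJ, ← hK, g0, zero_apply, map_zero,
      mul_add, add_mul, smul_mul_assoc, mul_smul_comm, ht.II, ht.JI, ht.KI, ht.IK,
      add_apply, sub_apply, smul_apply, neg_apply, one_apply_eq_self, map_add, map_sub, map_smul,
      map_neg, ht.apply_IJ, ht.apply_IK]
    module
  have hn := h.base.finrank_cast
  have hn0 := h.base.n_pos
  rw [e, map_sub, map_sub, map_add, ← trL_apply, ← h.base.metric.localRicci_eq_trace hm,
    h.base.localRicci_eq hm, h.nscal_eq _ hm]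
  simp only [LinearMap.trace_smulRight, map_add, map_smul, ht.trJ, ht.trK, trL_one, hn, smul_eq_mul, ContinuousLinearMap.coe_coe,
    ContinuousLinearMap.flip_apply, ht.rotate.inner_I, ht.rotate.rotate.inner_I]
  rw [show trL V (covEnd G pr I x a * covEnd G pr I x b) =
    -(4 * n) * gam V (covEnd G pr I x a) (covEnd G pr I x b) by rw [gam, hn]; field_simp, hs (pr b)]
  ring

-- For vertical p every term with Φ(pr p, ·) vanishes. What remains is the curvature of the fibre, a
-- unit sphere for γ, and a multiple of g that comes from the non-integrability of ker θ.
omit hJ hJJ hIJ in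
theorem ver_curvature_vertical {p : N} (hp : pr p = 0) (a b : N) {C : V →L[ℝ] V}
    (hC : covEnd G pr I x p = C) (hCC : gam V C C = 1) (hIC : gam V (I x) C = 0) :
    gam V C (covEnd G pr I x (localCurvature H x p a b)) =
      gam V (covEnd G pr I x a) (covEnd G pr I x b) -
        gam V C (covEnd G pr I x a) * gam V C (covEnd G pr I x b) +
      c / 4 * G (pr x) (pr a) (pr b) := by
  have hm := h.maps x hx
  have hCm : C ∈ imQuat (J₁ (pr x)) (J₂ (pr x)) := hC ▸ h.theta_mem hx p
  have ht := h.adapted hx hCm hCC hIC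
  obtain ⟨-, -, gKK, -, gIK, gJK⟩ := ht.gam_frame h.base.finrank_pos
  have hs := h.base.metric.symm _ hm
  have ea := h.theta_eq hx hCm hCC hIC a
  have eb := h.theta_eq hx hCm hCC hIC b
  have gCI : gam V C (I x) = 0 := by rw [gam_comm, hIC]
  rw [h.gam_theta_theta hx hCm hCC hIC, h.ver_curvature hx, hp, hC]
  simp only [h.quatMoment_eq hx hCm hCC hIC]
  generalize gam V C (covEnd G pr I x a) = a₂ at *
  generalize gam V (I x * C) (covEnd G pr I x a) = a₃ at *
  generalize gam V C (covEnd G pr I x b) = b₂ at *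
  generalize gam V (I x * C) (covEnd G pr I x b) = b₃ at *
  rw [ea, eb]
  generalize hK : I x * C = K at *
  generalize pr a = X
  generalize pr b = Y
  generalize hg : G (pr x) = g at *
  generalize I x = I at *
  simp only [map_zero, zero_apply, zero_smul, add_zero, zero_add, sub_zero, zero_mul, mul_zero, smul_zero,
    mul_add, add_mul, smul_mul_assoc, mul_smul_comm, ht.II, ht.JJ,
    ht.IJ, ht.JI, ht.JK, ht.KJ, ht.KI, ht.IK, smul_neg]
  have g1J : gam V C 1 = 0 := by simp [gam, ht.trJ]
  have gC0 : gam V C 0 = 0 := by simp [gam]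
  have gKC : gam V K C = 0 := by rw [gam_comm, gJK]
  simp only [map_neg, ht.apply_KK, ht.apply_IJ, ht.apply_IK, gam_add_left, gam_smul_left,
    gam_add_right, gam_sub_right, gam_smul_right, gam_neg_right, gKK, hCC, gJK, gCI, g1J, gC0, gKC]
  ring

/-- The contributions of the horizontal space and of the two vertical lines add up. The coefficient
of g is (n + 1/2)c + 2·c/4 = (n + 1)c. That of γ is n + 2 − 1 = n + 1, which is (n + 1)c times c⁻¹.
-/
theorem localRicci_eq (a b : N) : localRicci H x a b = (n + 1) * c * H x a b := by
  have hm := h.maps x hx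
  have hc := h.pos.ne'
  have ht := h.adapted hx hJ hJJ hIJ
  obtain ⟨-, -, gKK, -, gIK, gJK⟩ := ht.gam_frame h.base.finrank_pos
  obtain ⟨ι, α, β, j, k, hid, hα, hβ, hι, hj, hj', hk, hk'⟩ := h.exists_splitting hx hJ hJJ hIJ
  rw [h.isMetricOn.localRicci_eq_trace hx, trace_eq_of_splitting (pr : N →ₗ[ℝ] V) ι α β j k hid,
    h.trace_hor hx hJ hJJ hIJ hι, hα, hβ]
  change _ + gam V J (covEnd G pr I x (localCurvature H x j a b)) +
    gam V (I x * J) (covEnd G pr I x (localCurvature H x k a b)) = _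
  rw [h.ver_curvature_vertical hx hj a b hj' hJJ hIJ,
    h.ver_curvature_vertical hx hk a b hk' gKK gIK, h.metric_eq x hx,
    h.gam_theta_theta hx hJ hJJ hIJ]
  field_simp
  ring

/-- The scalar curvature of the twistor metric. -/
theorem localScalarCurvature_eq :
    localScalarCurvature H x = c * (2 * n + 1) * (2 * n + 2) := by
  obtain ⟨ι, α, β, j, k, hid, hα, hβ, hι, hj, hj', hk, hk'⟩ := h.exists_splitting hx hJ hJJ hIJ
  obtain ⟨-, -, gKK, -, gIK, gJK⟩ := (h.adapted hx hJ hJJ hIJ).gam_frame h.base.finrank_pos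
  -- The trace of the identity of `N` is read off from the splitting as 4n + 1 + 1.
  have e : (pr : N →ₗ[ℝ] V) ∘ₗ (LinearMap.id : N →ₗ[ℝ] N) ∘ₗ ι = LinearMap.id := by
    ext X; exact (hι X).1
  rw [h.isMetricOn.localScalarCurvature_eq_trace hx (((n + 1) * c : ℝ) • LinearMap.id)
    (fun w z ↦ by rw [h.localRicci_eq hx hJ hJJ hIJ]; simp), map_smul,
    trace_eq_of_splitting (pr : N →ₗ[ℝ] V) ι α β j k hid, e, hα, hβ, LinearMap.trace_id,
    h.base.finrank_cast, LinearMap.id_apply, LinearMap.id_apply, hj', hk', hJJ, gKK, smul_eq_mul]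
  ring

end IsLocalTwistor
end TwistorScalar

theorem IsMetricOn.mono {V : Type*} [NormedAddCommGroup V] [NormedSpace ℝ V]
    {G : V → V →L[ℝ] V →L[ℝ] ℝ} {U U' : Set V} (hG : IsMetricOn G U) (hU' : IsOpen U')
    (h : U' ⊆ U) : IsMetricOn G U' :=
  ⟨hU', hG.smooth.mono h, fun x hx ↦ hG.symm x (h hx), fun x hx ↦ hG.pos x (h hx)⟩

/-! ### Changes of chart as local isometries. -/

section ChartTransition

variable {E : Type*} [NormedAddCommGroup E] [NormedSpace ℝ E]
  {M : Type*} [TopologicalSpace M] [ChartedSpace E M]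

/-- The transition map from the preferred chart at `p` to the preferred chart at `q`. -/
def chartTrans (p q : M) : E → E := extChartAt 𝓘(ℝ, E) q ∘ (extChartAt 𝓘(ℝ, E) p).symm

theorem chartTrans_apply (p q : M) (u : E) :
    chartTrans p q u = extChartAt 𝓘(ℝ, E) q ((extChartAt 𝓘(ℝ, E) p).symm u) := rfl

/-- The domain of the transition map `chartTrans p q`. -/
def transDomain (p q : M) : Set E :=
  (extChartAt 𝓘(ℝ, E) p).target ∩ (extChartAt 𝓘(ℝ, E) p).symm ⁻¹' (extChartAt 𝓘(ℝ, E) q).source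

theorem isOpen_transDomain (p q : M) : IsOpen (transDomain (E := E) p q) :=
  (continuousOn_extChartAt_symm (I := 𝓘(ℝ, E)) p).isOpen_inter_preimage
    (isOpen_extChartAt_target p) (isOpen_extChartAt_source q)

theorem mem_transDomain {p q r : M} (hp : r ∈ (extChartAt 𝓘(ℝ, E) p).source)
    (hq : r ∈ (extChartAt 𝓘(ℝ, E) q).source) : extChartAt 𝓘(ℝ, E) p r ∈ transDomain p q :=
  ⟨(extChartAt 𝓘(ℝ, E) p).map_source hp, by
    rwa [Set.mem_preimage, (extChartAt 𝓘(ℝ, E) p).left_inv hp]⟩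

theorem mem_transDomain_self {p : M} {u : E} (hu : u ∈ (extChartAt 𝓘(ℝ, E) p).target) :
    u ∈ transDomain p ((extChartAt 𝓘(ℝ, E) p).symm u) :=
  ⟨hu, mem_extChartAt_source _⟩

theorem chartTrans_comp {p q : M} (r : M) {u : E} (hu : u ∈ transDomain p q) :
    chartTrans q r (chartTrans p q u) = chartTrans p r u := by
  simp only [chartTrans_apply, (extChartAt 𝓘(ℝ, E) q).left_inv hu.2]

theorem chartTrans_mem {p q r : M} {u : E} (hq : u ∈ transDomain p q) (hr : u ∈ transDomain p r) :
    chartTrans p q u ∈ transDomain q r :=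
  mem_transDomain hq.2 hr.2

theorem chartTrans_self {p : M} {u : E} (hu : u ∈ (extChartAt 𝓘(ℝ, E) p).target) :
    chartTrans p p u = u := (extChartAt 𝓘(ℝ, E) p).right_inv hu

section

variable [IsManifold 𝓘(ℝ, E) ∞ M]

theorem contDiffOn_chartTrans (p q : M) :
    ContDiffOn ℝ ∞ (chartTrans (E := E) p q) (transDomain p q) := by
  rw [← contMDiffOn_iff_contDiffOn]
  refine ContMDiffOn.comp (t := (chartAt E q).source) contMDiffOn_extChartAt
    ((contMDiffOn_extChartAt_symm p).mono Set.inter_subset_left) ?_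
  intro u hu
  have := hu.2
  rwa [Set.mem_preimage, extChartAt_source] at this

theorem differentiableAt_chartTrans {p q : M} {u : E} (hu : u ∈ transDomain p q) :
    DifferentiableAt ℝ (chartTrans p q) u :=
  ((contDiffOn_chartTrans p q).contDiffAt ((isOpen_transDomain p q).mem_nhds hu)).differentiableAt
    (by simp)

theorem fderiv_chartTrans_comp {p q r : M} {u : E} (hq : u ∈ transDomain p q)
    (hr : u ∈ transDomain p r) (v : E) :
    fderiv ℝ (chartTrans q r) (chartTrans p q u) (fderiv ℝ (chartTrans p q) u v) =
      fderiv ℝ (chartTrans p r) u v := by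
  have h : chartTrans p r =ᶠ[nhds u] fun y ↦ chartTrans q r (chartTrans p q y) := by
    filter_upwards [(isOpen_transDomain p q).mem_nhds hq] with y hy
    exact (chartTrans_comp r hy).symm
  rw [h.fderiv_eq]
  have := fderiv_fun_comp (𝕜 := ℝ) u (differentiableAt_chartTrans (chartTrans_mem hq hr))
    (differentiableAt_chartTrans hq)
  rw [this]; rfl

theorem fderiv_chartTrans_self {p : M} {u : E} (hu : u ∈ (extChartAt 𝓘(ℝ, E) p).target) (v : E) :
    fderiv ℝ (chartTrans p p) u v = v := by
  have h : chartTrans p p =ᶠ[nhds u] fun y ↦ y := by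
    filter_upwards [(isOpen_extChartAt_target p).mem_nhds hu] with y hy
    exact chartTrans_self hy
  rw [h.fderiv_eq]; simp

theorem mfderiv_extChartAt_symm {p : M} {u : E} (hu : u ∈ (extChartAt 𝓘(ℝ, E) p).target) :
    mfderiv 𝓘(ℝ, E) 𝓘(ℝ, E) (extChartAt 𝓘(ℝ, E) p).symm u =
      fderiv ℝ (chartTrans p ((extChartAt 𝓘(ℝ, E) p).symm u)) u := by
  have h : MDifferentiableAt 𝓘(ℝ, E) 𝓘(ℝ, E) (extChartAt 𝓘(ℝ, E) p).symm u :=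
    ((contMDiffOn_extChartAt_symm (n := ∞) p).contMDiffAt
      ((isOpen_extChartAt_target p).mem_nhds hu)).mdifferentiableAt (by simp)
  rw [h.mfderiv]
  simp only [modelWithCornersSelf_coe, Set.range_id, fderivWithin_univ]
  rfl

theorem mfderiv_extChartAt {p q : M} (hq : q ∈ (extChartAt 𝓘(ℝ, E) p).source) :
    mfderiv 𝓘(ℝ, E) 𝓘(ℝ, E) (extChartAt 𝓘(ℝ, E) p) q =
      fderiv ℝ (chartTrans q p) (extChartAt 𝓘(ℝ, E) q q) := by
  have h : MDifferentiableAt 𝓘(ℝ, E) 𝓘(ℝ, E) (extChartAt 𝓘(ℝ, E) p) q :=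
    mdifferentiableAt_extChartAt (by rwa [extChartAt_source] at hq)
  rw [h.mfderiv]
  simp only [modelWithCornersSelf_coe, Set.range_id, fderivWithin_univ]
  rfl

/-- The tangent space at q is identified with the model through the preferred chart at q, not at p;
this is why the differential of the transition map enters. -/
theorem coordMetric_apply
    (g : ∀ p : M, TangentSpace 𝓘(ℝ, E) p →L[ℝ] TangentSpace 𝓘(ℝ, E) p →L[ℝ] ℝ) {p q : M} {u : E}
    (hu : u ∈ (extChartAt 𝓘(ℝ, E) p).target) (hq : (extChartAt 𝓘(ℝ, E) p).symm u = q) (v w : E) :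
    coordMetric g p u v w = (g q : E →L[ℝ] E →L[ℝ] ℝ)
      (fderiv ℝ (chartTrans p q) u v) (fderiv ℝ (chartTrans p q) u w) := by
  subst hq
  rw [← mfderiv_extChartAt_symm hu]
  rfl

theorem coordMetric_self
    (g : ∀ p : M, TangentSpace 𝓘(ℝ, E) p →L[ℝ] TangentSpace 𝓘(ℝ, E) p →L[ℝ] ℝ) (p : M) (v w : E) :
    coordMetric g p (extChartAt 𝓘(ℝ, E) p p) v w = (g p : E →L[ℝ] E →L[ℝ] ℝ) v w := by
  have hu := mem_extChartAt_target (I := 𝓘(ℝ, E)) p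
  refine (coordMetric_apply g hu (extChartAt_to_inv p) v w).trans ?_
  rw [fderiv_chartTrans_self hu, fderiv_chartTrans_self hu]

theorem coordMetric_chartTrans
    (g : ∀ p : M, TangentSpace 𝓘(ℝ, E) p →L[ℝ] TangentSpace 𝓘(ℝ, E) p →L[ℝ] ℝ) {p q : M} {u : E}
    (hu : u ∈ transDomain p q) (v w : E) :
    coordMetric g p u v w = coordMetric g q (chartTrans p q u)
      (fderiv ℝ (chartTrans p q) u v) (fderiv ℝ (chartTrans p q) u w) := by
  have e : (extChartAt 𝓘(ℝ, E) q).symm (chartTrans p q u) = (extChartAt 𝓘(ℝ, E) p).symm u :=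
    (extChartAt 𝓘(ℝ, E) q).left_inv hu.2
  refine (coordMetric_apply g hu.1 rfl v w).trans
    (Eq.trans ?_ (coordMetric_apply g ((extChartAt 𝓘(ℝ, E) q).map_source hu.2) e _ _).symm)
  have h := fderiv_chartTrans_comp hu (mem_transDomain_self hu.1)
  exact congrArg₂ (fun a b ↦ (g ((extChartAt 𝓘(ℝ, E) p).symm u) : E →L[ℝ] E →L[ℝ] ℝ) a b)
    (h v).symm (h w).symm

theorem fderiv_chartTrans_injective {p q : M} {u : E} (hu : u ∈ transDomain p q) {v : E}
    (h : fderiv ℝ (chartTrans p q) u v = 0) : v = 0 := by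
  have := fderiv_chartTrans_comp hu (r := p) ⟨hu.1, (extChartAt 𝓘(ℝ, E) p).map_target hu.1⟩ v
  rw [h, map_zero, fderiv_chartTrans_self hu.1] at this
  exact this.symm

variable (g : Bundle.ContMDiffRiemannianMetric 𝓘(ℝ, E) ∞ E (fun p : M ↦ TangentSpace 𝓘(ℝ, E) p))

/-- Coordinate vector fields are smooth sections of the tangent bundle. The smoothness of `g` is
given in bundle terms, so this is what makes its coordinate expression smooth. -/
theorem contMDiffOn_mfderiv_extChartAt_symm (p : M) (v : E) :
    ContMDiffOn 𝓘(ℝ, E) (𝓘(ℝ, E).prod 𝓘(ℝ, E)) ∞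
      (fun u ↦ Bundle.TotalSpace.mk' E (E := fun q : M ↦ TangentSpace 𝓘(ℝ, E) q)
        ((extChartAt 𝓘(ℝ, E) p).symm u)
        (mfderiv 𝓘(ℝ, E) 𝓘(ℝ, E) (extChartAt 𝓘(ℝ, E) p).symm u v))
      (extChartAt 𝓘(ℝ, E) p).target := by
  have hU := isOpen_extChartAt_target (I := 𝓘(ℝ, E)) p
  have h1 := (contMDiffOn_extChartAt_symm (I := 𝓘(ℝ, E)) (n := ∞) p).contMDiffOn_tangentMapWithin
    (m := ∞) (by simp) hU.uniqueMDiffOn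
  have h2 : ContMDiff 𝓘(ℝ, E) (𝓘(ℝ, E).prod 𝓘(ℝ, E)) ∞
      (fun u : E ↦ Bundle.TotalSpace.mk' E (E := fun q : E ↦ TangentSpace 𝓘(ℝ, E) q) u v) :=
    contMDiff_vectorSpace_iff_contDiff.2 contDiff_const
  have h3 := h1.comp h2.contMDiffOn (s := (extChartAt 𝓘(ℝ, E) p).target) (fun u hu ↦ hu)
  refine h3.congr fun u hu ↦ ?_
  simp only [Function.comp_apply, tangentMapWithin]
  rw [mfderivWithin_of_isOpen hU hu]

theorem contDiffOn_coordMetric [FiniteDimensional ℝ E] (p : M) :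
    ContDiffOn ℝ ∞ (coordMetric g.inner p) (extChartAt 𝓘(ℝ, E) p).target := by
  rw [contDiffOn_clm_apply]
  intro v
  rw [contDiffOn_clm_apply]
  intro w
  rw [← contMDiffOn_iff_contDiffOn]
  intro u hu
  have hb := (contMDiffOn_extChartAt_symm (I := 𝓘(ℝ, E)) (n := ∞) p) u hu
  have : ContMDiffWithinAt 𝓘(ℝ, E) (𝓘(ℝ, E).prod 𝓘(ℝ)) ∞
      (fun u ↦ Bundle.TotalSpace.mk' ℝ (E := Bundle.Trivial M ℝ) ((extChartAt 𝓘(ℝ, E) p).symm u)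
        (g.inner ((extChartAt 𝓘(ℝ, E) p).symm u)
          (mfderiv 𝓘(ℝ, E) 𝓘(ℝ, E) (extChartAt 𝓘(ℝ, E) p).symm u v)
          (mfderiv 𝓘(ℝ, E) 𝓘(ℝ, E) (extChartAt 𝓘(ℝ, E) p).symm u w)))
      (extChartAt 𝓘(ℝ, E) p).target u := by
    apply ContMDiffWithinAt.clm_bundle_apply₂ (F₁ := E) (F₂ := E)
    · exact ContMDiffAt.comp_contMDiffWithinAt u g.contMDiff.contMDiffAt hb
    · exact contMDiffOn_mfderiv_extChartAt_symm p v u hu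
    · exact contMDiffOn_mfderiv_extChartAt_symm p w u hu
  simp only [Bundle.contMDiffWithinAt_totalSpace] at this
  exact this.2

theorem isMetricOn_coordMetric [FiniteDimensional ℝ E] (p : M) :
    IsMetricOn (coordMetric g.inner p) (extChartAt 𝓘(ℝ, E) p).target where
  isOpen := isOpen_extChartAt_target p
  smooth := contDiffOn_coordMetric g p
  symm _ _ _ _ := by exact g.symm _ _ _
  pos u hu v hv := by
    refine lt_of_lt_of_eq ?_ (coordMetric_apply g.inner hu rfl v v).symm
    exact g.pos _ _ fun h ↦ hv (fderiv_chartTrans_injective (mem_transDomain_self hu) h)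

theorem isIsometryOn_chartTrans [FiniteDimensional ℝ E] (p q : M) :
    IsIsometryOn (chartTrans p q) (coordMetric g.inner p) (coordMetric g.inner q)
      (transDomain p q) (transDomain q p) where
  left := (isMetricOn_coordMetric g p).mono (isOpen_transDomain p q) Set.inter_subset_left
  right := (isMetricOn_coordMetric g q).mono (isOpen_transDomain q p) Set.inter_subset_left
  mapsTo _ hu := mem_transDomain hu.2 ((extChartAt 𝓘(ℝ, E) p).map_target hu.1)
  smooth := contDiffOn_chartTrans p q
  inner _ hu := coordMetric_chartTrans g.inner hu

/-- The scalar curvature at each point is defined in the chart preferred there. Transition maps are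
isometries, so the chart at p computes it at all points of its domain. -/
theorem scalarCurvature_eq [FiniteDimensional ℝ E] {p : M} {u : E}
    (hu : u ∈ (extChartAt 𝓘(ℝ, E) p).target) :
    scalarCurvature g.inner ((extChartAt 𝓘(ℝ, E) p).symm u) =
      localScalarCurvature (coordMetric g.inner p) u :=
  ((isIsometryOn_chartTrans g p _).localScalarCurvature_eq (mem_transDomain_self hu)).symm

end

end ChartTransition

/-- Naturality of the covariant derivative along a map. The second derivatives of τ that arise on
differentiating A' dτ = dτ A cancel against those in the transformation law `map_christoffel`. -/
theorem IsIsometryOn.covEnd_map {V N N' : Type*} [NormedAddCommGroup V] [NormedSpace ℝ V]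
    [FiniteDimensional ℝ V] [NormedAddCommGroup N] [NormedSpace ℝ N] [NormedAddCommGroup N'] [NormedSpace ℝ N']
    {G G' : V → V →L[ℝ] V →L[ℝ] ℝ} {U U' : Set V} {τ : V → V} (h : IsIsometryOn τ G G' U U')
    {pr : N →L[ℝ] V} {pr' : N' →L[ℝ] V} {θ : N → N'} {A : N → V →L[ℝ] V} {A' : N' → V →L[ℝ] V}
    {x : N} (hx : pr x ∈ U) (hθ : DifferentiableAt ℝ θ x) (hA : DifferentiableAt ℝ A x)
    (hA' : DifferentiableAt ℝ A' (θ x))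
    (hpr : (fun y ↦ pr' (θ y)) =ᶠ[nhds x] fun y ↦ τ (pr y))
    (hAA : ∀ᶠ y in nhds x, ∀ v, A' (θ y) (fderiv ℝ τ (pr y) v) = fderiv ℝ τ (pr y) (A y v))
    (a : N) (v : V) :
    covEnd G' pr' A' (θ x) (fderiv ℝ θ x a) (fderiv ℝ τ (pr x) v) =
      fderiv ℝ τ (pr x) (covEnd G pr A x a v) := by
  have hτ := h.differentiableAt hx
  have hD : ∀ w, DifferentiableAt ℝ (fun u ↦ fderiv ℝ τ u w) (pr x) := fun w ↦
    (h.contDiffAt_fderiv_apply hx w).differentiableAt (by simp)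
  have hD' : DifferentiableAt ℝ (fderiv ℝ τ) (pr x) := differentiableAt_fderiv (h.contDiffAt hx)
  have hDp : DifferentiableAt ℝ (fun y ↦ fderiv ℝ τ (pr y)) x :=
    hD'.comp x pr.differentiableAt
  have e0 : pr' (θ x) = τ (pr x) := hpr.eq_of_nhds
  have e1 : pr' (fderiv ℝ θ x a) = fderiv ℝ τ (pr x) (pr a) := by
    have := hpr.fderiv_eq (𝕜 := ℝ)
    rw [fderiv_fun_comp (𝕜 := ℝ) x pr'.differentiableAt hθ, fderiv_fun_comp (𝕜 := ℝ) x hτ pr.differentiableAt] at this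
    simpa using congrArg (fun T ↦ T a) this
  have e2 : ∀ w, fderiv ℝ (fun y ↦ fderiv ℝ τ (pr y) w) x a =
      fderiv ℝ (fun u ↦ fderiv ℝ τ u w) (pr x) (pr a) := by
    intro w
    rw [fderiv_fun_comp (𝕜 := ℝ) (g := fun u ↦ fderiv ℝ τ u w) x (hD w) pr.differentiableAt]
    simp
  -- This is the relation A' dτ = dτ A, differentiated in the direction a.
  have e3 : fderiv ℝ A' (θ x) (fderiv ℝ θ x a) (fderiv ℝ τ (pr x) v) +
      A' (θ x) (fderiv ℝ (fun u ↦ fderiv ℝ τ u v) (pr x) (pr a)) =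
      fderiv ℝ (fun u ↦ fderiv ℝ τ u (A x v)) (pr x) (pr a) + fderiv ℝ τ (pr x) (fderiv ℝ A x a v) := by
    have hv : (fun y ↦ A' (θ y) (fderiv ℝ τ (pr y) v)) =ᶠ[nhds x]
        fun y ↦ fderiv ℝ τ (pr y) (A y v) := hAA.mono fun y hy ↦ hy v
    have := congrArg (fun T ↦ T a) (hv.fderiv_eq (𝕜 := ℝ))
    have hAv : DifferentiableAt ℝ (fun y ↦ A y v) x := hA.clm_apply (differentiableAt_const v)
    have hDv : DifferentiableAt ℝ (fun y ↦ fderiv ℝ τ (pr y) v) x := hDp.clm_apply (differentiableAt_const v)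
    have hc : DifferentiableAt ℝ (fun y ↦ A' (θ y)) x := hA'.comp x hθ
    have c1 := (hc.hasFDerivAt.clm_apply hDv.hasFDerivAt).fderiv
    have c2 := (hDp.hasFDerivAt.clm_apply hAv.hasFDerivAt).fderiv
    have c3 : fderiv ℝ (fun y ↦ A y v) x a = fderiv ℝ A x a v := by
      rw [(hA.hasFDerivAt.clm_apply (hasFDerivAt_const v x)).fderiv]; simp
    have c4 : fderiv ℝ (fun y ↦ fderiv ℝ τ (pr y)) x a (A x v) =
        fderiv ℝ (fun y ↦ fderiv ℝ τ (pr y) (A x v)) x a := by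
      rw [(hDp.hasFDerivAt.clm_apply (hasFDerivAt_const (A x v) x)).fderiv]; simp
    have c5 : fderiv ℝ (fun y ↦ A' (θ y)) x a = fderiv ℝ A' (θ x) (fderiv ℝ θ x a) := by
      rw [fderiv_fun_comp (𝕜 := ℝ) x hA' hθ]; rfl
    rw [c1, c2] at this
    simp only [add_apply, ContinuousLinearMap.comp_apply, ContinuousLinearMap.flip_apply, c3, c4, c5, e2] at this
    rw [add_comm, this, add_comm]
  have e4 : ∀ w, christoffel G' (τ (pr x)) (fderiv ℝ τ (pr x) (pr a)) (fderiv ℝ τ (pr x) w) =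
      fderiv ℝ τ (pr x) (christoffel G (pr x) (pr a) w) -
        fderiv ℝ (fun u ↦ fderiv ℝ τ u w) (pr x) (pr a) := fun w ↦ by
    rw [h.map_christoffel hx]; abel
  have e5 := hAA.self_of_nhds
  simp only [covEnd, sub_apply, add_apply, mul_apply_eq_comp, e0, e1, e5, e4, map_add, map_sub]
  rw [eq_sub_of_add_eq e3]
  abel

/-! ### Fields of endomorphisms in charts. -/

section ManifoldCoordinates

variable {E : Type*} [NormedAddCommGroup E] [NormedSpace ℝ E]
  {M : Type*} [TopologicalSpace M] [ChartedSpace E M] [IsManifold 𝓘(ℝ, E) ∞ M]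

theorem endCoord_apply {p q : M} (hq : q ∈ (extChartAt 𝓘(ℝ, E) p).source) (A : EndT E q) (v : E) :
    endCoord p q A v = fderiv ℝ (chartTrans q p) (extChartAt 𝓘(ℝ, E) q q)
      ((A : E →L[ℝ] E) (fderiv ℝ (chartTrans p q) (extChartAt 𝓘(ℝ, E) p q) v)) := by
  have hq' : q ∈ (chartAt E p).source := by rwa [extChartAt_source] at hq
  have h1 := TangentBundle.continuousLinearMapAt_trivializationAt (I := 𝓘(ℝ, E)) hq'
  have h2 := TangentBundle.symmL_trivializationAt (I := 𝓘(ℝ, E)) hq'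
  have h3 : mfderiv 𝓘(ℝ, E) 𝓘(ℝ, E) (extChartAt 𝓘(ℝ, E) p).symm (extChartAt 𝓘(ℝ, E) p q) =
      (fderiv ℝ (chartTrans p q) (extChartAt 𝓘(ℝ, E) p q) : E →L[ℝ] E) := by
    refine (mfderiv_extChartAt_symm ((extChartAt 𝓘(ℝ, E) p).map_source hq)).trans ?_
    rw [(extChartAt 𝓘(ℝ, E) p).left_inv hq]
  simp only [modelWithCornersSelf_coe, Set.range_id, mfderivWithin_univ] at h2
  simp only [endCoord, ContinuousLinearMap.inCoordinates]
  rw [h1, h2]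
  exact congrArg₂ (fun (S T : E →L[ℝ] E) ↦ S ((A : E →L[ℝ] E) (T v))) (mfderiv_extChartAt hq) h3

theorem endCoord_chartTrans {p q r : M} (hp : r ∈ (extChartAt 𝓘(ℝ, E) p).source)
    (hq : r ∈ (extChartAt 𝓘(ℝ, E) q).source) (A : EndT E r) (v : E) :
    endCoord q r A (fderiv ℝ (chartTrans p q) (extChartAt 𝓘(ℝ, E) p r) v) =
      fderiv ℝ (chartTrans p q) (extChartAt 𝓘(ℝ, E) p r) (endCoord p r A v) := by
  have hr := mem_extChartAt_source (I := 𝓘(ℝ, E)) r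
  have e : ∀ s t : M, r ∈ (extChartAt 𝓘(ℝ, E) s).source →
      chartTrans s t (extChartAt 𝓘(ℝ, E) s r) = extChartAt 𝓘(ℝ, E) t r := fun s t hs ↦ by
    rw [chartTrans_apply, (extChartAt 𝓘(ℝ, E) s).left_inv hs]
  rw [endCoord_apply hp, endCoord_apply hq]
  have h1 := fderiv_chartTrans_comp (mem_transDomain hp hq) (mem_transDomain hp hr) v
  have h2 := fderiv_chartTrans_comp (mem_transDomain hr hp) (mem_transDomain hr hq)
    ((A : E →L[ℝ] E) (fderiv ℝ (chartTrans p r) (extChartAt 𝓘(ℝ, E) p r) v))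
  rw [e p q hp] at h1
  rw [e r p hr] at h2
  rw [h1, h2]

end ManifoldCoordinates

section SectionCoordinates

variable {E : Type*} [NormedAddCommGroup E] [NormedSpace ℝ E]
  {M : Type*} [TopologicalSpace M] [ChartedSpace E M] [IsManifold 𝓘(ℝ, E) ∞ M]

/-- A field of endomorphisms of the tangent spaces, in the preferred chart at `p`. -/
def sectionCoord (p : M) (σ : ∀ q : M, EndT E q) (u : E) : E →L[ℝ] E :=
  endCoord p ((extChartAt 𝓘(ℝ, E) p).symm u) (σ ((extChartAt 𝓘(ℝ, E) p).symm u))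

/-- Smoothness of a field of endomorphisms at a point. -/
abbrev SmoothEndAt (σ : ∀ q : M, EndT E q) (q : M) : Prop :=
  ContMDiffAt 𝓘(ℝ, E) (𝓘(ℝ, E).prod 𝓘(ℝ, E →L[ℝ] E)) ∞
      (fun q ↦ Bundle.TotalSpace.mk' (E →L[ℝ] E) (E := fun q : M ↦ EndT E q) q (σ q)) q

variable {p : M} {σ : ∀ q : M, EndT E q} {u : E}

theorem contMDiffAt_endCoord {q : M} (hq : q ∈ (extChartAt 𝓘(ℝ, E) p).source)
    (hσ : SmoothEndAt σ q) :
    ContMDiffAt 𝓘(ℝ, E) 𝓘(ℝ, E →L[ℝ] E) ∞ (fun r ↦ endCoord p r (σ r)) q := by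
  have hq' : q ∈ (chartAt E p).source := by rwa [extChartAt_source] at hq
  exact (Bundle.Trivialization.contMDiffAt_section_iff
    (trivializationAt (E →L[ℝ] E) (fun q : M ↦ EndT E q) p) ⟨hq', hq'⟩).1 hσ

theorem contDiffAt_sectionCoord (hu : u ∈ (extChartAt 𝓘(ℝ, E) p).target)
    (hσ : SmoothEndAt σ ((extChartAt 𝓘(ℝ, E) p).symm u)) :
    ContDiffAt ℝ ∞ (sectionCoord p σ) u := by
  rw [← contMDiffAt_iff_contDiffAt]
  exact (contMDiffAt_endCoord ((extChartAt 𝓘(ℝ, E) p).map_target hu) hσ).comp u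
    ((contMDiffOn_extChartAt_symm p).contMDiffAt ((isOpen_extChartAt_target p).mem_nhds hu))

theorem sectionCoord_chartTrans {q : M} (hu : u ∈ transDomain p q) (v : E) :
    sectionCoord q σ (chartTrans p q u) (fderiv ℝ (chartTrans p q) u v) =
      fderiv ℝ (chartTrans p q) u (sectionCoord p σ u v) := by
  have h := endCoord_chartTrans ((extChartAt 𝓘(ℝ, E) p).map_target hu.1) hu.2
    (σ ((extChartAt 𝓘(ℝ, E) p).symm u)) v
  rw [(extChartAt 𝓘(ℝ, E) p).right_inv hu.1] at h
  have e : (extChartAt 𝓘(ℝ, E) q).symm (chartTrans p q u) = (extChartAt 𝓘(ℝ, E) p).symm u :=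
    (extChartAt 𝓘(ℝ, E) q).left_inv hu.2
  rw [sectionCoord, e, h, sectionCoord]

theorem sectionCoord_self (p : M) (σ : ∀ q : M, EndT E q) :
    sectionCoord p σ (extChartAt 𝓘(ℝ, E) p p) = σ p :=
  endCoord_of_eq (extChartAt_to_inv p) σ

theorem covDerivSection_eq
    (g : ∀ p : M, TangentSpace 𝓘(ℝ, E) p →L[ℝ] TangentSpace 𝓘(ℝ, E) p →L[ℝ] ℝ)
    (hσ : SmoothEndAt σ p) (v : E) :
    covDerivSection g σ p v = covEnd (coordMetric g p) (ContinuousLinearMap.id ℝ E)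
      (sectionCoord p σ) (extChartAt 𝓘(ℝ, E) p p) v := by
  have h1 := contMDiffAt_endCoord (mem_extChartAt_source p) hσ
  have h2 : mfderiv 𝓘(ℝ, E) 𝓘(ℝ, E →L[ℝ] E) (fun q ↦ endCoord p q (σ q)) p =
      (fderiv ℝ (sectionCoord p σ) (extChartAt 𝓘(ℝ, E) p p) : E →L[ℝ] (E →L[ℝ] E)) := by
    have h3 : MDifferentiableAt 𝓘(ℝ, E) 𝓘(ℝ, E →L[ℝ] E)
      (fun q ↦ endCoord p q (σ q)) p := h1.mdifferentiableAt (by simp)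
    rw [h3.mfderiv]
    simp only [modelWithCornersSelf_coe, Set.range_id, fderivWithin_univ]
    rfl
  have h4 : mfderiv 𝓘(ℝ, E) 𝓘(ℝ, E) (id : M → M) p = ContinuousLinearMap.id ℝ E := mfderiv_id
  unfold covDerivSection covDerivEnd
  change covDerivCoord (V := E) (V' := E) _ _ (mfderiv 𝓘(ℝ, E) 𝓘(ℝ, E) (id : M → M) p)
    (mfderiv 𝓘(ℝ, E) 𝓘(ℝ, E →L[ℝ] E) (fun q ↦ endCoord p q (σ q)) p) _ _ = _
  rw [h2, h4, covEnd, sectionCoord_self]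
  rfl

variable (g : Bundle.ContMDiffRiemannianMetric 𝓘(ℝ, E) ∞ E (fun p : M ↦ TangentSpace 𝓘(ℝ, E) p))

/-- The covariant derivative at q is defined in the chart at q, while the left side stays in the
chart at p; `covEnd_map` along the transition map compares the two. -/
theorem covEnd_sectionCoord [FiniteDimensional ℝ E] (hu : u ∈ (extChartAt 𝓘(ℝ, E) p).target)
    (hσ : SmoothEndAt σ ((extChartAt 𝓘(ℝ, E) p).symm u)) (v : E) :
    covEnd (coordMetric g.inner p) (ContinuousLinearMap.id ℝ E) (sectionCoord p σ) u v =
      endCoord p ((extChartAt 𝓘(ℝ, E) p).symm u)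
        (covDerivSection g.inner σ ((extChartAt 𝓘(ℝ, E) p).symm u)
          (fderiv ℝ (chartTrans p ((extChartAt 𝓘(ℝ, E) p).symm u)) u v : E)) := by
  set q := (extChartAt 𝓘(ℝ, E) p).symm u with hq
  have hu' : u ∈ transDomain p q := mem_transDomain_self hu
  ext w
  rw [← sub_eq_zero]
  refine fderiv_chartTrans_injective hu' ?_
  rw [map_sub, sub_eq_zero]
  have hτu : chartTrans p q u = extChartAt 𝓘(ℝ, E) q q := rfl
  have hqq := mem_extChartAt_target (I := 𝓘(ℝ, E)) q
  have h1 := (isIsometryOn_chartTrans g p q).covEnd_map (pr := ContinuousLinearMap.id ℝ E)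
    (pr' := ContinuousLinearMap.id ℝ E) (θ := chartTrans p q) (A := sectionCoord p σ)
    (A' := sectionCoord q σ) (x := u) hu' (differentiableAt_chartTrans hu')
    ((contDiffAt_sectionCoord hu hσ).differentiableAt (by simp))
    ((contDiffAt_sectionCoord (p := q) (u := chartTrans p q u) hqq
      (by rw [hτu, extChartAt_to_inv]; exact hσ)).differentiableAt (by simp))
    Filter.EventuallyEq.rfl
    (by
      filter_upwards [(isOpen_transDomain p q).mem_nhds hu'] with y hy v
      exact sectionCoord_chartTrans hy v) v w
  have h2 := endCoord_chartTrans (E := E) (p := p) (q := q) (r := q)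
    ((extChartAt 𝓘(ℝ, E) p).map_target hu) (mem_extChartAt_source q)
    (covDerivSection g.inner σ q (fderiv ℝ (chartTrans p q) u v : E)) w
  rw [endCoord_self, (extChartAt 𝓘(ℝ, E) p).right_inv hu] at h2
  refine h1.symm.trans (Eq.trans ?_ h2)
  exact congrArg (fun T : E →L[ℝ] E ↦ T (fderiv ℝ (chartTrans p q) u w))
    (covDerivSection_eq g.inner hσ _).symm

end SectionCoordinates

/-- Such a q has norm one, so its conjugate is its inverse, which is −q. This turns the
compatibility of `Q` with `g` into the skewness of the almost complex structures. -/
theorem quaternion_star_eq_neg {q : ℍ[ℝ]} (hq : q * q = -1) : star q = -q := by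
  have h1 : Quaternion.normSq q = 1 := by
    have h := congrArg Quaternion.normSq hq
    rw [map_mul, Quaternion.normSq_neg, map_one] at h
    nlinarith [Quaternion.normSq_nonneg (a := q)]
  have h0 : q ≠ 0 := by rintro rfl; simp at hq
  have h2 : q * star q = 1 := by rw [Quaternion.self_mul_star, h1]; simp
  exact mul_left_cancel₀ h0 (by rw [h2, mul_neg, hq, neg_neg])

/-! ### The quaternion-Kähler structure in a chart. -/

section FrameCoordinates

variable {E : Type*} [NormedAddCommGroup E] [NormedSpace ℝ E]
  {M : Type*} [TopologicalSpace M] [ChartedSpace E M] [IsManifold 𝓘(ℝ, E) ∞ M]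

theorem endCoord_add {p q : M} (A B : EndT E q) :
    endCoord p q (A + B) = endCoord p q A + endCoord p q B := by
  ext v; simp [endCoord, ContinuousLinearMap.inCoordinates]

theorem endCoord_neg {p q : M} (A : EndT E q) : endCoord p q (-A) = -endCoord p q A := by
  ext v; simp [endCoord, ContinuousLinearMap.inCoordinates]

theorem endCoord_smul {p q : M} (c : ℝ) (A : EndT E q) :
    endCoord p q (c • A) = c • endCoord p q A := by
  ext v; simp [endCoord, ContinuousLinearMap.inCoordinates]

variable {n : ℕ}
    {g : Bundle.ContMDiffRiemannianMetric 𝓘(ℝ, E) ∞ E (fun p : M ↦ TangentSpace 𝓘(ℝ, E) p)}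

theorem QuaternionKahlerStructure.skew (S : QuaternionKahlerStructure n g) {q : M} {A : EndT E q}
    (hA : A ∈ S.Q q) (hAA : A * A = -1) (X Y : TangentSpace 𝓘(ℝ, E) q) :
    g.inner q (A X) Y = -g.inner q X (A Y) := by
  obtain ⟨φ, hφ⟩ := S.quaternionic q
  have h1 : (⟨A, hA⟩ : S.Q q) * ⟨A, hA⟩ = -1 := Subtype.ext hAA
  have h2 := quaternion_star_eq_neg (q := φ ⟨A, hA⟩) (by rw [← map_mul, h1, map_neg, map_one])
  have h3 := hφ ⟨A, hA⟩ X Y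
  rw [h2, map_neg, φ.symm_apply_apply] at h3
  refine h3.trans ?_
  change g.inner q X (-(A Y)) = _
  exact map_neg _ _

theorem endCoord_skew {p q : M} (hq : q ∈ (extChartAt 𝓘(ℝ, E) p).source) {A : EndT E q}
    (hA : ∀ X Y : TangentSpace 𝓘(ℝ, E) q, g.inner q (A X) Y = -g.inner q X (A Y)) (v w : E) :
    coordMetric g.inner p (extChartAt 𝓘(ℝ, E) p q) (endCoord p q A v) w =
      -coordMetric g.inner p (extChartAt 𝓘(ℝ, E) p q) v (endCoord p q A w) := by
  have hu := (extChartAt 𝓘(ℝ, E) p).map_source hq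
  have e := (extChartAt 𝓘(ℝ, E) p).left_inv hq
  have h := fun v ↦ endCoord_chartTrans hq (mem_extChartAt_source q) A v
  rw [endCoord_self] at h
  refine (coordMetric_apply g.inner hu e _ _).trans
    (Eq.trans ?_ (congrArg Neg.neg (coordMetric_apply g.inner hu e _ _).symm))
  rw [← h, ← h]
  exact hA _ _

variable [FiniteDimensional ℝ E]

section

variable {Q : ∀ p : M, Subalgebra ℝ (EndT E p)} {U : Set M} {e : Fin 3 → ∀ q : M, EndT E q}

/-- A local frame need not satisfy e₂ = e₀e₁. But e₀e₁ squares to −1 and is orthogonal to e₀ and e₁,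
so it equals c e₂ with c² = 1. -/
theorem IsLocalFrame.exists_mul_eq (he : IsLocalFrame Q U e) (hE : 0 < Module.finrank ℝ E) {q : M}
    (hq : q ∈ U) : ∃ c : ℝ, e 2 q = c • (e 0 q * e 1 q) := by
  have hsq : e 0 q * e 1 q * (e 0 q * e 1 q) = -1 := by
    rw [mul_assoc, ← mul_assoc (e 1 q), he.anticomm q hq 1 0 (by decide), neg_mul, mul_neg,
      mul_assoc (e 0 q), he.sq q hq, ← mul_assoc, he.sq q hq]
    simp
  obtain ⟨h1, h2⟩ := he.eq_comb hE hq (mul_mem (he.mem q hq 0) (he.mem q hq 1)) hsq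
  have c0 : coordEnd (e 0 q) (e 0 q * e 1 q) = 0 := by
    rw [coordEnd, ← mul_assoc, he.sq q hq, neg_one_mul, map_neg, he.tr_eq_zero hq]; simp
  have c1 : coordEnd (e 1 q) (e 0 q * e 1 q) = 0 := by
    rw [coordEnd, trEnd_mul_comm, mul_assoc, he.sq q hq, mul_neg, mul_one, map_neg,
      he.tr_eq_zero hq]; simp
  rw [Fin.sum_univ_three, c0, c1, zero_smul, zero_smul, zero_add, zero_add] at h1
  rw [Fin.sum_univ_three, c0, c1] at h2
  refine ⟨coordEnd (e 2 q) (e 0 q * e 1 q), ?_⟩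
  generalize coordEnd (e 2 q) (e 0 q * e 1 q) = c at h1 h2
  have h3 : c * c = 1 := by linarith
  rw [h1, smul_smul, h3, one_smul]

theorem IsLocalFrame.endCoord_mem_imQuat (he : IsLocalFrame Q U e) (hE : 0 < Module.finrank ℝ E)
    (p : M) {q : M} (hp : q ∈ (extChartAt 𝓘(ℝ, E) p).source) (hq : q ∈ U) {A : EndT E q}
    (hA : A ∈ Q q) (htr : trL E (endCoord p q A) = 0) :
    endCoord p q A ∈ imQuat (endCoord p q (e 0 q)) (endCoord p q (e 1 q)) := by
  have hp' : q ∈ (chartAt E p).source := by rwa [extChartAt_source] at hp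
  obtain ⟨a, s, h⟩ := he.span q hq A hA
  have hE' : (Module.finrank ℝ E : ℝ) ≠ 0 := by positivity
  have ha : a = 0 := by
    have h1 : trEnd A = 0 := (trEnd_eq_endCoord hp' A).trans htr
    rw [h, map_add, map_smul, trEnd_one, map_sum, Finset.sum_eq_zero, add_zero] at h1
    · exact (mul_eq_zero.1 h1).resolve_right hE'
    · intro i _; rw [map_smul, he.tr_eq_zero hq, smul_zero]
  obtain ⟨c, hc⟩ := he.exists_mul_eq hE hq
  rw [ha, zero_smul, zero_add, Fin.sum_univ_three, hc] at h
  rw [h, mem_imQuat]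
  refine ⟨s 0, s 1, s 2 * c, ?_⟩
  rw [endCoord_add, endCoord_add, endCoord_smul, endCoord_smul, endCoord_smul, endCoord_smul,
    endCoord_mul hp', smul_smul]

end

theorem QuaternionKahlerStructure.isLocalQK (S : QuaternionKahlerStructure n g) {U : Set M}
    {e : Fin 3 → ∀ q : M, EndT E q} (he : IsLocalFrame S.Q U e) (p : M) :
    IsLocalQK n (coordMetric g.inner p) (sectionCoord p (e 0)) (sectionCoord p (e 1))
      ((extChartAt 𝓘(ℝ, E) p).target ∩ (extChartAt 𝓘(ℝ, E) p).symm ⁻¹' U) := by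
  have hopen : IsOpen ((extChartAt 𝓘(ℝ, E) p).target ∩ (extChartAt 𝓘(ℝ, E) p).symm ⁻¹' U) :=
    (continuousOn_extChartAt_symm (I := 𝓘(ℝ, E)) p).isOpen_inter_preimage
      (isOpen_extChartAt_target p) he.isOpen
  have hsm : ∀ i, ∀ q ∈ U, SmoothEndAt (e i) q := fun i q hq ↦
    (he.smooth i).contMDiffAt (he.isOpen.mem_nhds hq)
  have hcd : ∀ i, ∀ u ∈ (extChartAt 𝓘(ℝ, E) p).target ∩ (extChartAt 𝓘(ℝ, E) p).symm ⁻¹' U,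
      ContDiffAt ℝ ∞ (sectionCoord p (e i)) u := fun i u hu ↦
    contDiffAt_sectionCoord hu.1 (hsm i _ hu.2)
  have hmul : ∀ u ∈ (extChartAt 𝓘(ℝ, E) p).target ∩ (extChartAt 𝓘(ℝ, E) p).symm ⁻¹' U, ∀ i j,
      sectionCoord p (e i) u * sectionCoord p (e j) u =
        endCoord p ((extChartAt 𝓘(ℝ, E) p).symm u) (e i ((extChartAt 𝓘(ℝ, E) p).symm u) *
          e j ((extChartAt 𝓘(ℝ, E) p).symm u)) := fun u hu i j ↦ by
    rw [sectionCoord, sectionCoord, endCoord_mul]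
    have := (extChartAt 𝓘(ℝ, E) p).map_target hu.1
    rwa [extChartAt_source] at this
  have hsq : ∀ u ∈ (extChartAt 𝓘(ℝ, E) p).target ∩ (extChartAt 𝓘(ℝ, E) p).symm ⁻¹' U, ∀ i,
      sectionCoord p (e i) u * sectionCoord p (e i) u = -1 := fun u hu i ↦ by
    rw [hmul u hu, he.sq _ hu.2, endCoord_neg_one]
    have := (extChartAt 𝓘(ℝ, E) p).map_target hu.1
    rwa [extChartAt_source] at this
  have hskew : ∀ u ∈ (extChartAt 𝓘(ℝ, E) p).target ∩ (extChartAt 𝓘(ℝ, E) p).symm ⁻¹' U, ∀ i v w,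
      coordMetric g.inner p u (sectionCoord p (e i) u v) w =
        -coordMetric g.inner p u v (sectionCoord p (e i) u w) := fun u hu i v w ↦ by
    have := endCoord_skew ((extChartAt 𝓘(ℝ, E) p).map_target hu.1)
      (S.skew (he.mem _ hu.2 i) (he.sq _ hu.2 i)) v w
    rwa [(extChartAt 𝓘(ℝ, E) p).right_inv hu.1] at this
  have hpar : ∀ i, ∀ u ∈ (extChartAt 𝓘(ℝ, E) p).target ∩ (extChartAt 𝓘(ℝ, E) p).symm ⁻¹' U, ∀ v,
      covEnd (coordMetric g.inner p) (ContinuousLinearMap.id ℝ E) (sectionCoord p (e i)) u v ∈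
        imQuat (sectionCoord p (e 0) u) (sectionCoord p (e 1) u) := fun i u hu v ↦ by
    have hd := (hcd i u hu).differentiableAt (by simp)
    -- Parallelism of `Q` only places the derivative in `Q`. It is imaginary because its trace is
    -- the derivative of tr eᵢ = 0.
    have htr : trL E (covEnd (coordMetric g.inner p) (ContinuousLinearMap.id ℝ E)
        (sectionCoord p (e i)) u v) = 0 := by
      rw [← fderiv_trL hd]
      have : (fun y ↦ trL E (sectionCoord p (e i) y)) =ᶠ[nhds u] fun _ ↦ (0 : ℝ) := by
        filter_upwards [hopen.mem_nhds hu] with y hy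
        have hy' := (extChartAt 𝓘(ℝ, E) p).map_target hy.1
        rw [extChartAt_source] at hy'
        exact (trEnd_eq_endCoord hy' _).symm.trans (he.tr_eq_zero hy.2 i)
      rw [this.fderiv_eq]; simp
    rw [covEnd_sectionCoord g hu.1 (hsm i _ hu.2)] at htr ⊢
    refine he.endCoord_mem_imQuat S.finrank_pos p ((extChartAt 𝓘(ℝ, E) p).map_target hu.1) hu.2 ?_ htr
    exact S.parallel _ _ (hsm i _ hu.2)
      (Filter.eventually_of_mem (he.isOpen.mem_nhds hu.2) fun q hq ↦ he.mem q hq i) _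
  refine ⟨(isMetricOn_coordMetric g p).mono hopen Set.inter_subset_left,
    fun u hu ↦ (hcd 0 u hu).contDiffWithinAt, fun u hu ↦ (hcd 1 u hu).contDiffWithinAt,
    fun u hu ↦ ⟨hsq u hu 0, hsq u hu 1, rfl, ?_, hskew u hu 0, hskew u hu 1⟩,
    hpar 0, hpar 1, S.finrank_eq, S.two_le⟩
  rw [hmul u hu, hmul u hu, he.anticomm _ hu.2 1 0 (by decide), endCoord_neg]

end FrameCoordinates

section EndCoordInjective

variable {E : Type*} [NormedAddCommGroup E] [NormedSpace ℝ E]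
  {M : Type*} [TopologicalSpace M] [ChartedSpace E M] [IsManifold 𝓘(ℝ, E) ∞ M]

theorem endCoord_eq_zero {p q : M} (hq : q ∈ (extChartAt 𝓘(ℝ, E) p).source) {A : EndT E q}
    (h : endCoord p q A = 0) : A = 0 := by
  have hr := mem_extChartAt_source (I := 𝓘(ℝ, E)) q
  have h1 := endCoord_chartTrans hr hq A
  rw [endCoord_self, h] at h1
  ext v
  refine fderiv_chartTrans_injective (mem_transDomain hr hq) ((h1 v).symm.trans ?_)
  simp

end EndCoordInjective

/-! ### The twistor space in its preferred charts. -/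

namespace TwistorSpace

variable {E : Type*} [NormedAddCommGroup E] [NormedSpace ℝ E] [FiniteDimensional ℝ E]
  {M : Type*} [TopologicalSpace M] [ChartedSpace E M] [IsManifold 𝓘(ℝ, E) ∞ M] {n : ℕ}
  {g : Bundle.ContMDiffRiemannianMetric 𝓘(ℝ, E) ∞ E (fun p : M ↦ TangentSpace 𝓘(ℝ, E) p)}
  {S : QuaternionKahlerStructure n g}

variable (E) in
/-- The projection of the model space of the twistor space. -/
abbrev modelFst : TwistorModel E →L[ℝ] E := ContinuousLinearMap.fst ℝ E (EuclideanSpace ℝ (Fin 2))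

theorem horizontal_apply (w : TwistorSpace S) (b : TwistorModel E) :
    (horizontal w b : E) = b.1 := by
  change mfderiv 𝓘(ℝ, TwistorModel E) 𝓘(ℝ, E) (pt : TwistorSpace S → M) w b = _
  rw [mfderiv_pt]; rfl

theorem covDerivTaut_apply (w : TwistorSpace S) (b : TwistorModel E) :
    (covDerivTaut w b : E →L[ℝ] E) = covEnd (coordMetric g.inner w.pt) (modelFst E) (cxCoord w)
      (extChartAt 𝓘(ℝ, TwistorModel E) w w) b := by
  refine (covDerivEnd_cx w b).trans ?_
  rw [covEnd, cxCoord_self]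
  rfl

section

variable {z : TwistorSpace S} {x : TwistorModel E}

theorem pt_extChartAt_symm (hx : x ∈ (extChartAt 𝓘(ℝ, TwistorModel E) z).target) :
    (extChartAt 𝓘(ℝ, E) z.pt).symm x.1 = ((extChartAt 𝓘(ℝ, TwistorModel E) z).symm x).pt := by
  obtain ⟨h, h'⟩ := extChartAt_symm_eq z hx
  rw [h']; rfl

theorem fst_mem_target (hx : x ∈ (extChartAt 𝓘(ℝ, TwistorModel E) z).target) :
    x.1 ∈ (extChartAt 𝓘(ℝ, E) z.pt).target := by
  have := extChartAt_target_mem z hx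
  simpa [extChartAt_target] using this

theorem pt_mem_source (hx : x ∈ (extChartAt 𝓘(ℝ, TwistorModel E) z).target) :
    ((extChartAt 𝓘(ℝ, TwistorModel E) z).symm x).pt ∈ (extChartAt 𝓘(ℝ, E) z.pt).source := by
  rw [← pt_extChartAt_symm hx]
  exact (extChartAt 𝓘(ℝ, E) z.pt).map_target (fst_mem_target hx)

theorem pt_mem_frameDomain (hx : x ∈ (extChartAt 𝓘(ℝ, TwistorModel E) z).target) :
    ((extChartAt 𝓘(ℝ, TwistorModel E) z).symm x).pt ∈ frameDomain z := by
  obtain ⟨h, h'⟩ := extChartAt_symm_eq z hx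
  rw [h']; exact h

theorem contDiffAt_cxCoord_of_mem (hx : x ∈ (extChartAt 𝓘(ℝ, TwistorModel E) z).target) :
    ContDiffAt ℝ ∞ (cxCoord z) x := by
  refine ContDiffAt.sum fun i _ ↦ ContDiffAt.fun_smul ?_ ?_
  · exact ((contDiff_sphereCoeff i).comp contDiff_snd).contDiffAt
  · refine ContDiffAt.comp (g := frameCoord z i) x ?_ contDiffAt_fst
    refine contDiffAt_sectionCoord (fst_mem_target hx) ?_
    rw [pt_extChartAt_symm hx]
    exact ((isLocalFrame_frameAt z).smooth i).contMDiffAt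
      ((isLocalFrame_frameAt z).isOpen.mem_nhds (pt_mem_frameDomain hx))

theorem chartTrans_fst {w : TwistorSpace S} (hx : x ∈ transDomain z w) :
    (chartTrans z w x).1 = chartTrans z.pt w.pt x.1 := by
  rw [chartTrans_apply, chartTrans_apply, pt_extChartAt_symm hx.1]
  rfl

theorem fst_mem_transDomain {w : TwistorSpace S} (hx : x ∈ transDomain z w) :
    x.1 ∈ transDomain z.pt w.pt := by
  refine ⟨fst_mem_target hx.1, ?_⟩
  have h := pt_mem_source (z := w) ((extChartAt 𝓘(ℝ, TwistorModel E) w).map_source hx.2)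
  rwa [(extChartAt 𝓘(ℝ, TwistorModel E) w).left_inv hx.2, ← pt_extChartAt_symm hx.1] at h

theorem fderiv_chartTrans_fst {w : TwistorSpace S} (hx : x ∈ transDomain z w) (a : TwistorModel E) :
    (fderiv ℝ (chartTrans z w) x a).1 = fderiv ℝ (chartTrans z.pt w.pt) x.1 a.1 := by
  have h : (fun y ↦ (modelFst E) (chartTrans z w y)) =ᶠ[nhds x]
      fun y ↦ chartTrans z.pt w.pt (modelFst E y) := by
    filter_upwards [(isOpen_transDomain z w).mem_nhds hx] with y hy
    exact chartTrans_fst hy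
  have h' := congrArg (fun T ↦ T a) (h.fderiv_eq (𝕜 := ℝ))
  rw [fderiv_comp_apply' (modelFst E).differentiableAt (differentiableAt_chartTrans hx),
    fderiv_comp_apply' (f := modelFst E) (differentiableAt_chartTrans (fst_mem_transDomain hx))
      (modelFst E).differentiableAt] at h'
  rw [ContinuousLinearMap.fderiv, ContinuousLinearMap.fderiv] at h'
  exact h'

theorem cxCoord_chartTrans {w : TwistorSpace S} (hx : x ∈ transDomain z w) (v : E) :
    cxCoord w (chartTrans z w x) (fderiv ℝ (chartTrans z.pt w.pt) x.1 v) =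
      fderiv ℝ (chartTrans z.pt w.pt) x.1 (cxCoord z x v) := by
  have hw := (extChartAt 𝓘(ℝ, TwistorModel E) w).map_source hx.2
  have h1 := endCoord_cx_symm w hw
  rw [(extChartAt 𝓘(ℝ, TwistorModel E) w).left_inv hx.2] at h1
  have h2 := endCoord_cx_symm z hx.1
  have h3 := fst_mem_transDomain hx
  have h4 := endCoord_chartTrans (pt_mem_source hx.1)
    (q := w.pt) (by rw [← pt_extChartAt_symm hx.1]; exact h3.2)
    ((extChartAt 𝓘(ℝ, TwistorModel E) z).symm x).cx v
  rw [h1, h2, ← pt_extChartAt_symm hx.1, (extChartAt 𝓘(ℝ, E) z.pt).right_inv h3.1] at h4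
  exact h4

/-- At a nearby point w the form θ is defined through the charts preferred at w. Transitions of ZM
cover isometric transitions of M and carry the tautological endomorphism to itself, so `covEnd_map`
transports θ to the chart at z. -/
theorem endCoord_covDerivTaut (hx : x ∈ (extChartAt 𝓘(ℝ, TwistorModel E) z).target)
    {w : TwistorSpace S} (hw : (extChartAt 𝓘(ℝ, TwistorModel E) z).symm x = w) (a : TwistorModel E) :
    endCoord z.pt w.pt (covDerivTaut w (fderiv ℝ (chartTrans z w) x a : TwistorModel E)) =
      covEnd (coordMetric g.inner z.pt) (modelFst E) (cxCoord z) x a := by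
  subst hw
  set w := (extChartAt 𝓘(ℝ, TwistorModel E) z).symm x with hw
  have hxw : x ∈ transDomain z w := mem_transDomain_self hx
  have hx1 := fst_mem_transDomain hxw
  ext v
  rw [← sub_eq_zero]
  refine fderiv_chartTrans_injective hx1 ?_
  rw [map_sub, sub_eq_zero]
  have hτ : chartTrans z w x = extChartAt 𝓘(ℝ, TwistorModel E) w w := rfl
  have h1 := (isIsometryOn_chartTrans g z.pt w.pt).covEnd_map (pr := modelFst E)
    (pr' := modelFst E) (θ := chartTrans z w) (A := cxCoord z)
    (A' := cxCoord w) (x := x) hx1 (differentiableAt_chartTrans hxw)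
    ((contDiffAt_cxCoord_of_mem hx).differentiableAt (by simp))
    ((contDiffAt_cxCoord w).differentiableAt (by simp))
    (by
      filter_upwards [(isOpen_transDomain z w).mem_nhds hxw] with y hy
      exact chartTrans_fst hy)
    (by
      filter_upwards [(isOpen_transDomain z w).mem_nhds hxw] with y hy v
      exact cxCoord_chartTrans hy v) a v
  have h2 := endCoord_chartTrans (pt_mem_source hx) (mem_extChartAt_source w.pt)
    (covDerivTaut w (fderiv ℝ (chartTrans z w) x a : TwistorModel E)) v
  rw [endCoord_self, ← pt_extChartAt_symm hx, (extChartAt 𝓘(ℝ, E) z.pt).right_inv hx1.1] at h2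
  rw [pt_extChartAt_symm hx] at h2
  refine Eq.trans h2.symm (Eq.trans ?_ h1)
  exact congrArg (fun T : E →L[ℝ] E ↦ T (fderiv ℝ (chartTrans z.pt w.pt) x.1 v))
    (covDerivTaut_apply w _)

end

end TwistorSpace

theorem exists_fderiv_chartTrans_eq {E : Type*} [NormedAddCommGroup E] [NormedSpace ℝ E]
    {M : Type*} [TopologicalSpace M] [ChartedSpace E M] [IsManifold 𝓘(ℝ, E) ∞ M] {p q : M} {u : E}
    (hu : u ∈ transDomain p q) (v : E) : ∃ w, fderiv ℝ (chartTrans p q) u w = v := by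
  have hq : chartTrans p q u ∈ transDomain q p :=
    mem_transDomain hu.2 ((extChartAt 𝓘(ℝ, E) p).map_target hu.1)
  have hqq : chartTrans p q u ∈ transDomain q q := ⟨hq.1, (extChartAt 𝓘(ℝ, E) q).map_target hq.1⟩
  have h := fderiv_chartTrans_comp hq hqq v
  rw [chartTrans_comp p hu, chartTrans_self hu.1, fderiv_chartTrans_self hq.1] at h
  exact ⟨_, h⟩

namespace TwistorSpace

variable {E : Type*} [NormedAddCommGroup E] [NormedSpace ℝ E] [FiniteDimensional ℝ E]
  {M : Type*} [TopologicalSpace M] [ChartedSpace E M] [IsManifold 𝓘(ℝ, E) ∞ M] {n : ℕ}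
  {g : Bundle.ContMDiffRiemannianMetric 𝓘(ℝ, E) ∞ E (fun p : M ↦ TangentSpace 𝓘(ℝ, E) p)}
  {S : QuaternionKahlerStructure n g}

theorem covDerivTaut_mem (w : TwistorSpace S) (b : TangentSpace 𝓘(ℝ, TwistorModel E) w) :
    covDerivTaut w b ∈ QMinus w :=
  ⟨covDerivEnd_cx_mem w b, covDerivEnd_cx_anticomm w b⟩

theorem gammaEnd_of_mem_QMinus (w : TwistorSpace S) {A B : EndT E w.pt} (hA : A ∈ QMinus w) :
    gammaEnd A B = -trEnd (A * B) / Module.finrank ℝ E := by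
  rw [gammaEnd_eq, reEnd, tr_of_mem_QMinus w hA, reEnd, reEnd]; ring

/-- As θ anticommutes with I, (Iθ_a)(Iθ_b) = θ_aθ_b. The two factors ½ then turn the coefficient
16n(n+2)/κ of the metric into 4n(n+2)/κ = c⁻¹. -/
theorem gammaEnd_vertical (w : TwistorSpace S) (a b : TangentSpace 𝓘(ℝ, TwistorModel E) w) :
    gammaEnd (vertical w a : EndT E w.pt) (vertical w b : EndT E w.pt) =
      -trEnd (covDerivTaut w a * covDerivTaut w b) / Module.finrank ℝ E / 4 := by
  rw [gammaEnd_of_mem_QMinus w (vertical w a).2]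
  change -trEnd (((1 / 2 : ℝ) • (w.cx * covDerivTaut w a)) *
    ((1 / 2 : ℝ) • (w.cx * covDerivTaut w b))) / _ = _
  have h : w.cx * covDerivTaut w a * (w.cx * covDerivTaut w b) =
      covDerivTaut w a * covDerivTaut w b := by
    rw [← mul_assoc, mul_assoc w.cx, (covDerivTaut_mem w a).2, mul_neg, ← mul_assoc, w.sq]
    simp
  rw [smul_mul_smul_comm, h, map_smul, smul_eq_mul]
  ring

theorem neg_trEnd_eq_gam {p q : M} (hq : q ∈ (extChartAt 𝓘(ℝ, E) p).source) (A B : EndT E q) :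
    -trEnd (A * B) / Module.finrank ℝ E = gam E (endCoord p q A) (endCoord p q B) := by
  have hq' : q ∈ (chartAt E p).source := by rwa [extChartAt_source] at hq
  rw [trEnd_eq_endCoord hq', endCoord_mul hq', gam, trL_apply]

theorem twistorMetric_eq (w : TwistorSpace S) (a b : TwistorModel E) :
    (twistorMetric w : TwistorModel E →L[ℝ] TwistorModel E →L[ℝ] ℝ) a b =
      (g.inner w.pt : E →L[ℝ] E →L[ℝ] ℝ) a.1 b.1 +
        4 * n * (n + 2) / scalarCurvature g.inner w.pt *
          (-trEnd (covDerivTaut w a * covDerivTaut w b) / Module.finrank ℝ E) := by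
  refine (twistorMetric_apply w a b).trans ?_
  refine congrArg₂ (· + ·) ?_ ?_
  · exact congrArg₂ (fun s t ↦ (g.inner w.pt : E →L[ℝ] E →L[ℝ] ℝ) s t) (horizontal_apply w a)
      (horizontal_apply w b)
  · refine (congrArg (HMul.hMul _) (gammaEnd_vertical w a b)).trans ?_
    ring

theorem eq_zero_of_fst_of_covDerivTaut (w : TwistorSpace S) {b : TwistorModel E} (h1 : b.1 = 0)
    (h2 : covDerivTaut w b = 0) : b = 0 := by
  have h : ((horizontal w).prod (vertical w)) b = ((horizontal w).prod (vertical w)) 0 := by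
    rw [map_zero]
    refine Prod.ext ((horizontal_apply w b).trans h1) (Subtype.ext ?_)
    change (1 / 2 : ℝ) • (w.cx * covDerivTaut w b) = 0
    rw [h2, mul_zero, smul_zero]
  exact split_injective w h

theorem exists_fst_covDerivTaut (w : TwistorSpace S) (X : E) {B : EndT E w.pt}
    (hB : B ∈ QMinus w) : ∃ b : TwistorModel E, b.1 = X ∧ covDerivTaut w b = B := by
  obtain ⟨b, hb⟩ := (split_bijective w).2
    (X, ⟨(1 / 2 : ℝ) • (w.cx * B), Submodule.smul_mem _ _ (cx_mul_mem_QMinus w hB)⟩)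
  refine ⟨b, (horizontal_apply w b).symm.trans (congrArg Prod.fst hb), ?_⟩
  have h1 : (1 / 2 : ℝ) • (w.cx * covDerivTaut w b) = (1 / 2 : ℝ) • (w.cx * B) :=
    congrArg Subtype.val (congrArg Prod.snd hb)
  have h2 : w.cx * covDerivTaut w b = w.cx * B := smul_right_injective _ (by norm_num) h1
  have h3 := congrArg (fun A ↦ w.cx * A) h2
  simp only [← mul_assoc, w.sq, neg_mul, one_mul] at h3
  exact neg_injective h3

section

variable {z : TwistorSpace S} {x : TwistorModel E}

theorem cxCoord_mem_imQuat (hx : x ∈ (extChartAt 𝓘(ℝ, TwistorModel E) z).target) :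
    cxCoord z x ∈ imQuat (frameCoord z 0 x.1) (frameCoord z 1 x.1) := by
  have h := endCoord_cx_symm z hx
  have hp := pt_mem_source hx
  have hp' := hp
  rw [extChartAt_source] at hp'
  have htr := (trEnd_eq_endCoord hp' _).symm.trans (tr_cx ((extChartAt 𝓘(ℝ, TwistorModel E) z).symm x))
  have h2 := (isLocalFrame_frameAt z).endCoord_mem_imQuat S.finrank_pos z.pt hp
    (pt_mem_frameDomain hx) ((extChartAt 𝓘(ℝ, TwistorModel E) z).symm x).mem htr
  rw [h, ← pt_extChartAt_symm hx] at h2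
  exact h2

theorem cxCoord_sq (hx : x ∈ (extChartAt 𝓘(ℝ, TwistorModel E) z).target) :
    cxCoord z x * cxCoord z x = -1 := by
  have hp := pt_mem_source hx
  rw [extChartAt_source] at hp
  rw [← endCoord_cx_symm z hx, ← endCoord_mul hp,
    ((extChartAt 𝓘(ℝ, TwistorModel E) z).symm x).sq, endCoord_neg_one hp]

theorem exists_endCoord_eq (hx : x ∈ (extChartAt 𝓘(ℝ, TwistorModel E) z).target) {w : TwistorSpace S}
    (hw : (extChartAt 𝓘(ℝ, TwistorModel E) z).symm x = w) {A : E →L[ℝ] E}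
    (hA : A ∈ imQuat (frameCoord z 0 x.1) (frameCoord z 1 x.1))
    (hanti : A * cxCoord z x = -(cxCoord z x * A)) :
    ∃ B ∈ QMinus w, endCoord z.pt w.pt B = A := by
  subst hw
  have hp := pt_mem_source hx
  have hp' := hp
  rw [extChartAt_source] at hp'
  have hU := pt_mem_frameDomain hx
  have he := isLocalFrame_frameAt z
  obtain ⟨a, b, c, hA⟩ := mem_imQuat.1 hA
  have hB : ∃ B ∈ S.Q ((extChartAt 𝓘(ℝ, TwistorModel E) z).symm x).pt,
      endCoord z.pt ((extChartAt 𝓘(ℝ, TwistorModel E) z).symm x).pt B = A := by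
    refine ⟨a • frameAt z 0 _ + b • frameAt z 1 _ + c • (frameAt z 0 _ * frameAt z 1 _),
      add_mem (add_mem (Subalgebra.smul_mem _ (he.mem _ hU 0) _)
        (Subalgebra.smul_mem _ (he.mem _ hU 1) _))
        (Subalgebra.smul_mem _ (mul_mem (he.mem _ hU 0) (he.mem _ hU 1)) _), ?_⟩
    rw [endCoord_add, endCoord_add, endCoord_smul, endCoord_smul, endCoord_smul, endCoord_mul hp',
      ← pt_extChartAt_symm hx]
    exact hA
  obtain ⟨B, hBQ, hBA⟩ := hB
  refine ⟨B, ⟨hBQ, ?_⟩, hBA⟩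
  rw [← sub_eq_zero, sub_neg_eq_add]
  refine endCoord_eq_zero hp ?_
  rw [endCoord_add, endCoord_mul hp', endCoord_mul hp', endCoord_cx_symm z hx, hBA, hanti]
  simp

theorem coordMetric_twistorMetric (hx : x ∈ (extChartAt 𝓘(ℝ, TwistorModel E) z).target)
    (a b : TwistorModel E) :
    coordMetric (twistorMetric (S := S)) z x a b =
      coordMetric g.inner z.pt x.1 a.1 b.1 +
        4 * n * (n + 2) / localScalarCurvature (coordMetric g.inner z.pt) x.1 *
          gam E (covEnd (coordMetric g.inner z.pt) (modelFst E) (cxCoord z) x a)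
            (covEnd (coordMetric g.inner z.pt) (modelFst E) (cxCoord z) x b) := by
  set w := (extChartAt 𝓘(ℝ, TwistorModel E) z).symm x with hw
  have hxw : x ∈ transDomain z w := mem_transDomain_self hx
  rw [coordMetric_apply (twistorMetric (S := S)) hx rfl, twistorMetric_eq,
    neg_trEnd_eq_gam (pt_mem_source hx), endCoord_covDerivTaut hx rfl, endCoord_covDerivTaut hx rfl,
    coordMetric_apply g.inner (fst_mem_target hx) (pt_extChartAt_symm hx),
    fderiv_chartTrans_fst hxw, fderiv_chartTrans_fst hxw, ← scalarCurvature_eq g (fst_mem_target hx),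
    pt_extChartAt_symm hx]

end

/-- The vertical coefficient of the metric involves κ at the moving point. The base is shrunk to a
neighbourhood where κ is constant, so that one number c serves throughout; the bijectivity of the
splitting at each point gives `inj` and `surj`. -/
theorem exists_isLocalTwistor (z : TwistorSpace S)
    (hpos : 0 < scalarCurvature g.inner z.pt) :
    ∃ U W, extChartAt 𝓘(ℝ, TwistorModel E) z z ∈ W ∧
      IsLocalTwistor n (scalarCurvature g.inner z.pt / (4 * n * (n + 2))) (coordMetric g.inner z.pt)
        (frameCoord z 0) (frameCoord z 1) U (modelFst E) (cxCoord z)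
        (coordMetric (twistorMetric (S := S)) z) W := by
  have hn : (0 : ℝ) < n := by
    have := S.two_le; exact_mod_cast (by omega : 0 < n)
  set u := extChartAt 𝓘(ℝ, E) z.pt z.pt with hu
  have hqk := S.isLocalQK (isLocalFrame_frameAt z) z.pt
  have hu' : u ∈ (extChartAt 𝓘(ℝ, E) z.pt).target ∩
      (extChartAt 𝓘(ℝ, E) z.pt).symm ⁻¹' frameDomain z :=
    ⟨mem_extChartAt_target _, by
      rw [Set.mem_preimage, extChartAt_to_inv]; exact mem_frameDomain z⟩
  obtain ⟨t, ht, hto, hut⟩ := mem_nhds_iff.1 (hqk.eventually_nscal_eq hu')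
  have hopen := hqk.metric.isOpen.inter hto
  have hpos' : 0 < scalarCurvature g.inner z.pt / (4 * n * (n + 2)) := by positivity
  have hWo : IsOpen ((extChartAt 𝓘(ℝ, TwistorModel E) z).target ∩ modelFst E ⁻¹'
      (((extChartAt 𝓘(ℝ, E) z.pt).target ∩ (extChartAt 𝓘(ℝ, E) z.pt).symm ⁻¹' frameDomain z) ∩ t)) :=
    (isOpen_extChartAt_target z).inter (hopen.preimage (modelFst E).continuous)
  refine ⟨((extChartAt 𝓘(ℝ, E) z.pt).target ∩ (extChartAt 𝓘(ℝ, E) z.pt).symm ⁻¹' frameDomain z) ∩ t,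
    (extChartAt 𝓘(ℝ, TwistorModel E) z).target ∩ modelFst E ⁻¹'
      (((extChartAt 𝓘(ℝ, E) z.pt).target ∩ (extChartAt 𝓘(ℝ, E) z.pt).symm ⁻¹' frameDomain z) ∩ t),
    ⟨mem_extChartAt_target z, hu', hut⟩, hqk.mono hopen Set.inter_subset_left, hpos',
    fun v hv ↦ ht hv.2, hWo, fun x hx ↦ hx.2,
    fun x hx ↦ (contDiffAt_cxCoord_of_mem hx.1).contDiffWithinAt, fun x hx ↦ cxCoord_mem_imQuat hx.1,
    fun x hx ↦ cxCoord_sq hx.1, ?_, ?_, ?_⟩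
  · intro x hx a ha1 ha2
    have hxw := mem_transDomain_self hx.1
    refine fderiv_chartTrans_injective hxw (eq_zero_of_fst_of_covDerivTaut
      ((extChartAt 𝓘(ℝ, TwistorModel E) z).symm x) ?_ ?_)
    · rw [fderiv_chartTrans_fst hxw]
      exact (congrArg _ ha1).trans (map_zero _)
    · exact endCoord_eq_zero (pt_mem_source hx.1) ((endCoord_covDerivTaut hx.1 rfl a).trans ha2)
  · intro x hx X A hA hgam
    have hxw := mem_transDomain_self hx.1
    -- Orthogonality to I is the same as anticommuting with it, so `A` comes from an element of Q⁻
    -- at the corresponding point.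
    have hanti : A * cxCoord z x = -(cxCoord z x * A) := by
      have h := (hqk.triple _ hx.2.1).mul_add_mul S.finrank_pos hA (cxCoord_mem_imQuat hx.1)
      rw [gam_comm, hgam, mul_zero, zero_smul] at h
      exact eq_neg_of_add_eq_zero_left h
    obtain ⟨B, hB, hBA⟩ := exists_endCoord_eq hx.1 rfl hA hanti
    obtain ⟨b, hb1, hb2⟩ := exists_fst_covDerivTaut ((extChartAt 𝓘(ℝ, TwistorModel E) z).symm x)
      (fderiv ℝ (chartTrans z.pt ((extChartAt 𝓘(ℝ, TwistorModel E) z).symm x).pt) x.1 X) hB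
    obtain ⟨a, rfl⟩ := exists_fderiv_chartTrans_eq hxw b
    refine ⟨a, ?_, ?_⟩
    · rw [fderiv_chartTrans_fst hxw] at hb1
      rw [← sub_eq_zero]
      refine fderiv_chartTrans_injective (fst_mem_transDomain hxw) ?_
      rw [map_sub, sub_eq_zero]
      exact hb1
    · rw [← endCoord_covDerivTaut hx.1 rfl, hb2, hBA]
  · intro x hx a b
    rw [coordMetric_twistorMetric hx.1]
    have hc : nscal n (coordMetric g.inner z.pt) x.1 =
      scalarCurvature g.inner z.pt / (4 * n * (n + 2)) := ht hx.2.2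
    rw [← hc, nscal, inv_div]
    rfl

end TwistorSpace

/-! ### Comparison of the bisectional curvatures. -/

theorem complexProjective_bisectional {T : Type*} [TopologicalSpace T] [AddCommGroup T] [Module ℝ T]
    {h : T →L[ℝ] T →L[ℝ] ℝ} {J : T → T} (hJJ : ∀ a, J (J a) = -a)
    (hJ : ∀ a b, h (J a) (J b) = h a b) (m : ℕ) (s : ℝ) (a b : T) :
    holomorphicBisectional h (complexProjectiveCurvature m s h J) J a b =
      s / (4 * m * (m + 1)) * 2 * (h a b ^ 2 + h (J a) b ^ 2 + h a a * h b b) := by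
  -- J is orthogonal with square −1, hence skew. The two wedge terms then contribute equally, which
  -- gives the common factor 2.
  have h0 : ∀ a b, h a (J b) = -h (J a) b := fun a b ↦ by
    rw [← hJ a, hJJ, map_neg]
  simp only [holomorphicBisectional, complexProjectiveCurvature, wedgeEnd, hJJ, hJ, h0, map_add,
    map_sub, map_smul, map_neg, add_apply, sub_apply, smul_apply, neg_apply, smul_eq_mul]
  ring

section

variable {V : Type*} [NormedAddCommGroup V] [NormedSpace ℝ V] [FiniteDimensional ℝ V]
  {N : Type*} [NormedAddCommGroup N] [NormedSpace ℝ N] [FiniteDimensional ℝ N]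

/-- A unit vector of the three-dimensional space Im Q orthogonal to I and J is IJ up to sign. The
sign stays undetermined, but only squares are needed. -/
theorem QuatTriple.eq_smul_mul_of_gam {g : V →L[ℝ] V →L[ℝ] ℝ} {J₁ J₂ K₁ I J A : V →L[ℝ] V}
    (h : QuatTriple g J₁ J₂ K₁) (hV : 0 < Module.finrank ℝ V)
    (hI : I ∈ imQuat J₁ J₂) (hJ : J ∈ imQuat J₁ J₂) (hII : gam V I I = 1) (hJJ : gam V J J = 1)
    (hIJ : gam V I J = 0) (hA : A ∈ imQuat J₁ J₂) (hIA : gam V I A = 0) (hJA : gam V J A = 0)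
    (hAA : gam V A A = 1) : ∃ k : ℝ, k ^ 2 = 1 ∧ A = k • (I * J) := by
  have h1 := h.eq_comb_of_gam hV hI hJ hII hJJ hIJ hA
  rw [hIA, hJA, zero_smul, zero_smul, zero_add, zero_add] at h1
  generalize gam V (I * J) A = k at h1
  refine ⟨k, ?_, h1⟩
  rw [h1, gam_smul_left, gam_smul_right,
    ((h.of_gam hV hI hJ hII hJJ hIJ).gam_frame hV).2.2.1] at hAA
  linarith

/-- A form of `bisectional_eq` in which the values at x are separate variables, so that tensors on
the tangent spaces at z can be substituted for them. -/
theorem IsLocalTwistor.bisectional_eq_of_eq {n : ℕ} {c : ℝ} {G : V → V →L[ℝ] V →L[ℝ] ℝ}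
    {J₁ J₂ : V → V →L[ℝ] V} {U : Set V} {pr : N →L[ℝ] V} {I : N → V →L[ℝ] V}
    {H : N → N →L[ℝ] N →L[ℝ] ℝ} {W : Set N} (h : IsLocalTwistor n c G J₁ J₂ U pr I H W) {x : N}
    (hx : x ∈ W) {I' J : V →L[ℝ] V} (hJ : J ∈ imQuat (J₁ (pr x)) (J₂ (pr x)))
    (hJJ : gam V J J = 1) (hI : I x = I') (hIJ : gam V I' J = 0) {g : V →L[ℝ] V →L[ℝ] ℝ}
    {k : N →L[ℝ] N →L[ℝ] ℝ} (hg : G (pr x) = g) (hk : H x = k) {a a' b b' : N} {X Y : V}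
    (hX : pr a = X) (hY : pr b = Y) (ha : pr a' = I' X)
    (ha' : covEnd G pr I x a' = I' * covEnd G pr I x a) (hb : pr b' = I' Y)
    (hb' : covEnd G pr I x b' = I' * covEnd G pr I x b) :
    k (localCurvature H x a a' b') b = g (localCurvature G (pr x) X (I' X) (I' Y)) Y +
      c / 2 * (g (J X) Y ^ 2 + g (I' (J X)) Y ^ 2) +
      c / 2 * (k a b ^ 2 + k a' b ^ 2 + k a a * k b b) -
      c / 2 * (g X Y ^ 2 + g (I' X) Y ^ 2 + g X X * g Y Y) := by
  subst hI hg hk hX hY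
  exact h.bisectional_eq hx hJ hJJ hIJ ha ha' hb hb'

end

namespace TwistorSpace

variable {E : Type*} [NormedAddCommGroup E] [NormedSpace ℝ E] [FiniteDimensional ℝ E]
  {M : Type*} [TopologicalSpace M] [ChartedSpace E M] [IsManifold 𝓘(ℝ, E) ∞ M] {n : ℕ}
  {g : Bundle.ContMDiffRiemannianMetric 𝓘(ℝ, E) ∞ E (fun p : M ↦ TangentSpace 𝓘(ℝ, E) p)}
  {S : QuaternionKahlerStructure n g} (z : TwistorSpace S)

theorem split_complexStructure (a : TangentSpace 𝓘(ℝ, TwistorModel E) z) :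
    split z (complexStructure z a) = (z.cx (split z a).1,
      ⟨z.cx * ((split z a).2 : EndT E z.pt), cx_mul_mem_QMinus z (split z a).2.2⟩) :=
  (split z).apply_symm_apply _

theorem complexStructure_complexStructure (a : TangentSpace 𝓘(ℝ, TwistorModel E) z) :
    complexStructure z (complexStructure z a) = -a := by
  refine (split z).injective ?_
  rw [split_complexStructure, map_neg]
  have h1 := congrArg Prod.fst (split_complexStructure z a)
  have h2 := congrArg (fun B ↦ (B.2 : EndT E z.pt)) (split_complexStructure z a)
  simp only at h1 h2
  refine Prod.ext ?_ (Subtype.ext ?_)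
  · change z.cx (split z (complexStructure z a)).1 = -(split z a).1
    rw [h1]
    have := congrArg (fun A : EndT E z.pt ↦ A (split z a).1) z.sq
    exact this
  · change z.cx * ((split z (complexStructure z a)).2 : EndT E z.pt) = -((split z a).2 : EndT E z.pt)
    rw [h2, ← mul_assoc, z.sq, neg_one_mul]

theorem gammaEnd_cx_mul {A B : EndT E z.pt} (hA : A ∈ QMinus z) :
    gammaEnd (z.cx * A) (z.cx * B) = gammaEnd A B := by
  rw [gammaEnd_of_mem_QMinus z hA, gammaEnd_of_mem_QMinus z (cx_mul_mem_QMinus z hA)]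
  have h : z.cx * A * (z.cx * B) = A * B := by
    rw [← mul_assoc, mul_assoc z.cx, hA.2, mul_neg, ← mul_assoc, z.sq]
    simp
  rw [h]

theorem inner_cx_cx (X Y : TangentSpace 𝓘(ℝ, E) z.pt) :
    g.inner z.pt (z.cx X) (z.cx Y) = g.inner z.pt X Y := by
  rw [S.skew z.mem z.sq]
  have h : z.cx (z.cx Y) = -Y := congrArg (fun A : EndT E z.pt ↦ A Y) z.sq
  rw [h, map_neg, neg_neg]

theorem twistorMetric_complexStructure (a b : TangentSpace 𝓘(ℝ, TwistorModel E) z) :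
    twistorMetric z (complexStructure z a) (complexStructure z b) = twistorMetric z a b := by
  rw [twistorMetric_apply, twistorMetric_apply, split_complexStructure, split_complexStructure]
  simp only
  rw [inner_cx_cx, gammaEnd_cx_mul z (split z a).2.2]

theorem cpBisectionalCurvature_eq (a b : TangentSpace 𝓘(ℝ, TwistorModel E) z) :
    cpBisectionalCurvature z a b =
      scalarCurvature (twistorMetric (S := S)) z / (4 * (2 * n + 1 : ℕ) * ((2 * n + 1 : ℕ) + 1)) * 2 *
        (twistorMetric z a b ^ 2 + twistorMetric z (complexStructure z a) b ^ 2 +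
          twistorMetric z a a * twistorMetric z b b) :=
  complexProjective_bisectional (complexStructure_complexStructure z)
    (twistorMetric_complexStructure z) _ _ a b

theorem twistorMetric_split_symm_zero (X Y : TangentSpace 𝓘(ℝ, E) z.pt) :
    twistorMetric z ((split z).symm (X, 0)) ((split z).symm (Y, 0)) = g.inner z.pt X Y := by
  rw [twistorMetric_apply, LinearEquiv.apply_symm_apply, LinearEquiv.apply_symm_apply]
  simp [gammaEnd_eq, reEnd]

theorem complexStructure_split_symm_zero (X : TangentSpace 𝓘(ℝ, E) z.pt) :
    complexStructure z ((split z).symm (X, 0)) = (split z).symm (z.cx X, 0) := by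
  refine (split z).injective ?_
  rw [split_complexStructure, LinearEquiv.apply_symm_apply, LinearEquiv.apply_symm_apply]
  simp

variable {z}

theorem mem_imQuat_frameCoord {A : EndT E z.pt} (hA : A ∈ S.Q z.pt) (htr : trEnd A = 0) :
    (A : E →L[ℝ] E) ∈ imQuat (frameCoord z 0 (extChartAt 𝓘(ℝ, E) z.pt z.pt))
      (frameCoord z 1 (extChartAt 𝓘(ℝ, E) z.pt z.pt)) := by
  have h := (isLocalFrame_frameAt z).endCoord_mem_imQuat S.finrank_pos z.pt
    (mem_extChartAt_source z.pt) (mem_frameDomain z) hA (by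
      rw [endCoord_self]; exact htr)
  rw [endCoord_self, endCoord_self, endCoord_self] at h
  have e : ∀ i, frameCoord z i (extChartAt 𝓘(ℝ, E) z.pt z.pt) = frameAt z i z.pt := frameCoord_self z
  rw [e, e]
  exact h

theorem gam_eq_gammaEnd {A B : EndT E z.pt} (hA : A ∈ QMinus z) :
    gam E (A : E →L[ℝ] E) B = gammaEnd A B :=
  (gammaEnd_of_mem_QMinus z hA).symm

theorem gam_cx {A : EndT E z.pt} (hA : A ∈ QMinus z) : gam E (z.cx : E →L[ℝ] E) A = 0 := by
  have h := congrArg trEnd hA.2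
  rw [map_neg, trEnd_mul_comm] at h
  have h' : trEnd (z.cx * A) = 0 := by linarith
  have : gam E (z.cx : E →L[ℝ] E) A = -trEnd (z.cx * A) / Module.finrank ℝ E := rfl
  rw [this, h', neg_zero, zero_div]

/-- The complex structure multiplies the vertical part ½Iθ by I on the left; cancelling ½I shows
that it multiplies θ by I as well. -/
theorem covEnd_complexStructure (a : TangentSpace 𝓘(ℝ, TwistorModel E) z) :
    covDerivTaut z (complexStructure z a) = z.cx * covDerivTaut z a := by
  have h : (1 / 2 : ℝ) • (z.cx * covDerivTaut z (complexStructure z a)) =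
      z.cx * ((1 / 2 : ℝ) • (z.cx * covDerivTaut z a)) :=
    congrArg (fun B ↦ (B.2 : EndT E z.pt)) (split_complexStructure z a)
  rw [mul_smul_comm] at h
  have h2 := smul_right_injective (EndT E z.pt) (by norm_num : (1 / 2 : ℝ) ≠ 0) h
  have h3 := congrArg (fun A ↦ z.cx * A) h2
  rw [← mul_assoc, ← mul_assoc, z.sq, neg_one_mul, neg_one_mul] at h3
  exact neg_injective h3

variable {J K : EndT E z.pt} (hJ : J ∈ QMinus z) (hK : K ∈ QMinus z)
    (hJJ : gammaEnd J J = 1) (hKK : gammaEnd K K = 1) (hJK : gammaEnd J K = 0)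
include hJ hJJ

/-- Here K = ±IJ, and the square removes the sign. -/
theorem inner_sq_eq (hK : K ∈ QMinus z) (hKK : gammaEnd K K = 1) (hJK : gammaEnd J K = 0)
    (X Y : TangentSpace 𝓘(ℝ, E) z.pt) :
    g.inner z.pt (K X) Y ^ 2 = g.inner z.pt (z.cx (J X)) Y ^ 2 := by
  have hE : (Module.finrank ℝ E : ℝ) ≠ 0 := by exact_mod_cast S.finrank_pos.ne'
  have ht := (S.isLocalQK (isLocalFrame_frameAt z) z.pt).triple (extChartAt 𝓘(ℝ, E) z.pt z.pt)
    ⟨mem_extChartAt_target _, by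
      rw [Set.mem_preimage, extChartAt_to_inv]; exact mem_frameDomain z⟩
  have hI := mem_imQuat_frameCoord z.mem (tr_cx z)
  have hII : gam E (z.cx : E →L[ℝ] E) z.cx = 1 := by
    have h : gam E (z.cx : E →L[ℝ] E) z.cx = -trEnd (z.cx * z.cx) / Module.finrank ℝ E := rfl
    rw [h, z.sq, map_neg, trEnd_one, neg_neg, div_self hE]
  have hJ' := mem_imQuat_frameCoord hJ.1 (tr_of_mem_QMinus z hJ)
  have hK' := mem_imQuat_frameCoord hK.1 (tr_of_mem_QMinus z hK)
  obtain ⟨k, hk, h⟩ := ht.eq_smul_mul_of_gam S.finrank_pos hI hJ' hII ((gam_eq_gammaEnd hJ).trans hJJ)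
    (gam_cx hJ) hK' (gam_cx hK) ((gam_eq_gammaEnd hJ).trans hJK) ((gam_eq_gammaEnd hK).trans hKK)
  have hX : K X = k • z.cx (J X) := congrArg (fun A : E →L[ℝ] E ↦ A X) h
  rw [hX, map_smul, smul_apply, smul_eq_mul, mul_pow, hk, one_mul]

theorem scalarCurvature_twistorMetric (hpos : 0 < scalarCurvature g.inner z.pt) :
    scalarCurvature (twistorMetric (S := S)) z =
      scalarCurvature g.inner z.pt / (4 * n * (n + 2)) * (2 * n + 1) * (2 * n + 2) := by
  obtain ⟨U, W, hW, h⟩ := exists_isLocalTwistor z hpos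
  exact h.localScalarCurvature_eq hW (mem_imQuat_frameCoord hJ.1 (tr_of_mem_QMinus z hJ))
    ((gam_eq_gammaEnd hJ).trans hJJ)
    ((congrArg (fun A : E →L[ℝ] E ↦ gam E A J) (cxCoord_self z)).trans (gam_cx hJ))

theorem bisectionalCurvature_eq (hpos : 0 < scalarCurvature g.inner z.pt)
    (a b : TangentSpace 𝓘(ℝ, TwistorModel E) z) :
    bisectionalCurvature z a b =
      g.inner z.pt (riemannCurvature g.inner z.pt (split z a).1 (z.cx (split z a).1)
        (z.cx (split z b).1)) (split z b).1 +
      scalarCurvature g.inner z.pt / (4 * n * (n + 2)) / 2 *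
        (g.inner z.pt (J (split z a).1) (split z b).1 ^ 2 +
          g.inner z.pt (z.cx (J (split z a).1)) (split z b).1 ^ 2) +
      scalarCurvature g.inner z.pt / (4 * n * (n + 2)) / 2 *
        (twistorMetric z a b ^ 2 + twistorMetric z (complexStructure z a) b ^ 2 +
          twistorMetric z a a * twistorMetric z b b) -
      scalarCurvature g.inner z.pt / (4 * n * (n + 2)) / 2 *
        (g.inner z.pt (split z a).1 (split z b).1 ^ 2 +
          g.inner z.pt (z.cx (split z a).1) (split z b).1 ^ 2 +
          g.inner z.pt (split z a).1 (split z a).1 * g.inner z.pt (split z b).1 (split z b).1) := by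
  obtain ⟨U, W, hW, h⟩ := exists_isLocalTwistor z hpos
  -- At the point z itself the chart identification is trivial, so coordinate tensors are the
  -- tensors on the tangent spaces.
  have hG : coordMetric g.inner z.pt (modelFst E (extChartAt 𝓘(ℝ, TwistorModel E) z z)) =
      (g.inner z.pt : E →L[ℝ] E →L[ℝ] ℝ) := by
    ext v w; exact coordMetric_self g.inner z.pt v w
  have hH : coordMetric (twistorMetric (S := S)) z (extChartAt 𝓘(ℝ, TwistorModel E) z z) =
      (twistorMetric z : TwistorModel E →L[ℝ] TwistorModel E →L[ℝ] ℝ) :=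
    ContinuousLinearMap.ext fun v ↦ ContinuousLinearMap.ext fun w ↦
      coordMetric_self (twistorMetric (S := S)) z v w
  have hpr : ∀ a : TangentSpace 𝓘(ℝ, TwistorModel E) z, modelFst E a = (split z a).1 := fun a ↦
    (horizontal_apply z a).symm
  have hJa : ∀ a : TangentSpace 𝓘(ℝ, TwistorModel E) z,
      modelFst E (complexStructure z a) = (z.cx : E →L[ℝ] E) (split z a).1 := fun a ↦
    (hpr _).trans (congrArg Prod.fst (split_complexStructure z a))
  let I' : E →L[ℝ] E := z.cx
  have hθ : ∀ a : TangentSpace 𝓘(ℝ, TwistorModel E) z,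
      covEnd (coordMetric g.inner z.pt) (modelFst E) (cxCoord z)
        (extChartAt 𝓘(ℝ, TwistorModel E) z z) (complexStructure z a) =
      I' * covEnd (coordMetric g.inner z.pt) (modelFst E) (cxCoord z)
          (extChartAt 𝓘(ℝ, TwistorModel E) z z) a := fun a ↦
    (covDerivTaut_apply z _).symm.trans ((covEnd_complexStructure a).trans
      (congrArg (fun B : E →L[ℝ] E ↦ I' * B) (covDerivTaut_apply z a)))
  exact h.bisectional_eq_of_eq hW (mem_imQuat_frameCoord hJ.1 (tr_of_mem_QMinus z hJ))
    ((gam_eq_gammaEnd hJ).trans hJJ) (cxCoord_self z) (gam_cx hJ) hG hH (hpr a) (hpr b)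
    (hJa a) (hθ a) (hJa b) (hθ b)

end TwistorSpace

namespace TwistorSpace

variable {E : Type*} [NormedAddCommGroup E] [NormedSpace ℝ E] [FiniteDimensional ℝ E]
  {M : Type*} [TopologicalSpace M] [ChartedSpace E M] [IsManifold 𝓘(ℝ, E) ∞ M] {n : ℕ}
  {g : Bundle.ContMDiffRiemannianMetric 𝓘(ℝ, E) ∞ E (fun p : M ↦ TangentSpace 𝓘(ℝ, E) p)}
  {S : QuaternionKahlerStructure n g} {z : TwistorSpace S}
theorem cpBisectionalCurvature_split_symm_zero (X Y : TangentSpace 𝓘(ℝ, E) z.pt) :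
    cpBisectionalCurvature z ((split z).symm (X, 0)) ((split z).symm (Y, 0)) =
      scalarCurvature (twistorMetric (S := S)) z / (4 * (2 * n + 1 : ℕ) * ((2 * n + 1 : ℕ) + 1)) * 2 *
        (g.inner z.pt X Y ^ 2 + g.inner z.pt (z.cx X) Y ^ 2 +
          g.inner z.pt X X * g.inner z.pt Y Y) := by
  rw [cpBisectionalCurvature_eq, complexStructure_split_symm_zero, twistorMetric_split_symm_zero,
    twistorMetric_split_symm_zero, twistorMetric_split_symm_zero, twistorMetric_split_symm_zero]

/-- With m = 2n + 1 the factor 4m(m + 1) = 4(2n + 1)(2n + 2) reduces the scalar curvature c(2n +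
1)(2n + 2) to c/4. So the projective space has the coefficient c/2, the same as in
`bisectionalCurvature_eq`. -/
theorem scalarCurvature_twistorMetric_div {J : EndT E z.pt} (hJ : J ∈ QMinus z)
    (hJJ : gammaEnd J J = 1) (hpos : 0 < scalarCurvature g.inner z.pt) :
    scalarCurvature (twistorMetric (S := S)) z /
      (4 * (2 * n + 1 : ℕ) * ((2 * n + 1 : ℕ) + 1)) * 2 =
      scalarCurvature g.inner z.pt / (4 * n * (n + 2)) / 2 := by
  have hn : (0 : ℝ) < n := by
    have := S.two_le; exact_mod_cast (by omega : 0 < n)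
  rw [scalarCurvature_twistorMetric hJ hJJ hpos]
  generalize scalarCurvature g.inner z.pt = κ
  push_cast
  field_simp
  ring

theorem quaternionicBisectionalCurvature_eq {J K : EndT E z.pt} (hJ : J ∈ QMinus z) (hK : K ∈ QMinus z)
    (hJJ : gammaEnd J J = 1) (hKK : gammaEnd K K = 1) (hJK : gammaEnd J K = 0)
    (X Y : TangentSpace 𝓘(ℝ, E) z.pt) : quaternionicBisectionalCurvature z J K X Y =
      g.inner z.pt (riemannCurvature g.inner z.pt X (z.cx X) (z.cx Y)) Y +
      scalarCurvature g.inner z.pt / (4 * n * (n + 2)) / 2 *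
        (g.inner z.pt (J X) Y ^ 2 + g.inner z.pt (z.cx (J X)) Y ^ 2) := by
  have hn : (0 : ℝ) < n := by
    have := S.two_le; exact_mod_cast (by omega : 0 < n)
  have hc : ∀ κ : ℝ, κ / (8 * n * (n + 2)) = κ / (4 * n * (n + 2)) / 2 := fun κ ↦ by
    field_simp
    ring
  rw [quaternionicBisectionalCurvature, hc, inner_sq_eq hJ hJJ hK hKK hJK]

theorem bisectionalCurvature_eq_add {J : EndT E z.pt} (hJ : J ∈ QMinus z)
    (hJJ : gammaEnd J J = 1) (hpos : 0 < scalarCurvature g.inner z.pt)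
    (X Y : TangentSpace 𝓘(ℝ, E) z.pt) (x y : QMinus z) :
    bisectionalCurvature z ((split z).symm (X, x)) ((split z).symm (Y, y)) =
      g.inner z.pt (riemannCurvature g.inner z.pt X (z.cx X) (z.cx Y)) Y +
      scalarCurvature g.inner z.pt / (4 * n * (n + 2)) / 2 *
        (g.inner z.pt (J X) Y ^ 2 + g.inner z.pt (z.cx (J X)) Y ^ 2) +
      cpBisectionalCurvature z ((split z).symm (X, x)) ((split z).symm (Y, y)) -
      cpBisectionalCurvature z ((split z).symm (X, 0)) ((split z).symm (Y, 0)) := by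
  rw [bisectionalCurvature_eq hJ hJJ hpos, cpBisectionalCurvature_split_symm_zero,
    cpBisectionalCurvature_eq, scalarCurvature_twistorMetric_div hJ hJJ hpos,
    LinearEquiv.apply_symm_apply, LinearEquiv.apply_symm_apply]

end TwistorSpace

end TwistorCurvature

end

open TwistorCurvature TwistorCurvature.TwistorSpace in
theorem proposition3p2 {n : ℕ} {E : Type*} [NormedAddCommGroup E] [NormedSpace ℝ E]
    [FiniteDimensional ℝ E] {M : Type*} [TopologicalSpace M] [T2Space M]
    [SecondCountableTopology M] [ChartedSpace E M] [IsManifold 𝓘(ℝ, E) ∞ M]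
    (g : Bundle.ContMDiffRiemannianMetric 𝓘(ℝ, E) ∞ E (fun p : M ↦ TangentSpace 𝓘(ℝ, E) p))
    (S : QuaternionKahlerStructure n g)
    (hpos : ∀ p : M, 0 < scalarCurvature g.inner p)
    (z : TwistorSpace S) (J K : EndT E z.pt) (hJ : J ∈ QMinus z) (hK : K ∈ QMinus z)
    (hJJ : gammaEnd J J = 1) (hKK : gammaEnd K K = 1) (hJK : gammaEnd J K = 0)
    (X Y : TangentSpace 𝓘(ℝ, E) z.pt) (x y : QMinus z) :
    bisectionalCurvature z ((split z).symm (X, x)) ((split z).symm (Y, y)) =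
      quaternionicBisectionalCurvature z J K X Y +
        cpBisectionalCurvature z ((split z).symm (X, x)) ((split z).symm (Y, y)) -
        cpBisectionalCurvature z ((split z).symm (X, 0)) ((split z).symm (Y, 0)) := by
  rw [quaternionicBisectionalCurvature_eq hJ hK hJJ hKK hJK]
  exact bisectionalCurvature_eq_add hJ hJJ (hpos z.pt) X Y x y
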